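/- **Setting.** Let $\Bbbk$ be a field, $A=\Bbbk[x_1,\dots,x_n]$ a standard graded polynomial ring in finitely many variables, $\mathfrak a\subseteq A$ a homogeneous ideal and $R=A/\mathfrak a$. Let $t$ be a positive integer or $t=\infty$, let $B=A[z]$ with $\deg z=1$, and let $S=R[z]/(z^t)=B/(\mathfrak aB+(z^t))$, where $z^\infty=0$. By an $R$-ideal we mean a homogeneous ideal of $R$. For a homogeneous ideal $I$ (of $R$ or of $S$), $H_I$ is the Hilbert series of $I$ (not of the quotient by $I$); Hilbert series are ordered coefficientwise ($\preccurlyeq$), ideals by inclusion. Let $\mathcal I_R$, $\mathcal I_S$ be the posets of homogeneous ideals and $\mathcal H_R$ the poset of Hilbert series of ideals in $\mathcal I_R$. Suppose that $\mathcal H_R$ admits an embedding, i.e. we are given an embedding of posets $\epsilon_R:\mathcal H_R\hookrightarrow\mathcal I_R$ with $H_{\epsilon_R(h)}=h$ for all $h\in\mathcal H_R$. For an ideal $J$ of $S$ put $J_{\langle i\rangle}=(J:_Sz^i)\cap R$. Give $S$ the $\mathbb N^2$-grading with $\deg x_l=(1,0)$, $\deg z=(0,1)$. An ideal $J$ of $S$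 is *$z$-stable* if it is homogeneous for this $\mathbb N^2$-grading and $\mathfrak m_RJ_{\langle i\rangle}\subseteq J_{\langle i-1\rangle}$ for all integers $0<i<t$, where $\mathfrak m_R$ is the ideal of $R$ generated by the images of the variables. Let $\mathcal H_S^{\mathrm{stab}}=\{H_J: J\ z\text{-stable}\}$, with Hilbert series taken in the standard grading. For a finitely generated graded module $M$ over a standard graded polynomial ring $P$ over $\Bbbk$, let $\beta^P_{i,j}(M)=\dim_\Bbbk\operatorname{Tor}^P_i(M,\Bbbk)_j$ and $\beta^P(M)=\sum_{i,j}\beta^P_{i,j}(M)\,\mathbf e_{i,j}$. We say that $\beta^P(M)$ is obtained from $\beta^P(N)$ by *consecutive cancellations* if there are $n_{i,j}\in\mathbb N$ with $\beta^P(N)=\beta^P(M)+\sum_{i,j}n_{i,j}(\mathbf e_{i,j}+\mathbf e_{i+1,j})$. **Statement.** There is exactly one embedding of posets $\epsilon_S:\mathcal H_S^{\mathrm{stab}}\hookrightarrow\mathcal I_S$ (the embedding induced by $\epsilon_R$) such that $H_{\epsilon_S(h)}=h$ for all $h$; every ideal $L$ in the image of $\epsilon_S$ is $z$-stable and $L_{\langle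 i\rangle}$ is in the image of $\epsilon_R$ for all $0\le i<t$; and $H_{\epsilon_S(H_J)+(z^i)}\preccurlyeq H_{J+(z^i)}$ for all $z$-stable ideals $J$ of $S$ and all $0\le i<t$. For this $\epsilon_S$ the following holds. If for every $R$-ideal $I$ the Betti table $\beta^A(R/I)$ is obtained from $\beta^A(R/\epsilon_R(H_I))$ by consecutive cancellations, then for every $z$-stable ideal $J$ of $S$ the Betti table $\beta^B(S/J)$ is obtained from $\beta^B(S/\epsilon_S(H_J))$ by consecutive cancellations. -/

import Mathlib

open MvPolynomial

noncomputable section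

namespace PosetEmbedding

universe u v w

/-! ### Graded pieces, graded ideals and Hilbert series -/

section Graded

variable {k : Type u} [Field k]

/-- An ideal is graded, with respect to a family `𝒯` of homogeneous pieces, if it is generated by
the homogeneous elements that it contains. -/
def IsGradedIdeal {T : Type w} [CommRing T] [Algebra k T] {ι : Type*}
    (𝒯 : ι → Submodule k T) (I : Ideal T) : Prop :=
  I = Ideal.span {x : T | x ∈ I ∧ ∃ d, x ∈ 𝒯 d}

/-- For a quotient `T` of the polynomial ring `k[τ]`, the piece of degree `d` for the standard
grading: the image in `T` of the forms of degree `d`. -/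
def piece (k : Type u) [Field k] (τ : Type v) (T : Type w) [CommRing T] [Algebra k T]
    [Algebra (MvPolynomial τ k) T] [IsScalarTower k (MvPolynomial τ k) T] (d : ℕ) :
    Submodule k T :=
  (homogeneousSubmodule τ k d).map (IsScalarTower.toAlgHom k (MvPolynomial τ k) T).toLinearMap

/-- The coefficients `d ↦ dim_k I_d` of the Hilbert series of an ideal `I` (not of the quotient
by `I`) of a quotient `T` of `k[τ]`. Hilbert series are recorded by their coefficient sequences;
the order on `ℕ → ℕ` is the coefficientwise one. -/
def hilb (k : Type u) [Field k] (τ : Type v) {T : Type w} [CommRing T] [Algebra k T]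
    [Algebra (MvPolynomial τ k) T] [IsScalarTower k (MvPolynomial τ k) T] (I : Ideal T) : ℕ → ℕ :=
  fun d => Module.finrank k ↥(I.restrictScalars k ⊓ piece k τ T d)

/-- The poset (by inclusion) of homogeneous ideals of a quotient `T` of `k[τ]`. -/
def idealPoset (k : Type u) [Field k] (τ : Type v) (T : Type w) [CommRing T] [Algebra k T]
    [Algebra (MvPolynomial τ k) T] [IsScalarTower k (MvPolynomial τ k) T] : Set (Ideal T) :=
  {I | IsGradedIdeal (piece k τ T) I}

/-- The poset of Hilbert series of homogeneous ideals of a quotient `T` of `k[τ]`. -/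
def hilbertPoset (k : Type u) [Field k] (τ : Type v) (T : Type w) [CommRing T] [Algebra k T]
    [Algebra (MvPolynomial τ k) T] [IsScalarTower k (MvPolynomial τ k) T] : Set (ℕ → ℕ) :=
  {h | ∃ I ∈ idealPoset k τ T, hilb k τ I = h}

/-- The Hilbert series of a homogeneous ideal, as an element of the poset of Hilbert series. -/
def hilbOf {τ : Type v} {T : Type w} [CommRing T] [Algebra k T]
    [Algebra (MvPolynomial τ k) T] [IsScalarTower k (MvPolynomial τ k) T]
    (I : ↥(idealPoset k τ T)) : ↥(hilbertPoset k τ T) :=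
  ⟨hilb k τ I.1, I.1, I.2, rfl⟩

end Graded

/-! ### Graded Betti numbers -/

section Betti

variable {k : Type u} [Field k] {τ : Type v}

/-- A graded resolution, by graded free modules of finite rank over the standard graded polynomial
ring `P = k[τ]`, of a `P`-module `M` with homogeneous pieces `ℳ d`. The `i`-th free module
is `⨁_a P(-deg i a)`; the differentials are given by matrices and preserve degrees, and the
augmentation sends the `a`-th basis vector of the `0`-th free module to `gen a`. -/
structure GradedFreeResolution (τ : Type v) {M : Type w} [AddCommGroup M] [Module k M]
    [Module (MvPolynomial τ k) M] (ℳ : ℕ → Submodule k M) where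
  rank : ℕ → ℕ
  deg : ∀ i, Fin (rank i) → ℕ
  gen : Fin (rank 0) → M
  diff : ∀ i, Matrix (Fin (rank i)) (Fin (rank (i + 1))) (MvPolynomial τ k)
  gen_mem : ∀ a, gen a ∈ ℳ (deg 0 a)
  diff_homogeneous : ∀ i b a, diff i b a = 0 ∨
    (deg i b ≤ deg (i + 1) a ∧ (diff i b a).IsHomogeneous (deg (i + 1) a - deg i b))
  gen_surjective : Function.Surjective (Fintype.linearCombination (MvPolynomial τ k) gen)
  exact_zero : Function.Exact (diff 0).mulVecLin
    (Fintype.linearCombination (MvPolynomial τ k) gen)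
  exact_succ : ∀ i, Function.Exact (diff (i + 1)).mulVecLin (diff i).mulVecLin

namespace GradedFreeResolution

variable {M : Type w} [AddCommGroup M] [Module k M] [Module (MvPolynomial τ k) M]
  {ℳ : ℕ → Submodule k M} (F : GradedFreeResolution τ ℳ)

/-- The differential of the complex `F ⊗_P k`, where `k = P / (variables)`. -/
def redDiff (i : ℕ) : (Fin (F.rank (i + 1)) → k) →ₗ[k] (Fin (F.rank i) → k) :=
  ((F.diff i).map (constantCoeff : MvPolynomial τ k →+* k)).mulVecLin

/-- The part of internal degree `j` of `F_i ⊗_P k`. -/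
def strand (i j : ℕ) : Submodule k (Fin (F.rank i) → k) where
  carrier := {v | ∀ a, F.deg i a ≠ j → v a = 0}
  add_mem' hv hw a ha := by simp [hv a ha, hw a ha]
  zero_mem' _ _ := rfl
  smul_mem' c v hv a ha := by simp [hv a ha]

/-- The cycles of homological degree `i` and internal degree `j` in `F ⊗_P k`. -/
def cycles : (i j : ℕ) → Submodule k (Fin (F.rank i) → k)
  | 0, j => F.strand 0 j
  | i + 1, j => F.strand (i + 1) j ⊓ LinearMap.ker (F.redDiff i)

/-- The boundaries of homological degree `i` and internal degree `j` in `F ⊗_P k`. -/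
def boundaries (i j : ℕ) : Submodule k (Fin (F.rank i) → k) :=
  (F.strand (i + 1) j).map (F.redDiff i)

/-- `dim_k Tor_i^P(M, k)_j`, where `Tor_i^P(M, k)_j = H_i(F ⊗_P k)_j`. -/
def torDim (i j : ℕ) : ℕ :=
  Module.finrank k (↥(F.cycles i j) ⧸ (F.boundaries i j).submoduleOf (F.cycles i j))

end GradedFreeResolution

open Classical in
/-- The graded Betti number `β_{i,j}(M) = dim_k Tor_i^P(M, k)_j` of a finitely generated graded
module `M` over `P = k[τ]` (`τ` finite), with Tor computed from a graded free resolution of `M`;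
it does not depend on the resolution. Only modules that live in degrees `≥ 0` occur, so the
internal degree `j` is a natural number. -/
def betti {M : Type w} [AddCommGroup M] [Module k M] [Module (MvPolynomial τ k) M]
    (ℳ : ℕ → Submodule k M) (i j : ℕ) : ℕ :=
  if h : Nonempty (GradedFreeResolution τ ℳ) then h.some.torDim i j else 0

/-- The Betti table over `k[τ]` of a graded quotient ring `T` of `k[τ]`. -/
def bettiTable (k : Type u) [Field k] (τ : Type v) (T : Type w) [CommRing T] [Algebra k T]
    [Algebra (MvPolynomial τ k) T] [IsScalarTower k (MvPolynomial τ k) T] : ℕ → ℕ → ℕ :=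
  betti (τ := τ) (piece k τ T)

/-- The table `β` is obtained from the table `β'` by consecutive cancellations: there are
natural numbers `n i j` with `β' = β + ∑_{i,j} n i j • (e_{i,j} + e_{i+1,j})`. -/
def ObtainedByConsecutiveCancellations (β β' : ℕ → ℕ → ℕ) : Prop :=
  ∃ n : ℕ → ℕ → ℕ, (∀ j, β' 0 j = β 0 j + n 0 j) ∧
    ∀ i j, β' (i + 1) j = β (i + 1) j + n (i + 1) j + n i j

end Betti

/-! ### The extension ring `S = R[z]/(z^t)` of `R = A/𝔞` -/

section Extension

variable {k : Type u} [Field k] {σ : Type v}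

/-- The element `z^t` of `B = A[z]`, where `A = k[σ]`, with `z^∞ = 0`. The variables of `B` are
indexed by `Option σ`, and `none` is the index of `z`. -/
def zPow (k : Type u) [Field k] (σ : Type v) : ℕ∞ → MvPolynomial (Option σ) k
  | ⊤ => 0
  | (m : ℕ) => X none ^ m

/-- The ideal `𝔞B + (z^t)` of `B = A[z]`. -/
def extIdeal (𝔞 : Ideal (MvPolynomial σ k)) (t : ℕ∞) : Ideal (MvPolynomial (Option σ) k) :=
  𝔞.map (rename some : MvPolynomial σ k →ₐ[k] MvPolynomial (Option σ) k) ⊔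
    Ideal.span {zPow k σ t}

/-- The ring `R = A/𝔞`. -/
abbrev BaseRing (𝔞 : Ideal (MvPolynomial σ k)) : Type (max u v) :=
  MvPolynomial σ k ⧸ 𝔞

/-- The ring `S = R[z]/(z^t) = B/(𝔞B + (z^t))`. -/
abbrev ExtRing (𝔞 : Ideal (MvPolynomial σ k)) (t : ℕ∞) : Type (max u v) :=
  MvPolynomial (Option σ) k ⧸ extIdeal 𝔞 t

variable (𝔞 : Ideal (MvPolynomial σ k)) (t : ℕ∞)

/-- The ring map `R → S`. -/
def baseToExt : BaseRing 𝔞 →+* ExtRing 𝔞 t :=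
  Ideal.quotientMap (extIdeal 𝔞 t)
    (rename some : MvPolynomial σ k →ₐ[k] MvPolynomial (Option σ) k).toRingHom
    (Ideal.map_le_iff_le_comap.mp le_sup_left)

/-- The image of `z` in `S`. -/
def zElt : ExtRing 𝔞 t := Ideal.Quotient.mk (extIdeal 𝔞 t) (X none)

/-- The homogeneous maximal ideal of `R`, generated by the images of the variables. -/
def maxIdeal : Ideal (BaseRing 𝔞) :=
  Ideal.span (Set.range fun s : σ => Ideal.Quotient.mk 𝔞 (X s))

/-- The weights `deg x_s = (1, 0)` and `deg z = (0, 1)`. -/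
def bidegree : Option σ → ℕ × ℕ
  | some _ => (1, 0)
  | none => (0, 1)

/-- The piece of `S` of bidegree `p`. -/
def bipiece (p : ℕ × ℕ) : Submodule k (ExtRing 𝔞 t) :=
  (weightedHomogeneousSubmodule k bidegree p).map
    (Ideal.Quotient.mkₐ k (extIdeal 𝔞 t)).toLinearMap

variable {𝔞 t}

/-- The ideal `J_⟨i⟩ = (J :_S z^i) ∩ R` of `R`. -/
def slice (J : Ideal (ExtRing 𝔞 t)) (i : ℕ) : Ideal (BaseRing 𝔞) :=
  Ideal.comap (baseToExt 𝔞 t) (Submodule.colon J {zElt 𝔞 t ^ i})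

/-- `z`-stable ideals of `S`: the multigraded ideals `J` with `𝔪_R J_⟨i⟩ ⊆ J_⟨i-1⟩` for all
`0 < i < t`. -/
def IsZStable (J : Ideal (ExtRing 𝔞 t)) : Prop :=
  IsGradedIdeal (bipiece 𝔞 t) J ∧
    ∀ i : ℕ, ((i + 1 : ℕ) : ℕ∞) < t → maxIdeal 𝔞 * slice J (i + 1) ≤ slice J i

variable (𝔞 t)

/-- The poset of Hilbert series (for the standard grading of `S`) of `z`-stable ideals of `S`. -/
def stableHilbertPoset : Set (ℕ → ℕ) :=
  {h | ∃ J : Ideal (ExtRing 𝔞 t), IsZStable J ∧ hilb k (Option σ) J = h}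

variable {𝔞 t}

/-- The Hilbert series of a `z`-stable ideal, as an element of the poset of such series. -/
def stableHilbOf (J : {J : Ideal (ExtRing 𝔞 t) // IsZStable J}) : ↥(stableHilbertPoset 𝔞 t) :=
  ⟨hilb k (Option σ) J.1, J.1, J.2, rfl⟩

/-- `ε_R` is an embedding of the poset of Hilbert series of homogeneous `R`-ideals into the
poset of homogeneous `R`-ideals, i.e. (besides being a poset embedding) `H ∘ ε_R = id`. -/
def IsHilbertEmbedding
    (εR : ↥(hilbertPoset k σ (BaseRing 𝔞)) ↪o ↥(idealPoset k σ (BaseRing 𝔞))) : Prop :=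
  ∀ h, hilb k σ (εR h).1 = h.1

/-- `ε_S` is the embedding induced by `ε_R` on the Hilbert series of `z`-stable `S`-ideals. -/
structure IsInducedEmbedding
    (εR : ↥(hilbertPoset k σ (BaseRing 𝔞)) ↪o ↥(idealPoset k σ (BaseRing 𝔞)))
    (εS : ↥(stableHilbertPoset 𝔞 t) ↪o ↥(idealPoset k (Option σ) (ExtRing 𝔞 t))) : Prop where
  /-- The Hilbert series of `ε_S(H)` is `H`. -/
  hilb_eq : ∀ h, hilb k (Option σ) (εS h).1 = h.1
  /-- The values of `ε_S` are multigraded and `z`-stable. -/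
  isZStable : ∀ h, IsZStable (εS h).1
  /-- If `L` is a value of `ε_S`, then every `L_⟨i⟩`, `i < t`, is in the image of `ε_R`. -/
  slice_mem : ∀ h, ∀ i : ℕ, (i : ℕ∞) < t → ∃ g, ((εR g).1 : Ideal (BaseRing 𝔞)) = slice (εS h).1 i
  /-- If `J` is `z`-stable and `L = ε_S(H_J)`, then `H_{L+(z^i)} ≼ H_{J+(z^i)}` for `i < t`. -/
  restriction : ∀ J : {J : Ideal (ExtRing 𝔞 t) // IsZStable J}, ∀ i : ℕ, (i : ℕ∞) < t →
    hilb k (Option σ) ((εS (stableHilbOf J)).1 ⊔ Ideal.span {zElt 𝔞 t ^ i}) ≤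
      hilb k (Option σ) (J.1 ⊔ Ideal.span {zElt 𝔞 t ^ i})

end Extension

end PosetEmbedding

end

/-!
All ideals are replaced by their preimages: ideals of `R` by homogeneous ideals of `A = k[σ]` that
contain `𝔞`, and a `z`-stable ideal of `S` by the increasing family of its slices
`𝒥 0 ≤ 𝒥 1 ≤ ⋯`, so that its preimage in `B = A[z]` is `⨁ 𝒥 l z ^ l`
(`IsZStable.comap_eq`, `IsStableFamily`). The variable `z` is `X none` in `MvPolynomial (Option σ)`.

*The embedding.* An ideal of `A` over `𝔞` can be changed freely in degrees below and above a given
one (`exists_splice`). Therefore the piece of degree `d` of `ε_R I` depends only on `d` and on the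
dimension of the piece of `I`, in a monotone way, and these pieces form a complete flag above `𝔞`
in each degree (`IsHilbertLift.inf_zhom_eq_flag`, `IsHilbertLift.finrank_flag`). An ideal in the
image of `ε_R` is thus a sequence of dimensions. Moreover `𝔪 I ≤ I'` for `I' ≤ I` yields the same
relation between the members of the flags with the dimensions of `I` and `I'`
(`IsHilbertLift.flagRel`). Hence the dimensions of the slices of a `z`-stable ideal in total degree
`D` form a sequence that satisfies bounds and a monotone relation between consecutive terms, and it
is natural to replace it by a sequence of the same kind with the same total and minimal partial
sums. The pointwise minima of the partial sums of such sequences come again from such a sequence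
(`isStableSeq_of_local`), so there is an optimal one (`exists_isOptimalSeq`), and the optimal
sequences increase with the total (`IsOptimalSeq.mono`). The members of the flags with these
dimensions are the slices of an ideal of `S` because optimal sequences grow as slowly as possible
from one total degree to the next (`IsOptimalSeq.shift_le`). This ideal is the value of `ε_S`; the
minimality of the partial sums is the condition on `H_{J + (z ^ i)}`. That condition, applied to two
embeddings in both directions, gives uniqueness (`IsInducedEmbedding.eq`).

*The Betti tables.* Betti numbers are computed by the Koszul complex (`torDim_eq_homDim`). For two
ideals with the same Hilbert function the Koszul chains have the same dimensions, and so the Betti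
tables differ by consecutive cancellations if and only if the ranks of the Koszul boundaries modulo
the ideals satisfy inequalities
(`obtainedByConsecutiveCancellations_iff_finrank_idealBounds`). The Koszul complex of `B` is the
mapping cone of `z` on that of `A`. Modulo `⨁ 𝒥 l z ^ l`, the stability condition makes the
contributions of the intermediate slices to the boundaries depend on their dimensions only; what
remains are the Koszul boundaries modulo the first slice `𝒥 0` and, if `t` is finite, modulo the
last slice `𝒥 (t - 1)` (`KoszulMatrices.mem_cone_idealBounds_succ`, `finrank_cone_idealBounds_le`).
If `ℒ` is the family of slices of the value of `ε_S`, minimality of the partial sums gives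
`ℒ 0 ≤ ε_R (𝒥 0)` and `ε_R (𝒥 (t - 1)) ≤ ℒ (t - 1)`, and these inclusions go in the directions
that the required inequalities need (`finrank_cone_idealBounds_inducedFamily_le`).
-/

open MvPolynomial

noncomputable section

namespace PosetEmbedding

universe u v w

/-! ### Dimension counts for linear maps -/

section LinearAlgebra

variable {k : Type*} [Field k] {V W : Type*} [AddCommGroup V] [Module k V] [AddCommGroup W]
  [Module k W]

lemma finrank_map_add_finrank_inf_ker (f : V →ₗ[k] W) (X : Submodule k V)
    [FiniteDimensional k X] :
    Module.finrank k (X.map f) + Module.finrank k ↥(X ⊓ LinearMap.ker f) =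
      Module.finrank k X := by
  have h := LinearMap.finrank_range_add_finrank_ker (f.domRestrict X)
  rw [LinearMap.range_domRestrict, LinearMap.ker_domRestrict] at h
  rw [← h, ← Submodule.map_comap_subtype, ← (Submodule.equivSubtypeMap X _).finrank_eq]

/-- If `Y ≤ X` contains the part of the kernel of `f` in `X`, then `X / Y ≅ f(X) / f(Y)`. -/
lemma finrank_add_finrank_map_eq (f : V →ₗ[k] W) {X Y : Submodule k V} [FiniteDimensional k X]
    (hYX : Y ≤ X) (hker : X ⊓ LinearMap.ker f ≤ Y) :
    Module.finrank k X + Module.finrank k (Y.map f) =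
      Module.finrank k Y + Module.finrank k (X.map f) := by
  have : FiniteDimensional k Y := Submodule.finiteDimensional_of_le hYX
  have hX := finrank_map_add_finrank_inf_ker f X
  have hY := finrank_map_add_finrank_inf_ker f Y
  have h : X ⊓ LinearMap.ker f = Y ⊓ LinearMap.ker f :=
    le_antisymm (le_inf hker inf_le_right) (inf_le_inf_right _ hYX)
  rw [h] at hX
  omega

lemma finrank_map_of_injOn (f : V →ₗ[k] W) {X : Submodule k V} [FiniteDimensional k X]
    (h : ∀ x ∈ X, f x = 0 → x = 0) : Module.finrank k (X.map f) = Module.finrank k X := by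
  have hX := finrank_map_add_finrank_inf_ker f X
  have h0 : X ⊓ LinearMap.ker f = ⊥ := by
    rw [eq_bot_iff]
    rintro x ⟨hx, hfx⟩
    exact h x hx hfx
  rw [h0, finrank_bot] at hX
  omega

/-- A product of subspaces, as a subspace, is the product of the subspaces. -/
def submodulePiEquiv {ι : Type*} {N : ι → Type*} [∀ i, AddCommGroup (N i)] [∀ i, Module k (N i)]
    (p : ∀ i, Submodule k (N i)) : ↥(Submodule.pi Set.univ p) ≃ₗ[k] ∀ i, ↥(p i) where
  toFun x i := ⟨x.1 i, x.2 i trivial⟩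
  map_add' _ _ := rfl
  map_smul' _ _ := rfl
  invFun y := ⟨fun i => (y i).1, fun i _ => (y i).2⟩
  left_inv _ := rfl
  right_inv _ := rfl

instance finiteDimensional_pi {ι : Type*} [Finite ι] {N : ι → Type*} [∀ i, AddCommGroup (N i)]
    [∀ i, Module k (N i)] (p : ∀ i, Submodule k (N i)) [∀ i, FiniteDimensional k (p i)] :
    FiniteDimensional k ↥(Submodule.pi Set.univ p) :=
  (submodulePiEquiv p).symm.finiteDimensional

lemma finrank_submodule_pi {ι : Type*} [Fintype ι] {N : ι → Type*} [∀ i, AddCommGroup (N i)]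
    [∀ i, Module k (N i)] (p : ∀ i, Submodule k (N i)) [∀ i, FiniteDimensional k (p i)] :
    Module.finrank k ↥(Submodule.pi Set.univ p) = ∑ i, Module.finrank k (p i) := by
  rw [(submodulePiEquiv p).finrank_eq, Module.finrank_pi_fintype]

/-- A product of two subspaces, as a subspace, is the product of the subspaces. -/
def submoduleProdEquiv (p : Submodule k V) (q : Submodule k W) : ↥(p.prod q) ≃ₗ[k] p × q where
  toFun x := (⟨x.1.1, x.2.1⟩, ⟨x.1.2, x.2.2⟩)
  map_add' _ _ := rfl
  map_smul' _ _ := rfl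
  invFun y := ⟨(y.1.1, y.2.1), y.1.2, y.2.2⟩
  left_inv _ := rfl
  right_inv _ := rfl

lemma finrank_submodule_prod (p : Submodule k V) (q : Submodule k W) [FiniteDimensional k p]
    [FiniteDimensional k q] :
    Module.finrank k ↥(p.prod q) = Module.finrank k p + Module.finrank k q := by
  rw [(submoduleProdEquiv p q).finrank_eq, Module.finrank_prod]

/-- Every dimension between those of two nested subspaces is the dimension of a subspace between
them. -/
lemma exists_submodule_finrank_eq {U X : Submodule k V} [FiniteDimensional k X] (hUX : U ≤ X)
    {r : ℕ} (h₁ : Module.finrank k U ≤ r) (h₂ : r ≤ Module.finrank k X) :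
    ∃ Y, U ≤ Y ∧ Y ≤ X ∧ Module.finrank k Y = r := by
  induction r, h₁ using Nat.le_induction with
  | base => exact ⟨U, le_rfl, hUX, rfl⟩
  | succ n hn ih =>
    obtain ⟨Y, hUY, hYX, hY⟩ := ih (by omega)
    have hlt : Y < X := lt_of_le_of_ne hYX (by rintro rfl; omega)
    obtain ⟨x, hxX, hxY⟩ := SetLike.exists_of_lt hlt
    have hle : Y ⊔ Submodule.span k {x} ≤ X :=
      sup_le hYX ((Submodule.span_singleton_le_iff_mem _ _).2 hxX)
    have : FiniteDimensional k Y := Submodule.finiteDimensional_of_le hYX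
    refine ⟨_, hUY.trans le_sup_left, hle, ?_⟩
    have h0 : Y ⊓ Submodule.span k {x} = ⊥ := by
      rw [eq_bot_iff]
      rintro y ⟨hy, hyx⟩
      obtain ⟨c, rfl⟩ := Submodule.mem_span_singleton.1 hyx
      by_cases hc : c = 0
      · simp [hc]
      · exact absurd (by simpa [smul_smul, hc] using Y.smul_mem c⁻¹ hy) hxY
    have := Submodule.finrank_sup_add_finrank_inf_eq Y (Submodule.span k {x})
    rw [h0, finrank_bot, hY, finrank_span_singleton] at this
    · omega
    · rintro rfl
      exact hxY Y.zero_mem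

end LinearAlgebra

/-! ### The grading of a polynomial ring by the integers -/

section Grading

variable (k : Type u) [Field k] (τ : Type v)

/-- The forms of degree `n` of the polynomial ring `k[τ]`, for an integer `n`: there are none but
`0` if `n` is negative. -/
def zhom (n : ℤ) : Submodule k (MvPolynomial τ k) where
  carrier := {p | ∀ u, coeff u p ≠ 0 → (u.degree : ℤ) = n}
  add_mem' {p q} hp hq u hu := by
    by_contra h
    have h₁ : coeff u p = 0 := not_not.1 fun h' => h (hp u h')
    have h₂ : coeff u q = 0 := not_not.1 fun h' => h (hq u h')
    exact hu (by rw [coeff_add, h₁, h₂, add_zero])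
  zero_mem' u hu := absurd (coeff_zero u) hu
  smul_mem' c p hp u hu := hp u fun h => hu (by rw [coeff_smul, h, smul_zero])

/-- The component of degree `n` of a polynomial, for an integer `n`. -/
def zcomp (n : ℤ) : MvPolynomial τ k →ₗ[k] MvPolynomial τ k :=
  if 0 ≤ n then homogeneousComponent n.toNat else 0

variable {k τ}

lemma weight_one_eq_degree (u : τ →₀ ℕ) : Finsupp.weight (1 : τ → ℕ) u = u.degree :=
  (DFunLike.congr_fun Finsupp.degree_eq_weight_one u).symm

lemma mem_zhom_natCast {d : ℕ} {p : MvPolynomial τ k} :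
    p ∈ zhom k τ d ↔ p.IsHomogeneous d := by
  refine ⟨fun h u hu => ?_, fun h u hu => ?_⟩
  · have := h u hu
    rw [weight_one_eq_degree]
    exact_mod_cast this
  · have := h hu
    rw [weight_one_eq_degree] at this
    exact_mod_cast this

lemma zhom_natCast (d : ℕ) : zhom k τ d = homogeneousSubmodule τ k d :=
  Submodule.ext fun _ => mem_zhom_natCast

lemma zhom_of_neg {n : ℤ} (hn : n < 0) : zhom k τ n = ⊥ := by
  rw [eq_bot_iff]
  intro p hp
  ext u
  by_contra h
  have := hp u h
  omega

lemma coeff_zcomp (n : ℤ) (u : τ →₀ ℕ) (p : MvPolynomial τ k) :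
    coeff u (zcomp k τ n p) = if (u.degree : ℤ) = n then coeff u p else 0 := by
  unfold zcomp
  split_ifs with h1 h2 h2
  · rw [coeff_homogeneousComponent, if_pos (by omega)]
  · rw [coeff_homogeneousComponent, if_neg (by omega)]
  · omega
  · simp

lemma zcomp_mem (n : ℤ) (p : MvPolynomial τ k) : zcomp k τ n p ∈ zhom k τ n := by
  intro u hu
  by_contra h
  exact hu (by rw [coeff_zcomp, if_neg h])

lemma zcomp_of_mem {n : ℤ} {p : MvPolynomial τ k} (hp : p ∈ zhom k τ n) :
    zcomp k τ n p = p := by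
  ext u
  rw [coeff_zcomp]
  split_ifs with h
  · rfl
  · by_contra h'
    exact h (hp u (Ne.symm h'))

lemma zcomp_of_mem_of_ne {n m : ℤ} {p : MvPolynomial τ k} (hp : p ∈ zhom k τ m) (h : n ≠ m) :
    zcomp k τ n p = 0 := by
  ext u
  rw [coeff_zcomp, coeff_zero]
  split_ifs with h'
  · by_contra h2
    exact h (h'.symm.trans (hp u h2))
  · rfl

lemma zcomp_natCast (d : ℕ) : zcomp k τ d = homogeneousComponent d := by
  simp [zcomp]

lemma mul_mem_zhom {d : ℤ} {p q : MvPolynomial τ k} {n : ℤ} (hp : p ∈ zhom k τ d)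
    (hq : q ∈ zhom k τ n) : p * q ∈ zhom k τ (n + d) := by
  classical
  intro u hu
  rw [coeff_mul] at hu
  obtain ⟨x, hx, hx'⟩ := Finset.exists_ne_zero_of_sum_ne_zero hu
  have h1 := hp x.1 (left_ne_zero_of_mul hx')
  have h2 := hq x.2 (right_ne_zero_of_mul hx')
  rw [← Finset.HasAntidiagonal.mem_antidiagonal.1 hx, map_add]
  push_cast
  omega

lemma zcomp_mul {d : ℤ} {p : MvPolynomial τ k} (hp : p ∈ zhom k τ d) (n : ℤ)
    (q : MvPolynomial τ k) : zcomp k τ n (p * q) = p * zcomp k τ (n - d) q := by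
  classical
  ext u
  have key : ∀ x ∈ Finset.HasAntidiagonal.antidiagonal u,
      coeff x.1 p * coeff x.2 (zcomp k τ (n - d) q) =
        if (u.degree : ℤ) = n then coeff x.1 p * coeff x.2 q else 0 := by
    intro x hx
    by_cases h : coeff x.1 p = 0
    · simp [h]
    have h1 := hp x.1 h
    have h2 : (u.degree : ℤ) = x.1.degree + x.2.degree := by
      rw [← Finset.HasAntidiagonal.mem_antidiagonal.1 hx, map_add, Nat.cast_add]
    rw [coeff_zcomp]
    by_cases h3 : (u.degree : ℤ) = n
    · rw [if_pos (by omega), if_pos h3]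
    · rw [if_neg (by omega), if_neg h3, mul_zero]
  rw [coeff_zcomp, coeff_mul, coeff_mul, Finset.sum_congr rfl key]
  split_ifs
  · rfl
  · simp

instance finiteDimensional_zhom [Finite τ] (n : ℤ) : FiniteDimensional k (zhom k τ n) := by
  rcases lt_or_ge n 0 with hn | hn
  · rw [zhom_of_neg hn]
    infer_instance
  · lift n to ℕ using hn
    rw [zhom_natCast]
    exact Module.Finite.iff_fg.2 (homogeneousSubmodule_fg τ k n)

end Grading

/-! ### Koszul complexes -/

/-- A linear free resolution of `k` over the polynomial ring `k[τ]`, starting in rank one, given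
by its matrices: the Koszul complex on the variables is one. The basis of the `i`-th free module
is indexed by `ι i` and sits in degree `i`. -/
structure KoszulMatrices (k : Type u) [Field k] (τ : Type v) where
  ι : ℕ → Type
  fintype : ∀ i, Fintype (ι i)
  unique : Unique (ι 0)
  diff : ∀ i, Matrix (ι i) (ι (i + 1)) (MvPolynomial τ k)
  diff_mem : ∀ i b a, diff i b a ∈ zhom k τ 1
  diff_mul : ∀ i, diff i * diff (i + 1) = 0
  exact_zero : ∀ v : ι 0 → MvPolynomial τ k, (∀ b, constantCoeff (v b) = 0) →
    ∃ w, (diff 0).mulVec w = v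
  exact_succ : ∀ i v, (diff i).mulVec v = 0 → ∃ w, (diff (i + 1)).mulVec w = v

attribute [instance] KoszulMatrices.fintype KoszulMatrices.unique

section Cone

variable {k : Type u} [Field k] {σ : Type v}

/-- The inclusion of `A = k[σ]` in `B = A[z]`. -/
def incl (k : Type u) [Field k] (σ : Type v) :
    MvPolynomial σ k →ₐ[k] MvPolynomial (Option σ) k :=
  rename some

/-- The retraction of `A[z]` onto `A` that sends `z` to `0`. -/
def evalZero (k : Type u) [Field k] (σ : Type v) :
    MvPolynomial (Option σ) k →ₐ[k] MvPolynomial σ k :=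
  aeval fun o => o.elim 0 X

lemma evalZero_incl (p : MvPolynomial σ k) : evalZero k σ (incl k σ p) = p := by
  have h : (evalZero k σ).comp (incl k σ) = AlgHom.id k _ := by
    ext s
    simp [evalZero, incl]
  exact DFunLike.congr_fun h p

lemma evalZero_z : evalZero k σ (X none) = 0 := by
  simp [evalZero]

lemma exists_eq_incl_add (p : MvPolynomial (Option σ) k) :
    ∃ q, p = incl k σ (evalZero k σ p) + X none * q := by
  induction p using MvPolynomial.induction_on with
  | C a => exact ⟨0, by simp [incl, evalZero]⟩
  | add p q hp hq =>
    obtain ⟨p', hp'⟩ := hp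
    obtain ⟨q', hq'⟩ := hq
    refine ⟨p' + q', ?_⟩
    rw [map_add, map_add, mul_add]
    linear_combination hp' + hq'
  | mul_X p o hp =>
    obtain ⟨p', hp'⟩ := hp
    cases o with
    | none => exact ⟨p, by rw [map_mul, evalZero_z, mul_zero, map_zero, zero_add, mul_comm]⟩
    | some s =>
      refine ⟨p' * X (some s), ?_⟩
      have : incl k σ (evalZero k σ (X (some s))) = X (some s) := by simp [incl, evalZero]
      rw [map_mul, map_mul, this]
      linear_combination X (some s) * hp'

lemma constantCoeff_evalZero (p : MvPolynomial (Option σ) k) :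
    constantCoeff (evalZero k σ p) = constantCoeff p := by
  have h : (constantCoeff.comp (evalZero k σ).toRingHom) =
      (constantCoeff : MvPolynomial (Option σ) k →+* k) := by
    ext o
    · simp [evalZero]
    · cases o <;> simp [evalZero]
  exact DFunLike.congr_fun h p

lemma incl_mem_zhom {n : ℤ} {p : MvPolynomial σ k} (hp : p ∈ zhom k σ n) :
    incl k σ p ∈ zhom k (Option σ) n := by
  rcases lt_or_ge n 0 with hn | hn
  · rw [zhom_of_neg hn, Submodule.mem_bot] at hp
    rw [hp, map_zero]
    exact Submodule.zero_mem _
  · lift n to ℕ using hn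
    exact mem_zhom_natCast.2 (mem_zhom_natCast.1 hp).rename_isHomogeneous

/-- A matrix over `A`, regarded as a matrix over `A[z]`. -/
def inclMatrix {α β : Type} (D : Matrix α β (MvPolynomial σ k)) :
    Matrix α β (MvPolynomial (Option σ) k) :=
  D.map (incl k σ)

lemma inclMatrix_mulVec {α β : Type} [Fintype β] (D : Matrix α β (MvPolynomial σ k))
    (w : β → MvPolynomial σ k) :
    (inclMatrix D).mulVec (fun b => incl k σ (w b)) = fun a => incl k σ (D.mulVec w a) := by
  ext1 a
  simp [inclMatrix, Matrix.mulVec, dotProduct]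

lemma evalZero_mulVec {α β : Type} [Fintype β] (D : Matrix α β (MvPolynomial σ k))
    (w : β → MvPolynomial (Option σ) k) (a : α) :
    evalZero k σ ((inclMatrix D).mulVec w a) = D.mulVec (fun b => evalZero k σ (w b)) a := by
  simp [inclMatrix, Matrix.mulVec, dotProduct, evalZero_incl]

/-- The exactness of the mapping cone of multiplication by `z`. -/
lemma exists_of_cone_cycle {α β γ : Type} [Fintype β] [Fintype γ]
    (D : Matrix α β (MvPolynomial σ k)) (D' : Matrix β γ (MvPolynomial σ k))
    (hex : ∀ v, D.mulVec v = 0 → ∃ w, D'.mulVec w = v)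
    (u : β → MvPolynomial (Option σ) k) (v : α → MvPolynomial (Option σ) k)
    (h : (inclMatrix D).mulVec u + (X none : MvPolynomial (Option σ) k) • v = 0) :
    ∃ w y, (inclMatrix D').mulVec w + (X none : MvPolynomial (Option σ) k) • y = u ∧
      -(inclMatrix D).mulVec y = v := by
  have h0 : D.mulVec (fun b => evalZero k σ (u b)) = 0 := by
    ext1 a
    have := congrArg (evalZero k σ) (congrFun h a)
    simpa [evalZero_mulVec, evalZero_z] using this
  obtain ⟨w, hw⟩ := hex _ h0
  choose y hy using fun b => exists_eq_incl_add (u b)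
  refine ⟨fun b => incl k σ (w b), y, ?_, ?_⟩
  · ext1 b
    rw [inclMatrix_mulVec, hw, Pi.add_apply, Pi.smul_apply, smul_eq_mul, ← hy]
  · have hu : u = (fun b => incl k σ (evalZero k σ (u b))) +
        (X none : MvPolynomial (Option σ) k) • y := by
      ext1 b
      exact hy b
    rw [hu, Matrix.mulVec_add, inclMatrix_mulVec, h0, Matrix.mulVec_smul] at h
    ext1 a
    have ha := congrFun h a
    simp only [Pi.zero_apply, map_zero, Pi.add_apply, Pi.smul_apply, smul_eq_mul, zero_add,
      ← mul_add] at ha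
    have hz : (X none : MvPolynomial (Option σ) k) ≠ 0 := X_ne_zero _
    rw [Pi.neg_apply]
    linear_combination -((mul_eq_zero.1 ha).resolve_left hz)

lemma diagonal_z_mulVec {α : Type} [Fintype α] [DecidableEq α]
    (v : α → MvPolynomial (Option σ) k) :
    (Matrix.diagonal fun _ => (X none : MvPolynomial (Option σ) k)).mulVec v =
      (X none : MvPolynomial (Option σ) k) • v := by
  ext1 a
  rw [Matrix.mulVec_diagonal, Pi.smul_apply, smul_eq_mul]

lemma fromCols_diagonal_z_mulVec {α β : Type} [Fintype α] [Fintype β] [DecidableEq α]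
    (D : Matrix α β (MvPolynomial (Option σ) k)) (u : β → MvPolynomial (Option σ) k)
    (v : α → MvPolynomial (Option σ) k) :
    (Matrix.fromCols D (Matrix.diagonal fun _ => X none)).mulVec (Sum.elim u v) =
      D.mulVec u + (X none : MvPolynomial (Option σ) k) • v := by
  rw [Matrix.fromCols_mulVec_sumElim, diagonal_z_mulVec]

namespace KoszulMatrices

variable (G : KoszulMatrices k σ)

/-- The index types of the mapping cone of multiplication by `z`. -/
def coneIndex : ℕ → Type
  | 0 => G.ι 0
  | i + 1 => G.ι (i + 1) ⊕ G.ι i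

open Classical in
/-- The differentials of the mapping cone of multiplication by `z`. -/
def coneDiff : ∀ i, Matrix (G.coneIndex i) (G.coneIndex (i + 1)) (MvPolynomial (Option σ) k)
  | 0 => Matrix.fromCols (inclMatrix (G.diff 0)) (Matrix.diagonal fun _ => X none)
  | i + 1 => Matrix.fromBlocks (inclMatrix (G.diff (i + 1))) (Matrix.diagonal fun _ => X none) 0
      (-inclMatrix (G.diff i))

instance coneFintype : ∀ i, Fintype (G.coneIndex i)
  | 0 => G.fintype 0
  | i + 1 => inferInstanceAs (Fintype (G.ι (i + 1) ⊕ G.ι i))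

lemma coneDiff_zero_mulVec (u : G.ι 1 → MvPolynomial (Option σ) k)
    (v : G.ι 0 → MvPolynomial (Option σ) k) :
    (G.coneDiff 0).mulVec (Sum.elim u v) =
      (inclMatrix (G.diff 0)).mulVec u + (X none : MvPolynomial (Option σ) k) • v := by
  exact @fromCols_diagonal_z_mulVec _ _ _ (G.ι 0) (G.ι 1) _ _
    (fun a b => Classical.propDecidable (a = b)) (inclMatrix (G.diff 0)) u v

lemma coneDiff_succ_mulVec (i : ℕ) (u : G.ι (i + 2) → MvPolynomial (Option σ) k)
    (v : G.ι (i + 1) → MvPolynomial (Option σ) k) :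
    (G.coneDiff (i + 1)).mulVec (Sum.elim u v) =
      Sum.elim ((inclMatrix (G.diff (i + 1))).mulVec u +
        (X none : MvPolynomial (Option σ) k) • v) (-(inclMatrix (G.diff i)).mulVec v) := by
  classical
  refine (Matrix.fromBlocks_mulVec _ _ _ _ _).trans ?_
  ext1 a
  rw [diagonal_z_mulVec]
  cases a <;> simp [Matrix.neg_mulVec]

lemma coneDiff_mul (i : ℕ) : G.coneDiff i * G.coneDiff (i + 1) = 0 := by
  have hD : ∀ i, inclMatrix (G.diff i) * inclMatrix (G.diff (i + 1)) = 0 := fun i => by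
    simp only [inclMatrix, ← Matrix.map_mul, G.diff_mul]
    ext a b
    simp
  classical
  suffices h : ∀ v, (G.coneDiff i).mulVec ((G.coneDiff (i + 1)).mulVec v) = 0 by
    refine Matrix.ext_of_mulVec_single fun b => ?_
    rw [← Matrix.mulVec_mulVec, h, Matrix.zero_mulVec]
  intro v
  obtain ⟨u, v, rfl⟩ : ∃ u v', v = Sum.elim u v' := ⟨_, _, (Sum.elim_comp_inl_inr v).symm⟩
  rw [coneDiff_succ_mulVec]
  cases i with
  | zero =>
    refine (G.coneDiff_zero_mulVec _ _).trans ?_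
    rw [Matrix.mulVec_add, Matrix.mulVec_mulVec, hD, Matrix.zero_mulVec, Matrix.mulVec_smul,
      zero_add, smul_neg]
    exact add_neg_cancel _
  | succ i =>
    refine (G.coneDiff_succ_mulVec _ _ _).trans ?_
    rw [Matrix.mulVec_add, Matrix.mulVec_mulVec, hD, Matrix.zero_mulVec, Matrix.mulVec_smul,
      zero_add, Matrix.mulVec_neg, Matrix.mulVec_mulVec, hD]
    ext1 a
    cases a <;> simp <;> rfl

/-- The mapping cone of multiplication by `z`. -/
def cone : KoszulMatrices k (Option σ) where
  ι := G.coneIndex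
  fintype := G.coneFintype
  unique := G.unique
  diff := G.coneDiff
  diff_mem i b a := by
    classical
    have hz : (X none : MvPolynomial (Option σ) k) ∈ zhom k (Option σ) 1 :=
      mem_zhom_natCast.2 (isHomogeneous_X _ _)
    have hdiag : ∀ {α : Type} (b a : α), Matrix.diagonal
        (fun _ => (X none : MvPolynomial (Option σ) k)) b a ∈ zhom k (Option σ) 1 := by
      intro α b a
      rw [Matrix.diagonal_apply]
      split_ifs
      · exact hz
      · exact Submodule.zero_mem _
    cases i with
    | zero =>
      rcases a with a | a
      · exact incl_mem_zhom (G.diff_mem 0 b a)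
      · exact hdiag b a
    | succ i =>
      rcases a with a | a <;> rcases b with b | b
      · exact incl_mem_zhom (G.diff_mem _ b a)
      · exact Submodule.zero_mem _
      · exact hdiag b a
      · exact Submodule.neg_mem _ (incl_mem_zhom (G.diff_mem _ b a))
  diff_mul := G.coneDiff_mul
  exact_zero v hv := by
    obtain ⟨w, hw⟩ := G.exact_zero (fun b => evalZero k σ (v b)) fun b => by
      rw [constantCoeff_evalZero]
      exact hv b
    choose y hy using fun b => exists_eq_incl_add (v b)
    refine ⟨Sum.elim (fun b => incl k σ (w b)) y, ?_⟩
    refine (G.coneDiff_zero_mulVec _ _).trans ?_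
    rw [inclMatrix_mulVec, hw]
    ext1 b
    exact (hy b).symm
  exact_succ i v hv := by
    obtain ⟨u, v, rfl⟩ : ∃ u v', v = Sum.elim u v' :=
      ⟨_, _, (Sum.elim_comp_inl_inr v).symm⟩
    cases i with
    | zero =>
      have hv' := (G.coneDiff_zero_mulVec u v).symm.trans hv
      obtain ⟨w, y, hw, hy⟩ := exists_of_cone_cycle _ _ (G.exact_succ 0) u v hv'
      exact ⟨Sum.elim w y, by rw [coneDiff_succ_mulVec, hw, hy]⟩
    | succ i =>
      have hv' := (G.coneDiff_succ_mulVec i u v).symm.trans hv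
      have hv2 : (inclMatrix (G.diff (i + 1))).mulVec u +
          (X none : MvPolynomial (Option σ) k) • v = 0 :=
        funext fun a => congrFun hv' (Sum.inl a)
      obtain ⟨w, y, hw, hy⟩ := exists_of_cone_cycle _ _ (G.exact_succ _) u v hv2
      exact ⟨Sum.elim w y, by rw [coneDiff_succ_mulVec, hw, hy]⟩

/-- The resolution of `k` over the polynomial ring in no variables. -/
def ofIsEmpty (k : Type u) [Field k] (τ : Type v) [IsEmpty τ] : KoszulMatrices k τ where
  ι i := match i with
    | 0 => Unit
    | _ + 1 => Empty
  fintype i := match i with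
    | 0 => inferInstanceAs (Fintype Unit)
    | _ + 1 => inferInstanceAs (Fintype Empty)
  unique := inferInstanceAs (Unique Unit)
  diff _ := 0
  diff_mem _ _ _ := Submodule.zero_mem _
  diff_mul _ := by simp
  exact_zero v hv := by
    refine ⟨0, funext fun b => ?_⟩
    have := eq_C_of_isEmpty (v b)
    rw [this]
    have h := hv b
    rw [constantCoeff_eq] at h
    simp [h]
  exact_succ i v _ := ⟨0, funext fun b => Empty.elim b⟩

/-- The transport of a resolution of `k` along a bijection of the variables. -/
def ofEquiv {τ : Type w} (e : σ ≃ τ) : KoszulMatrices k τ where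
  ι := G.ι
  fintype := G.fintype
  unique := G.unique
  diff i := (G.diff i).map (rename e)
  diff_mem i b a := mem_zhom_natCast.2 (mem_zhom_natCast.1 (G.diff_mem i b a)).rename_isHomogeneous
  diff_mul i := by
    rw [← Matrix.map_mul, G.diff_mul]
    ext a b
    simp
  exact_zero v hv := by
    obtain ⟨w, hw⟩ := G.exact_zero (fun b => rename e.symm (v b)) fun b => by
      rw [constantCoeff_rename]
      exact hv b
    refine ⟨fun b => rename e (w b), funext fun b => ?_⟩
    have := congrArg (rename e) (congrFun hw b)
    rw [rename_rename, Equiv.self_comp_symm, rename_id_apply] at this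
    rw [← this]
    simp [Matrix.mulVec, dotProduct]
  exact_succ i v hv := by
    have hv' : (G.diff i).mulVec (fun b => rename e.symm (v b)) = 0 := by
      ext1 b
      have := congrArg (rename e.symm) (congrFun hv b)
      simpa [Matrix.mulVec, dotProduct, rename_rename] using this
    obtain ⟨w, hw⟩ := G.exact_succ i _ hv'
    refine ⟨fun b => rename e (w b), funext fun b => ?_⟩
    have := congrArg (rename e) (congrFun hw b)
    rw [rename_rename, Equiv.self_comp_symm, rename_id_apply] at this
    rw [← this]
    simp [Matrix.mulVec, dotProduct]

end KoszulMatrices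

/-- Induction on the number of variables, with the mapping cone as the inductive step. -/
lemma nonempty_koszulMatrices (k : Type u) [Field k] (τ : Type v) [Finite τ] :
    Nonempty (KoszulMatrices k τ) := by
  induction τ using Finite.induction_empty_option with
  | of_equiv e h => exact ⟨h.some.ofEquiv e⟩
  | h_empty => exact ⟨KoszulMatrices.ofIsEmpty k PEmpty⟩
  | h_option h => exact ⟨h.some.cone⟩

end Cone

/-! ### Koszul chains with coefficients in a graded module -/

section Chains

variable {k : Type u} [Field k] {τ : Type v} (G : KoszulMatrices k τ)
variable {M : Type*} [AddCommGroup M] [Module k M]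

namespace KoszulMatrices

/-- The Koszul chains of homological degree `i` and internal degree `j` with coefficients in the
graded module with pieces `𝒩 n`. -/
def chains (𝒩 : ℤ → Submodule k M) (i : ℕ) (j : ℤ) : Submodule k (G.ι i → M) :=
  Submodule.pi Set.univ fun _ => 𝒩 (j - i)

variable {G}

lemma mem_chains {𝒩 : ℤ → Submodule k M} {i : ℕ} {j : ℤ} {v : G.ι i → M} :
    v ∈ G.chains 𝒩 i j ↔ ∀ b, v b ∈ 𝒩 (j - i) := by
  simp [chains, Submodule.mem_pi]

lemma finrank_chains (𝒩 : ℤ → Submodule k M) [∀ n, FiniteDimensional k (𝒩 n)] (i : ℕ) (j : ℤ) :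
    Module.finrank k (G.chains 𝒩 i j) =
      Fintype.card (G.ι i) * Module.finrank k (𝒩 (j - i)) := by
  rw [chains, finrank_submodule_pi, Finset.sum_const, smul_eq_mul, Finset.card_univ]

instance (𝒩 : ℤ → Submodule k M) [∀ n, FiniteDimensional k (𝒩 n)] (i : ℕ) (j : ℤ) :
    FiniteDimensional k (G.chains 𝒩 i j) :=
  finiteDimensional_pi _

lemma chains_mono {𝒩 𝒩' : ℤ → Submodule k M} (h : ∀ n, 𝒩 n ≤ 𝒩' n) (i : ℕ) (j : ℤ) :
    G.chains 𝒩 i j ≤ G.chains 𝒩' i j :=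
  fun _ hv => mem_chains.2 fun b => h _ (mem_chains.1 hv b)

end KoszulMatrices

end Chains

section Koszul

variable {k : Type u} [Field k] {τ : Type v}
variable {M : Type*} [AddCommGroup M] [Module k M] [Module (MvPolynomial τ k) M]
  [IsScalarTower k (MvPolynomial τ k) M]
variable {M' : Type*} [AddCommGroup M'] [Module k M'] [Module (MvPolynomial τ k) M']
  [IsScalarTower k (MvPolynomial τ k) M']

/-- The action of a matrix over `k[τ]` on vectors with entries in a `k[τ]`-module. -/
def matAct {α β : Type*} [Fintype β] (D : Matrix α β (MvPolynomial τ k)) :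
    (β → M) →ₗ[k] (α → M) where
  toFun v a := ∑ b, D a b • v b
  map_add' v w := by
    ext1 a
    simp [Finset.sum_add_distrib]
  map_smul' c v := by
    ext1 a
    simp only [Pi.smul_apply, Finset.smul_sum, RingHom.id_apply]
    refine Finset.sum_congr rfl fun b _ => ?_
    rw [← algebraMap_smul (MvPolynomial τ k) c (v b), smul_comm, algebraMap_smul]

lemma matAct_apply {α β : Type*} [Fintype β] (D : Matrix α β (MvPolynomial τ k)) (v : β → M)
    (a : α) : matAct D v a = ∑ b, D a b • v b := rfl

lemma matAct_matAct {α β γ : Type*} [Fintype β] [Fintype γ] {D : Matrix α β (MvPolynomial τ k)}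
    {D' : Matrix β γ (MvPolynomial τ k)} (h : D * D' = 0) (v : γ → M) :
    matAct D (matAct D' v) = 0 := by
  ext1 a
  simp only [matAct_apply, Finset.smul_sum, smul_smul]
  rw [Finset.sum_comm]
  refine Finset.sum_eq_zero fun c _ => ?_
  rw [← Finset.sum_smul]
  have := congrFun (congrFun h a) c
  rw [Matrix.mul_apply, Matrix.zero_apply] at this
  rw [this, zero_smul]

lemma matAct_map {α β : Type*} [Fintype β] (D : Matrix α β (MvPolynomial τ k))
    (φ : M →ₗ[MvPolynomial τ k] M') (v : β → M) (a : α) :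
    matAct D (fun b => φ (v b)) a = φ (matAct D v a) := by
  simp [matAct_apply]

variable (G : KoszulMatrices k τ)

namespace KoszulMatrices

/-- The Koszul boundaries of homological degree `i` and internal degree `j` with coefficients in
the graded module with pieces `𝒩 n`. -/
def bounds (𝒩 : ℤ → Submodule k M) (i : ℕ) (j : ℤ) : Submodule k (G.ι i → M) :=
  (G.chains 𝒩 (i + 1) j).map (matAct (G.diff i))

variable {G}

lemma map_matAct_chains (𝒩 : ℤ → Submodule k M) (i : ℕ) (j : ℤ) :
    (G.chains 𝒩 (i + 1) j).map (matAct (G.diff i)) = G.bounds 𝒩 i j := rfl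

lemma bounds_le_chains {𝒩 : ℤ → Submodule k M}
    (h𝒩 : ∀ n, ∀ p ∈ zhom k τ 1, ∀ v ∈ 𝒩 n, p • v ∈ 𝒩 (n + 1)) (i : ℕ) (j : ℤ) :
    G.bounds 𝒩 i j ≤ G.chains 𝒩 i j := by
  rintro _ ⟨v, hv, rfl⟩
  rw [mem_chains]
  intro b
  refine Submodule.sum_mem _ fun a _ => ?_
  have := h𝒩 _ _ (G.diff_mem i b a) _ (mem_chains.1 hv a)
  rwa [show j - ((i + 1 : ℕ) : ℤ) + 1 = j - i by push_cast; ring] at this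

lemma map_chains (φ : M →ₗ[MvPolynomial τ k] M') {ℱ : ℤ → Submodule k M}
    {𝒩 : ℤ → Submodule k M'} (h : ∀ n, 𝒩 n = (ℱ n).map (φ.restrictScalars k)) (i : ℕ) (j : ℤ) :
    (G.chains ℱ i j).map ((φ.restrictScalars k).compLeft (G.ι i)) = G.chains 𝒩 i j := by
  ext v
  constructor
  · rintro ⟨w, hw, rfl⟩
    rw [mem_chains]
    intro b
    rw [h]
    exact ⟨w b, mem_chains.1 hw b, rfl⟩
  · intro hv
    have : ∀ b, ∃ x ∈ ℱ (j - i), φ x = v b := fun b => by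
      have := mem_chains.1 hv b
      rw [h] at this
      exact this
    choose w hw hw' using this
    exact ⟨w, mem_chains.2 hw, funext hw'⟩

lemma map_bounds (φ : M →ₗ[MvPolynomial τ k] M') {ℱ : ℤ → Submodule k M}
    {𝒩 : ℤ → Submodule k M'} (h : ∀ n, 𝒩 n = (ℱ n).map (φ.restrictScalars k)) (i : ℕ) (j : ℤ) :
    (G.bounds ℱ i j).map ((φ.restrictScalars k).compLeft (G.ι i)) = G.bounds 𝒩 i j := by
  rw [bounds, bounds, ← map_chains φ h, ← Submodule.map_comp, ← Submodule.map_comp]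
  congr 1
  ext1 v
  ext1 a
  exact (matAct_map (G.diff i) φ v a).symm

/-- Dimension shifting: if `𝒩` is the image of `ℱ` under `φ`, with kernel `𝒵`, and if the Koszul
complex with coefficients in `ℱ` is exact in homological degree `i + 1`, then the Koszul ranks of
`𝒩` in degree `i + 1` are given by those of `𝒵` in degree `i`. -/
lemma finrank_chains_add_finrank_bounds (φ : M →ₗ[MvPolynomial τ k] M') {ℱ 𝒵 : ℤ → Submodule k M}
    {𝒩 : ℤ → Submodule k M'} [∀ n, FiniteDimensional k (ℱ n)]
    (hℱ : ∀ n, ∀ p ∈ zhom k τ 1, ∀ v ∈ ℱ n, p • v ∈ ℱ (n + 1))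
    (h𝒩 : ∀ n, 𝒩 n = (ℱ n).map (φ.restrictScalars k))
    (h𝒵 : ∀ n, 𝒵 n = ℱ n ⊓ LinearMap.ker (φ.restrictScalars k)) (i : ℕ) (j : ℤ)
    (hex : G.chains ℱ (i + 1) j ⊓ LinearMap.ker (matAct (G.diff i)) ≤ G.bounds ℱ (i + 1) j) :
    Module.finrank k (G.chains 𝒩 (i + 1) j) + Module.finrank k (G.bounds 𝒵 i j) =
      Module.finrank k (G.bounds ℱ i j) + Module.finrank k (G.bounds 𝒩 (i + 1) j) := by
  have hYX : G.bounds ℱ (i + 1) j ⊔ G.chains 𝒵 (i + 1) j ≤ G.chains ℱ (i + 1) j :=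
    sup_le (bounds_le_chains hℱ _ _) (chains_mono (fun n => by rw [h𝒵]; exact inf_le_left) _ _)
  have hzero : (G.chains 𝒵 (i + 1) j).map ((φ.restrictScalars k).compLeft (G.ι (i + 1))) = ⊥ := by
    rw [eq_bot_iff]
    rintro _ ⟨v, hv, rfl⟩
    refine (Submodule.mem_bot k).2 (funext fun b => ?_)
    have := mem_chains.1 hv b
    rw [h𝒵] at this
    exact this.2
  have h₁ := finrank_add_finrank_map_eq ((φ.restrictScalars k).compLeft (G.ι (i + 1))) hYX (by
    rintro v ⟨hv, hv'⟩
    refine le_sup_right (a := G.bounds ℱ (i + 1) j) (mem_chains.2 fun b => ?_)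
    rw [h𝒵]
    exact ⟨mem_chains.1 hv b, congrFun hv' b⟩)
  have h₂ := finrank_add_finrank_map_eq (V := G.ι (i + 1) → M) (W := G.ι i → M)
    (matAct (G.diff i)) hYX (le_trans hex le_sup_left)
  have hzero' : (G.bounds ℱ (i + 1) j).map (matAct (G.diff i)) = ⊥ := by
    rw [eq_bot_iff]
    rintro _ ⟨_, ⟨v, _, rfl⟩, rfl⟩
    exact (Submodule.mem_bot k).2 (matAct_matAct (G.diff_mul i) v)
  rw [Submodule.map_sup, map_chains φ h𝒩, map_bounds φ h𝒩, hzero, sup_bot_eq] at h₁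
  rw [Submodule.map_sup, hzero', bot_sup_eq, map_matAct_chains, map_matAct_chains] at h₂
  omega

end KoszulMatrices

/-! ### Koszul complexes of graded free modules -/

/-- The pieces of the graded free module `⨁_a P(-deg a)`. -/
def freePiece (k : Type u) [Field k] (τ : Type v) {r : ℕ} (deg : Fin r → ℕ) (j : ℤ) :
    Submodule k (Fin r → MvPolynomial τ k) :=
  Submodule.pi Set.univ fun a => zhom k τ (j - deg a)

/-- The component of degree `j` of an element of `⨁_a P(-deg a)`. -/
def freeComp {r : ℕ} (deg : Fin r → ℕ) (j : ℤ) (v : Fin r → MvPolynomial τ k) :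
    Fin r → MvPolynomial τ k :=
  fun a => zcomp k τ (j - deg a) (v a)

/-- The part of degree `j` of `(⨁_a P(-deg a)) ⊗ k`. -/
def strandOf (k : Type u) [Field k] {r : ℕ} (deg : Fin r → ℕ) (j : ℤ) :
    Submodule k (Fin r → k) where
  carrier := {v | ∀ a, (deg a : ℤ) ≠ j → v a = 0}
  add_mem' hv hw a ha := by simp [hv a ha, hw a ha]
  zero_mem' _ _ := rfl
  smul_mem' c v hv a ha := by simp [hv a ha]

/-- Reduction of `P^r` modulo the variables. -/
def redVars (k : Type u) [Field k] (τ : Type v) (r : ℕ) :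
    (Fin r → MvPolynomial τ k) →ₗ[k] (Fin r → k) where
  toFun v a := constantCoeff (v a)
  map_add' _ _ := by ext1; simp
  map_smul' _ _ := by ext1; simp [smul_eq_C_mul]

lemma redVars_apply {r : ℕ} (v : Fin r → MvPolynomial τ k) (a : Fin r) :
    redVars k τ r v a = constantCoeff (v a) := rfl

variable {r : ℕ} {deg : Fin r → ℕ}

lemma mem_freePiece {j : ℤ} {v : Fin r → MvPolynomial τ k} :
    v ∈ freePiece k τ deg j ↔ ∀ a, v a ∈ zhom k τ (j - deg a) := by
  simp [freePiece, Submodule.mem_pi]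

instance [Finite τ] (j : ℤ) : FiniteDimensional k (freePiece k τ deg j) :=
  finiteDimensional_pi _

lemma freeComp_mem (j : ℤ) (v : Fin r → MvPolynomial τ k) :
    freeComp deg j v ∈ freePiece k τ deg j :=
  mem_freePiece.2 fun _ => zcomp_mem _ _

lemma freeComp_of_mem {j : ℤ} {v : Fin r → MvPolynomial τ k} (hv : v ∈ freePiece k τ deg j) :
    freeComp deg j v = v :=
  funext fun a => zcomp_of_mem (mem_freePiece.1 hv a)

lemma smul_mem_freePiece (n : ℤ) (p : MvPolynomial τ k) (hp : p ∈ zhom k τ 1)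
    (v : Fin r → MvPolynomial τ k) (hv : v ∈ freePiece k τ deg n) :
    p • v ∈ freePiece k τ deg (n + 1) := by
  rw [mem_freePiece]
  intro a
  have := mul_mem_zhom hp (mem_freePiece.1 hv a)
  rwa [show n - (deg a : ℤ) + 1 = n + 1 - deg a by ring] at this

lemma constantCoeff_of_mem_zhom {n : ℤ} (hn : n ≠ 0) {p : MvPolynomial τ k}
    (hp : p ∈ zhom k τ n) : constantCoeff p = 0 := by
  by_contra h
  rw [constantCoeff_eq] at h
  exact hn (by simpa using (hp 0 h).symm)

lemma map_redVars_freePiece (j : ℤ) :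
    (freePiece k τ deg j).map (redVars k τ r) = strandOf k deg j := by
  ext v
  constructor
  · rintro ⟨w, hw, rfl⟩ a ha
    exact constantCoeff_of_mem_zhom (by omega) (mem_freePiece.1 hw a)
  · intro hv
    refine ⟨fun a => C (v a), mem_freePiece.2 fun a => ?_, funext fun a => by
      simp [redVars_apply]⟩
    by_cases ha : (deg a : ℤ) = j
    · rw [ha, sub_self]
      exact mem_zhom_natCast.2 (isHomogeneous_C _ _)
    · rw [hv a ha, C_0]
      exact Submodule.zero_mem _

namespace KoszulMatrices

variable {G}

lemma zcomp_mulVec {α β : Type*} [Fintype β] {D : Matrix α β (MvPolynomial τ k)}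
    (hD : ∀ a b, D a b ∈ zhom k τ 1) (n : ℤ) (w : β → MvPolynomial τ k) (a : α) :
    zcomp k τ n (D.mulVec w a) = D.mulVec (fun b => zcomp k τ (n - 1) (w b)) a := by
  simp only [Matrix.mulVec, dotProduct, map_sum]
  exact Finset.sum_congr rfl fun b _ => zcomp_mul (hD a b) n (w b)

/-- A homogeneous cycle is the boundary of a homogeneous chain. -/
lemma exists_graded_of_mulVec_eq_zero (i : ℕ) {n : ℤ} (v : G.ι (i + 1) → MvPolynomial τ k)
    (hv : ∀ b, v b ∈ zhom k τ n) (h : (G.diff i).mulVec v = 0) :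
    ∃ w : G.ι (i + 2) → MvPolynomial τ k,
      (∀ b, w b ∈ zhom k τ (n - 1)) ∧ (G.diff (i + 1)).mulVec w = v := by
  obtain ⟨w, hw⟩ := G.exact_succ i v h
  refine ⟨fun b => zcomp k τ (n - 1) (w b), fun b => zcomp_mem _ _, funext fun b => ?_⟩
  rw [← zcomp_mulVec (G.diff_mem _), hw, zcomp_of_mem (hv b)]

lemma exists_graded_of_constantCoeff_eq_zero {n : ℤ} (v : G.ι 0 → MvPolynomial τ k)
    (hv : ∀ b, v b ∈ zhom k τ n) (h : ∀ b, constantCoeff (v b) = 0) :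
    ∃ w : G.ι 1 → MvPolynomial τ k,
      (∀ b, w b ∈ zhom k τ (n - 1)) ∧ (G.diff 0).mulVec w = v := by
  obtain ⟨w, hw⟩ := G.exact_zero v h
  refine ⟨fun b => zcomp k τ (n - 1) (w b), fun b => zcomp_mem _ _, funext fun b => ?_⟩
  rw [← zcomp_mulVec (G.diff_mem _), hw, zcomp_of_mem (hv b)]

/-- The Koszul complex of a graded free module is exact in positive homological degrees. -/
lemma chains_freePiece_inf_ker_le (i : ℕ) (j : ℤ) :
    G.chains (freePiece k τ deg) (i + 1) j ⊓ LinearMap.ker (matAct (G.diff i)) ≤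
      G.bounds (freePiece k τ deg) (i + 1) j := by
  rintro v ⟨hv, hv'⟩
  have h : ∀ a : Fin r, ∃ w : G.ι (i + 2) → MvPolynomial τ k,
      (∀ b, w b ∈ zhom k τ (j - ((i + 1 : ℕ) : ℤ) - deg a - 1)) ∧
        (G.diff (i + 1)).mulVec w = fun b => v b a := by
    intro a
    refine exists_graded_of_mulVec_eq_zero i _ (fun b => ?_) (funext fun b => ?_)
    · exact mem_freePiece.1 (mem_chains.1 hv b) a
    · have := congrFun (congrFun hv' b) a
      simpa [matAct_apply, Matrix.mulVec, dotProduct] using this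
  choose w hw hw' using h
  refine ⟨fun b a => w a b, mem_chains.2 fun b => mem_freePiece.2 fun a => ?_, ?_⟩
  · have := hw a b
    rwa [show j - ((i + 1 : ℕ) : ℤ) - deg a - 1 = j - ((i + 1 + 1 : ℕ) : ℤ) - deg a by
      push_cast; ring] at this
  · ext1 b
    ext1 a
    have := congrFun (hw' a) b
    simpa [matAct_apply, Matrix.mulVec, dotProduct] using this

/-- In homological degree `0`, the Koszul rank of the image `𝒩` of a graded free module counts the
generators of the free module that are not redundant. -/
lemma finrank_chains_zero_add [Finite τ] (φ : (Fin r → MvPolynomial τ k) →ₗ[MvPolynomial τ k] M')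
    {𝒵 : ℤ → Submodule k (Fin r → MvPolynomial τ k)} {𝒩 : ℤ → Submodule k M'}
    (h𝒩 : ∀ n, 𝒩 n = (freePiece k τ deg n).map (φ.restrictScalars k))
    (h𝒵 : ∀ n, 𝒵 n = freePiece k τ deg n ⊓ LinearMap.ker (φ.restrictScalars k)) (j : ℤ) :
    Module.finrank k (G.chains 𝒩 0 j) + Module.finrank k ((𝒵 j).map (redVars k τ r)) =
      Module.finrank k (strandOf k deg j) + Module.finrank k (G.bounds 𝒩 0 j) := by
  have hYX : G.bounds (freePiece k τ deg) 0 j ⊔ G.chains 𝒵 0 j ≤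
      G.chains (freePiece k τ deg) 0 j :=
    sup_le (bounds_le_chains smul_mem_freePiece _ _)
      (chains_mono (fun n => by rw [h𝒵]; exact inf_le_left) _ _)
  have hzero : (G.chains 𝒵 0 j).map ((φ.restrictScalars k).compLeft (G.ι 0)) = ⊥ := by
    rw [eq_bot_iff]
    rintro _ ⟨v, hv, rfl⟩
    refine (Submodule.mem_bot k).2 (funext fun b => ?_)
    have := mem_chains.1 hv b
    rw [h𝒵] at this
    exact this.2
  have h₁ := finrank_add_finrank_map_eq ((φ.restrictScalars k).compLeft (G.ι 0)) hYX (by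
    rintro v ⟨hv, hv'⟩
    refine le_sup_right (a := G.bounds (freePiece k τ deg) 0 j) (mem_chains.2 fun b => ?_)
    rw [h𝒵]
    exact ⟨mem_chains.1 hv b, congrFun hv' b⟩)
  let f : (G.ι 0 → Fin r → MvPolynomial τ k) →ₗ[k] (Fin r → k) :=
    redVars k τ r ∘ₗ LinearMap.proj default
  have hf : ∀ 𝒲 : ℤ → Submodule k (Fin r → MvPolynomial τ k),
      (G.chains 𝒲 0 j).map f = (𝒲 j).map (redVars k τ r) := by
    intro 𝒲
    ext x
    constructor
    · rintro ⟨v, hv, rfl⟩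
      refine ⟨v default, ?_, rfl⟩
      simpa using mem_chains.1 hv default
    · rintro ⟨v, hv, rfl⟩
      refine ⟨fun _ => v, mem_chains.2 fun _ => ?_, rfl⟩
      simpa using hv
  have hker : G.chains (freePiece k τ deg) 0 j ⊓ LinearMap.ker f ≤
      G.bounds (freePiece k τ deg) 0 j := by
    rintro v ⟨hv, hv'⟩
    have h : ∀ a : Fin r, ∃ w : G.ι 1 → MvPolynomial τ k,
        (∀ b, w b ∈ zhom k τ (j - ((0 : ℕ) : ℤ) - deg a - 1)) ∧
          (G.diff 0).mulVec w = fun b => v b a := by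
      intro a
      refine exists_graded_of_constantCoeff_eq_zero _ (fun b => ?_) (fun b => ?_)
      · exact mem_freePiece.1 (mem_chains.1 hv b) a
      · rw [Subsingleton.elim b default]
        exact congrFun hv' a
    choose w hw hw' using h
    refine ⟨fun b a => w a b, mem_chains.2 fun b => mem_freePiece.2 fun a => ?_, ?_⟩
    · have := hw a b
      rwa [show j - ((0 : ℕ) : ℤ) - deg a - 1 = j - ((0 + 1 : ℕ) : ℤ) - deg a by
        push_cast; ring] at this
    · ext1 b
      ext1 a
      have := congrFun (hw' a) b
      simpa [matAct_apply, Matrix.mulVec, dotProduct] using this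
  have h₂ := finrank_add_finrank_map_eq f hYX (hker.trans le_sup_left)
  have hzero' : (G.bounds (freePiece k τ deg) 0 j).map f = ⊥ := by
    rw [eq_bot_iff]
    rintro _ ⟨_, ⟨v, _, rfl⟩, rfl⟩
    refine (Submodule.mem_bot k).2 (funext fun a => ?_)
    change constantCoeff (matAct (G.diff 0) v default a) = 0
    rw [matAct_apply, Finset.sum_apply, map_sum]
    refine Finset.sum_eq_zero fun b _ => ?_
    rw [Pi.smul_apply, smul_eq_mul, map_mul,
      constantCoeff_of_mem_zhom one_ne_zero (G.diff_mem 0 default b), zero_mul]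
  rw [Submodule.map_sup, map_chains φ h𝒩, map_bounds φ h𝒩, hzero, sup_bot_eq] at h₁
  rw [Submodule.map_sup, hzero', bot_sup_eq, hf, hf, map_redVars_freePiece] at h₂
  omega

end KoszulMatrices

end Koszul

/-! ### Betti numbers from Koszul complexes -/

section Balancing

variable {k : Type u} [Field k] {τ : Type v}

namespace KoszulMatrices

variable {M : Type*} [AddCommGroup M] [Module k M] [Module (MvPolynomial τ k) M]
  [IsScalarTower k (MvPolynomial τ k) M] (G : KoszulMatrices k τ)

/-- The dimension of the Koszul homology of homological degree `i` and internal degree `j` with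
coefficients in the graded module with pieces `𝒩 n`, expressed by ranks. -/
def homDim (𝒩 : ℤ → Submodule k M) : ℕ → ℤ → ℤ
  | 0, j => Module.finrank k (G.chains 𝒩 0 j) - Module.finrank k (G.bounds 𝒩 0 j)
  | i + 1, j => Module.finrank k (G.chains 𝒩 (i + 1) j) - Module.finrank k (G.bounds 𝒩 i j) -
      Module.finrank k (G.bounds 𝒩 (i + 1) j)

variable {G} {r : ℕ} {deg : Fin r → ℕ}
  (φ : (Fin r → MvPolynomial τ k) →ₗ[MvPolynomial τ k] M)
  {𝒵 : ℤ → Submodule k (Fin r → MvPolynomial τ k)} {𝒩 : ℤ → Submodule k M}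
  (h𝒩 : ∀ n, 𝒩 n = (freePiece k τ deg n).map (φ.restrictScalars k))
  (h𝒵 : ∀ n, 𝒵 n = freePiece k τ deg n ⊓ LinearMap.ker (φ.restrictScalars k))

lemma finrank_bounds_bot (i : ℕ) (j : ℤ) :
    Module.finrank k (G.bounds (fun _ => (⊥ : Submodule k M)) i j) = 0 := by
  have h : G.bounds (fun _ => (⊥ : Submodule k M)) i j = ⊥ := by
    rw [eq_bot_iff]
    rintro _ ⟨v, hv, rfl⟩
    have : v = 0 := funext fun b => (Submodule.mem_bot k).1 (mem_chains.1 hv b)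
    rw [this, map_zero]
    exact Submodule.zero_mem _
  rw [h, finrank_bot]

lemma inf_ker_id (n : ℤ) : (⊥ : Submodule k (Fin r → MvPolynomial τ k)) =
    freePiece k τ deg n ⊓ LinearMap.ker
      ((LinearMap.id : (Fin r → MvPolynomial τ k) →ₗ[MvPolynomial τ k] _).restrictScalars k) := by
  rw [eq_comm, eq_bot_iff]
  rintro v ⟨-, hv⟩
  exact hv

lemma map_id_freePiece (n : ℤ) : freePiece k τ deg n = (freePiece k τ deg n).map
    ((LinearMap.id : (Fin r → MvPolynomial τ k) →ₗ[MvPolynomial τ k] _).restrictScalars k) :=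
  (Submodule.map_id _).symm

variable [Finite τ]

lemma finrank_chains_zero_freePiece (j : ℤ) :
    Module.finrank k (G.chains (freePiece k τ deg) 0 j) =
      Module.finrank k (strandOf k deg j) +
        Module.finrank k (G.bounds (freePiece k τ deg) 0 j) := by
  have := finrank_chains_zero_add (G := G) (LinearMap.id) (𝒩 := freePiece k τ deg)
    (𝒵 := fun _ => ⊥) map_id_freePiece inf_ker_id j
  rw [Submodule.map_bot, finrank_bot] at this
  exact this

lemma finrank_chains_succ_freePiece (i : ℕ) (j : ℤ) :
    Module.finrank k (G.chains (freePiece k τ deg) (i + 1) j) =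
      Module.finrank k (G.bounds (freePiece k τ deg) i j) +
        Module.finrank k (G.bounds (freePiece k τ deg) (i + 1) j) := by
  have := finrank_chains_add_finrank_bounds (G := G) (LinearMap.id) (𝒩 := freePiece k τ deg)
    (𝒵 := fun _ => ⊥) smul_mem_freePiece map_id_freePiece inf_ker_id i j
    (chains_freePiece_inf_ker_le i j)
  rw [finrank_bounds_bot] at this
  exact this

include h𝒩 h𝒵

/-- The Koszul chains form a short exact sequence for `0 → 𝒵 → F → 𝒩 → 0`. -/
lemma finrank_chains_freePiece_eq_add (i : ℕ) (j : ℤ) :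
    Module.finrank k (G.chains (freePiece k τ deg) i j) =
      Module.finrank k (G.chains 𝒩 i j) + Module.finrank k (G.chains 𝒵 i j) := by
  have h := finrank_map_add_finrank_inf_ker ((φ.restrictScalars k).compLeft (G.ι i))
    (G.chains (freePiece k τ deg) i j)
  have h2 : G.chains (freePiece k τ deg) i j ⊓
      LinearMap.ker ((φ.restrictScalars k).compLeft (G.ι i)) = G.chains 𝒵 i j := by
    ext v
    constructor
    · rintro ⟨hv, hv'⟩
      refine mem_chains.2 fun b => ?_
      rw [h𝒵]
      exact ⟨mem_chains.1 hv b, congrFun hv' b⟩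
    · intro hv
      have : ∀ b, v b ∈ freePiece k τ deg (j - i) ⊓ LinearMap.ker (φ.restrictScalars k) :=
        fun b => by
          rw [← h𝒵]
          exact mem_chains.1 hv b
      exact ⟨mem_chains.2 fun b => (this b).1, funext fun b => (this b).2⟩
  rw [map_chains φ h𝒩, h2] at h
  exact h.symm

/-- For a graded free cover `F → 𝒩` with kernel `𝒵`, the degree `0` homology of `𝒩` is the cokernel
of `𝒵 ⊗ k → F ⊗ k`. -/
lemma homDim_zero (j : ℤ) : G.homDim 𝒩 0 j =
    Module.finrank k (strandOf k deg j) - Module.finrank k ((𝒵 j).map (redVars k τ r)) := by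
  have := finrank_chains_zero_add (G := G) φ h𝒩 h𝒵 j
  rw [homDim]
  omega

/-- The long exact sequence of a graded free cover, at its end: the degree `1` homology of `𝒩` is
the kernel of `𝒵 ⊗ k → F ⊗ k`. -/
lemma homDim_one (j : ℤ) : G.homDim 𝒩 1 j =
    G.homDim 𝒵 0 j - Module.finrank k ((𝒵 j).map (redVars k τ r)) := by
  have h1 := finrank_chains_zero_add (G := G) φ h𝒩 h𝒵 j
  have h2 := finrank_chains_add_finrank_bounds (G := G) φ smul_mem_freePiece h𝒩 h𝒵 0 j
    (chains_freePiece_inf_ker_le 0 j)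
  have h3 := finrank_chains_zero_freePiece (G := G) (deg := deg) j
  have h4 := finrank_chains_freePiece_eq_add (G := G) φ h𝒩 h𝒵 0 j
  rw [homDim, homDim]
  omega

/-- Dimension shift along a graded free cover of `𝒩` with kernel `𝒵`. -/
lemma homDim_add_two (i : ℕ) (j : ℤ) : G.homDim 𝒩 (i + 2) j = G.homDim 𝒵 (i + 1) j := by
  have h1 := finrank_chains_add_finrank_bounds (G := G) φ smul_mem_freePiece h𝒩 h𝒵 i j
    (chains_freePiece_inf_ker_le i j)
  have h2 := finrank_chains_add_finrank_bounds (G := G) φ smul_mem_freePiece h𝒩 h𝒵 (i + 1) j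
    (chains_freePiece_inf_ker_le (i + 1) j)
  have h3 := finrank_chains_succ_freePiece (G := G) (deg := deg) i j
  have h4 := finrank_chains_freePiece_eq_add (G := G) φ h𝒩 h𝒵 (i + 1) j
  rw [homDim, homDim]
  omega

end KoszulMatrices

/-- The pieces, indexed by the integers, of a quotient `T` of the polynomial ring `k[τ]`. -/
def quotPiece (k : Type u) [Field k] (τ : Type v) (T : Type w) [CommRing T] [Algebra k T]
    [Algebra (MvPolynomial τ k) T] [IsScalarTower k (MvPolynomial τ k) T] (n : ℤ) :
    Submodule k T :=
  (zhom k τ n).map (IsScalarTower.toAlgHom k (MvPolynomial τ k) T).toLinearMap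

/-- `T` is the quotient of `k[τ]` by a homogeneous ideal. -/
structure IsGradedQuotient (k : Type u) [Field k] (τ : Type v) (T : Type w) [CommRing T]
    [Algebra (MvPolynomial τ k) T] : Prop where
  surjective : Function.Surjective (algebraMap (MvPolynomial τ k) T)
  zcomp_mem : ∀ (p : MvPolynomial τ k) (n : ℤ), algebraMap (MvPolynomial τ k) T p = 0 →
    algebraMap (MvPolynomial τ k) T (zcomp k τ n p) = 0

lemma quotPiece_natCast {T : Type w} [CommRing T] [Algebra k T]
    [Algebra (MvPolynomial τ k) T] [IsScalarTower k (MvPolynomial τ k) T] (d : ℕ) :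
    quotPiece k τ T d = piece k τ T d := by
  rw [quotPiece, piece, zhom_natCast]

namespace GradedFreeResolution

variable {T : Type w} [CommRing T] [Algebra k T] [Algebra (MvPolynomial τ k) T]
  [IsScalarTower k (MvPolynomial τ k) T] (F : GradedFreeResolution τ (piece k τ T))

/-- The augmentation of a resolution. -/
def aug : (Fin (F.rank 0) → MvPolynomial τ k) →ₗ[MvPolynomial τ k] T :=
  Fintype.linearCombination (MvPolynomial τ k) F.gen

/-- The pieces of the kernel of the map from the `l`-th free module of a resolution to the
previous one: the first syzygies for `l = 0`, and so on. -/
def syz : ∀ l, ℤ → Submodule k (Fin (F.rank l) → MvPolynomial τ k)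
  | 0, n => freePiece k τ (F.deg 0) n ⊓ LinearMap.ker (F.aug.restrictScalars k)
  | l + 1, n => freePiece k τ (F.deg (l + 1)) n ⊓
      LinearMap.ker ((F.diff l).mulVecLin.restrictScalars k)

lemma diff_mem_zhom (i : ℕ) (b : Fin (F.rank i)) (a : Fin (F.rank (i + 1))) :
    F.diff i b a ∈ zhom k τ (F.deg (i + 1) a - F.deg i b) := by
  rcases F.diff_homogeneous i b a with h | ⟨h1, h2⟩
  · rw [h]
    exact Submodule.zero_mem _
  · rw [← Nat.cast_sub h1]
    exact mem_zhom_natCast.2 h2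

lemma mulVec_mem_freePiece (i : ℕ) {n : ℤ} {v : Fin (F.rank (i + 1)) → MvPolynomial τ k}
    (hv : v ∈ freePiece k τ (F.deg (i + 1)) n) :
    (F.diff i).mulVec v ∈ freePiece k τ (F.deg i) n := by
  rw [mem_freePiece]
  intro b
  refine (zhom k τ _).sum_mem fun a _ => ?_
  have := mul_mem_zhom (F.diff_mem_zhom i b a) (mem_freePiece.1 hv a)
  rwa [show n - (F.deg (i + 1) a : ℤ) + (F.deg (i + 1) a - F.deg i b) = n - F.deg i b by ring]
    at this

lemma freeComp_mulVec (i : ℕ) (n : ℤ) (v : Fin (F.rank (i + 1)) → MvPolynomial τ k) :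
    freeComp (F.deg i) n ((F.diff i).mulVec v) =
      (F.diff i).mulVec (freeComp (F.deg (i + 1)) n v) := by
  ext1 b
  simp only [freeComp, Matrix.mulVec, dotProduct, map_sum]
  refine Finset.sum_congr rfl fun a _ => ?_
  rw [zcomp_mul (F.diff_mem_zhom i b a), sub_sub_sub_cancel_right]

/-- Exactness of the resolution holds in each degree. -/
lemma map_mulVecLin_eq_of_exact {l : ℕ} {N : Type*} [AddCommGroup N] [Module k N]
    [Module (MvPolynomial τ k) N] [IsScalarTower k (MvPolynomial τ k) N]
    (φ : (Fin (F.rank l) → MvPolynomial τ k) →ₗ[MvPolynomial τ k] N)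
    (h : Function.Exact (F.diff l).mulVecLin φ) (n : ℤ) :
    freePiece k τ (F.deg l) n ⊓ LinearMap.ker (φ.restrictScalars k) =
      (freePiece k τ (F.deg (l + 1)) n).map ((F.diff l).mulVecLin.restrictScalars k) := by
  ext v
  constructor
  · rintro ⟨hv, hv'⟩
    obtain ⟨w, rfl⟩ := (h v).1 hv'
    refine ⟨freeComp (F.deg (l + 1)) n w, freeComp_mem n w, ?_⟩
    exact (F.freeComp_mulVec l n w).symm.trans (freeComp_of_mem hv)
  · rintro ⟨w, hw, rfl⟩
    exact ⟨F.mulVec_mem_freePiece l hw, (h _).2 ⟨w, rfl⟩⟩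

lemma syz_eq_map (l : ℕ) (n : ℤ) : F.syz l n =
    (freePiece k τ (F.deg (l + 1)) n).map ((F.diff l).mulVecLin.restrictScalars k) := by
  cases l with
  | zero => exact F.map_mulVecLin_eq_of_exact F.aug F.exact_zero n
  | succ l => exact F.map_mulVecLin_eq_of_exact _ (F.exact_succ l) n

lemma quotPiece_eq_map (hT : IsGradedQuotient k τ T) (n : ℤ) : quotPiece k τ T n =
    (freePiece k τ (F.deg 0) n).map (F.aug.restrictScalars k) := by
  have hgen : ∀ a, ∃ g ∈ zhom k τ (F.deg 0 a), algebraMap (MvPolynomial τ k) T g = F.gen a := by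
    intro a
    have := F.gen_mem a
    rw [← quotPiece_natCast] at this
    exact this
  choose g hg hg' using hgen
  have haug : ∀ v, F.aug v = algebraMap (MvPolynomial τ k) T (∑ a, v a * g a) := by
    intro v
    simp only [aug, Fintype.linearCombination_apply, map_sum, map_mul, hg', Algebra.smul_def]
  ext x
  constructor
  · rintro ⟨p, hp, rfl⟩
    obtain ⟨v, hv⟩ := F.gen_surjective (algebraMap (MvPolynomial τ k) T p)
    refine ⟨freeComp (F.deg 0) n v, freeComp_mem n v, ?_⟩
    change F.aug _ = algebraMap (MvPolynomial τ k) T p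
    have h0 : algebraMap (MvPolynomial τ k) T (∑ a, v a * g a - p) = 0 := by
      rw [map_sub, ← haug, sub_eq_zero]
      exact hv
    have h1 := hT.zcomp_mem _ n h0
    rw [map_sub, map_sub, zcomp_of_mem hp, sub_eq_zero] at h1
    rw [← h1, haug, map_sum (zcomp k τ n)]
    refine congrArg (algebraMap (MvPolynomial τ k) T)
      (Finset.sum_congr (M := MvPolynomial τ k) rfl fun a _ => ?_)
    rw [mul_comm (v a), zcomp_mul (hg a), mul_comm]
    rfl
  · rintro ⟨v, hv, rfl⟩
    refine ⟨∑ a, v a * g a, (zhom k τ n).sum_mem fun a _ => ?_, (haug v).symm⟩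
    rw [mul_comm]
    have := mul_mem_zhom (hg a) (mem_freePiece.1 hv a)
    rwa [sub_add_cancel] at this

lemma strand_eq (i j : ℕ) : F.strand i j = strandOf k (F.deg i) j := by
  ext v
  exact forall_congr' fun a => by rw [Ne, Ne, Nat.cast_inj]

lemma redVars_mulVec (i : ℕ) (v : Fin (F.rank (i + 1)) → MvPolynomial τ k) :
    redVars k τ _ ((F.diff i).mulVec v) = F.redDiff i (redVars k τ _ v) := by
  ext1 b
  simp [redVars_apply, redDiff, Matrix.mulVec, dotProduct]

lemma boundaries_eq (i j : ℕ) : F.boundaries i j = (F.syz i j).map (redVars k τ _) := by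
  rw [boundaries, strand_eq, ← map_redVars_freePiece (τ := τ), syz_eq_map, ← Submodule.map_comp,
    ← Submodule.map_comp]
  exact congrArg (Submodule.map · _) (LinearMap.ext fun v => (F.redVars_mulVec i v).symm)

lemma diff_mul_diff (i : ℕ) : F.diff i * F.diff (i + 1) = 0 := by
  refine Matrix.ext_of_mulVec_single fun a => ?_
  rw [← Matrix.mulVec_mulVec, Matrix.zero_mulVec]
  exact (F.exact_succ i _).2 ⟨_, rfl⟩

lemma boundaries_le_cycles (i j : ℕ) : F.boundaries i j ≤ F.cycles i j := by
  have h1 : F.boundaries i j ≤ F.strand i j := by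
    rw [boundaries_eq, strand_eq, ← map_redVars_freePiece (τ := τ)]
    refine Submodule.map_mono ?_
    cases i <;> exact inf_le_left
  cases i with
  | zero => exact h1
  | succ i =>
    refine le_inf h1 ?_
    rintro _ ⟨v, _, rfl⟩
    rw [LinearMap.mem_ker, redDiff, redDiff, Matrix.mulVecLin_apply, Matrix.mulVecLin_apply,
      Matrix.mulVec_mulVec, ← Matrix.map_mul, diff_mul_diff]
    simp

lemma torDim_add_finrank (i j : ℕ) :
    F.torDim i j + Module.finrank k (F.boundaries i j) = Module.finrank k (F.cycles i j) := by
  have h := Submodule.finrank_quotient_add_finrank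
    ((F.boundaries i j).submoduleOf (F.cycles i j))
  rwa [(Submodule.submoduleOfEquivOfLe (F.boundaries_le_cycles i j)).finrank_eq] at h

lemma torDim_zero (j : ℕ) : (F.torDim 0 j : ℤ) = Module.finrank k (strandOf k (F.deg 0) j) -
    Module.finrank k ((F.syz 0 j).map (redVars k τ _)) := by
  have := F.torDim_add_finrank 0 j
  rw [boundaries_eq, cycles, strand_eq] at this
  omega

lemma torDim_succ (i j : ℕ) : (F.torDim (i + 1) j : ℤ) =
    Module.finrank k (strandOf k (F.deg (i + 1)) j) -
      Module.finrank k ((F.syz (i + 1) j).map (redVars k τ _)) -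
        Module.finrank k ((F.syz i j).map (redVars k τ _)) := by
  have h1 := F.torDim_add_finrank (i + 1) j
  have h2 := finrank_map_add_finrank_inf_ker (F.redDiff i) (F.strand (i + 1) j)
  change Module.finrank k (F.boundaries i j) + Module.finrank k (F.cycles (i + 1) j) = _ at h2
  rw [boundaries_eq] at h1 h2
  rw [strand_eq] at h2
  omega

variable [Finite τ] (G : KoszulMatrices k τ)

/-- Iterated dimension shift along the resolution. -/
lemma homDim_syz (i l j : ℕ) : G.homDim (F.syz l) (i + 1) j = F.torDim (l + 1 + i + 1) j := by
  induction i generalizing l with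
  | zero =>
    rw [KoszulMatrices.homDim_one _ (F.syz_eq_map l) (fun _ => rfl : ∀ n, F.syz (l + 1) n = _),
      KoszulMatrices.homDim_zero _ (F.syz_eq_map (l + 1))
        (fun _ => rfl : ∀ n, F.syz (l + 1 + 1) n = _), torDim_succ]
  | succ i ih =>
    rw [KoszulMatrices.homDim_add_two _ (F.syz_eq_map l)
      (fun _ => rfl : ∀ n, F.syz (l + 1) n = _), ih (l + 1),
      show l + 1 + (i + 1) + 1 = l + 1 + 1 + i + 1 by omega]

/-- Tor can be computed from a resolution of either argument. -/
lemma torDim_eq_homDim (hT : IsGradedQuotient k τ T) (i j : ℕ) :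
    (F.torDim i j : ℤ) = G.homDim (quotPiece k τ T) i j := by
  match i with
  | 0 => rw [KoszulMatrices.homDim_zero _ (F.quotPiece_eq_map hT)
      (fun _ => rfl : ∀ n, F.syz 0 n = _), torDim_zero]
  | 1 =>
    rw [KoszulMatrices.homDim_one _ (F.quotPiece_eq_map hT) (fun _ => rfl : ∀ n, F.syz 0 n = _),
      KoszulMatrices.homDim_zero _ (F.syz_eq_map 0) (fun _ => rfl : ∀ n, F.syz (0 + 1) n = _),
      torDim_succ]
  | i + 2 =>
    rw [KoszulMatrices.homDim_add_two _ (F.quotPiece_eq_map hT)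
      (fun _ => rfl : ∀ n, F.syz 0 n = _), homDim_syz,
      show 0 + 1 + i + 1 = i + 2 by omega]

end GradedFreeResolution

end Balancing

/-! ### Existence of graded free resolutions -/

section Existence

variable {k : Type u} [Field k] {τ : Type v}

/-- A graded submodule of a graded free module of finite rank over `k[τ]`. -/
structure GradedSubmoduleOfFree (k : Type u) [Field k] (τ : Type v) where
  rank : ℕ
  deg : Fin rank → ℕ
  carrier : Submodule (MvPolynomial τ k) (Fin rank → MvPolynomial τ k)
  freeComp_mem : ∀ v ∈ carrier, ∀ j : ℤ, freeComp deg j v ∈ carrier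

lemma sum_freeComp {r : ℕ} (deg : Fin r → ℕ) (v : Fin r → MvPolynomial τ k) :
    ∃ N : ℕ, ∑ j ∈ Finset.range N, freeComp deg j v = v := by
  refine ⟨(Finset.univ.sup fun a => (v a).totalDegree + deg a) + 1, ?_⟩
  ext1 a
  rw [Finset.sum_apply]
  ext u
  rw [coeff_sum]
  simp only [freeComp, coeff_zcomp]
  by_cases hu : coeff u (v a) = 0
  · simp [hu]
  · have h1 : u.degree ≤ (v a).totalDegree := le_totalDegree (mem_support_iff.2 hu)
    have h2 : (v a).totalDegree + deg a ≤ Finset.univ.sup fun a => (v a).totalDegree + deg a :=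
      Finset.le_sup (f := fun a => (v a).totalDegree + deg a) (Finset.mem_univ a)
    rw [Finset.sum_eq_single (u.degree + deg a)]
    · simp
    · intro j _ hj
      rw [if_neg (by omega)]
    · intro h
      exact absurd (Finset.mem_range.2 (by omega)) h

lemma mulVec_freeComp {r n : ℕ} {deg : Fin r → ℕ} {e : Fin n → ℕ}
    {D : Matrix (Fin r) (Fin n) (MvPolynomial τ k)}
    (hD : ∀ b a, D b a ∈ zhom k τ (e a - deg b)) (j : ℤ) (v : Fin n → MvPolynomial τ k) :
    freeComp deg j (D.mulVec v) = D.mulVec (freeComp e j v) := by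
  ext1 b
  simp only [freeComp, Matrix.mulVec, dotProduct, map_sum]
  refine Finset.sum_congr rfl fun a _ => ?_
  rw [zcomp_mul (hD b a), sub_sub_sub_cancel_right]

/-- A graded submodule is generated by finitely many homogeneous elements, by Hilbert's basis
theorem, and the relations between them form a graded submodule again. -/
lemma GradedSubmoduleOfFree.exists_presentation [Finite τ] (s : GradedSubmoduleOfFree k τ) :
    ∃ (s' : GradedSubmoduleOfFree k τ) (D : Matrix (Fin s.rank) (Fin s'.rank) (MvPolynomial τ k)),
      (∀ b a, D b a ∈ zhom k τ (s'.deg a - s.deg b)) ∧ LinearMap.range D.mulVecLin = s.carrier ∧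
        s'.carrier = LinearMap.ker D.mulVecLin := by
  set H : Set (Fin s.rank → MvPolynomial τ k) :=
    {v | v ∈ s.carrier ∧ ∃ j : ℕ, v ∈ freePiece k τ s.deg j}
  have hH : Submodule.span (MvPolynomial τ k) H = s.carrier := by
    refine le_antisymm (Submodule.span_le.2 fun v hv => hv.1) fun v hv => ?_
    obtain ⟨N, hN⟩ := sum_freeComp s.deg v
    rw [← hN]
    exact Submodule.sum_mem _ fun j _ => Submodule.subset_span
      ⟨s.freeComp_mem v hv j, j, PosetEmbedding.freeComp_mem _ _⟩
  have hfg : (Submodule.span (MvPolynomial τ k) H).FG := IsNoetherian.noetherian _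
  obtain ⟨S, hSH, hS⟩ := (Submodule.fg_span_iff_fg_span_finset_subset _).1 hfg
  have hmem : ∀ a : Fin S.card, ((S.equivFin.symm a : S) : Fin s.rank → _) ∈ H := fun a =>
    hSH (S.equivFin.symm a).2
  choose hZ e he using hmem
  let D : Matrix (Fin s.rank) (Fin S.card) (MvPolynomial τ k) :=
    fun b a => (S.equivFin.symm a : S).1 b
  have hD : ∀ b a, D b a ∈ zhom k τ (e a - s.deg b) := fun b a => mem_freePiece.1 (he a) b
  refine ⟨⟨S.card, e, LinearMap.ker D.mulVecLin, fun v hv j => ?_⟩, D, hD, ?_, rfl⟩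
  · have hv' : D.mulVec v = 0 := hv
    rw [LinearMap.mem_ker, Matrix.mulVecLin_apply, ← mulVec_freeComp hD, hv']
    ext1 b
    simp [freeComp]
  · rw [Matrix.range_mulVecLin, ← hH, hS]
    congr 1
    ext x
    constructor
    · rintro ⟨a, rfl⟩
      exact (S.equivFin.symm a : S).2
    · intro hx
      refine ⟨S.equivFin ⟨x, hx⟩, ?_⟩
      ext1 b
      change (S.equivFin.symm (S.equivFin ⟨x, hx⟩) : S).1 b = x b
      rw [Equiv.symm_apply_apply]

/-- Iterate the choice of homogeneous generators, beginning with the kernel of `A → T`. -/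
lemma nonempty_gradedFreeResolution [Finite τ] {T : Type w} [CommRing T] [Algebra k T]
    [Algebra (MvPolynomial τ k) T] [IsScalarTower k (MvPolynomial τ k) T]
    (hT : IsGradedQuotient k τ T) : Nonempty (GradedFreeResolution τ (piece k τ T)) := by
  choose next D hD hrange hker using GradedSubmoduleOfFree.exists_presentation (k := k) (τ := τ)
  let aug : (Fin 1 → MvPolynomial τ k) →ₗ[MvPolynomial τ k] T :=
    Fintype.linearCombination (MvPolynomial τ k) fun _ => (1 : T)
  have haug : ∀ v, aug v = algebraMap (MvPolynomial τ k) T (v 0) := fun v => by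
    simp [aug, Fintype.linearCombination_apply, Algebra.smul_def]
  let init : GradedSubmoduleOfFree k τ :=
    { rank := 1
      deg := fun _ => 0
      carrier := LinearMap.ker aug
      freeComp_mem := fun v hv j => by
        rw [LinearMap.mem_ker, haug] at hv ⊢
        exact hT.zcomp_mem _ _ hv }
  let seq : ℕ → GradedSubmoduleOfFree k τ := fun i => Nat.rec init (fun _ s => next s) i
  exact ⟨{
    rank := fun i => (seq i).rank
    deg := fun i => (seq i).deg
    gen := fun _ => 1
    diff := fun i => D (seq i)
    gen_mem := fun a => ⟨1, isHomogeneous_one _ _,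
      map_one (IsScalarTower.toAlgHom k (MvPolynomial τ k) T)⟩
    diff_homogeneous := fun i b a => by
      have h := hD (seq i) b a
      by_cases hle : (seq i).deg b ≤ (seq (i + 1)).deg a
      · right
        refine ⟨hle, mem_zhom_natCast.1 ?_⟩
        rw [Nat.cast_sub hle]
        exact h
      · left
        rw [zhom_of_neg (by change ((seq (i + 1)).deg a : ℤ) - _ < 0; omega)] at h
        exact h
    gen_surjective := fun x => by
      obtain ⟨p, rfl⟩ := hT.surjective x
      exact ⟨fun _ => p, haug fun _ => p⟩
    exact_zero := LinearMap.exact_iff.2 (hrange init).symm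
    exact_succ := fun i => LinearMap.exact_iff.2
      ((hker (seq i)).symm.trans (hrange (next (seq i))).symm) }⟩

end Existence

/-! ### Consecutive cancellations in terms of Koszul ranks -/

section CancellationCriterion

variable {k : Type u} [Field k] {τ : Type v} [Finite τ]

lemma bettiTable_eq_homDim (G : KoszulMatrices k τ) {T : Type w} [CommRing T] [Algebra k T]
    [Algebra (MvPolynomial τ k) T] [IsScalarTower k (MvPolynomial τ k) T]
    (hT : IsGradedQuotient k τ T) (i j : ℕ) :
    (bettiTable k τ T i j : ℤ) = G.homDim (quotPiece k τ T) i j := by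
  have h := nonempty_gradedFreeResolution hT
  rw [bettiTable, betti, dif_pos h]
  exact h.some.torDim_eq_homDim G hT i j

/-- For two graded quotients of `k[τ]` with the same Hilbert function, consecutive cancellations
amount to inequalities between Koszul ranks: the numbers of cancellations are the differences of
the ranks. -/
lemma obtainedByConsecutiveCancellations_iff (G : KoszulMatrices k τ)
    {T : Type w} [CommRing T] [Algebra k T]
    [Algebra (MvPolynomial τ k) T] [IsScalarTower k (MvPolynomial τ k) T]
    {T' : Type w} [CommRing T'] [Algebra k T']
    [Algebra (MvPolynomial τ k) T'] [IsScalarTower k (MvPolynomial τ k) T']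
    (hT : IsGradedQuotient k τ T) (hT' : IsGradedQuotient k τ T')
    (hchains : ∀ i (j : ℕ), Module.finrank k (G.chains (quotPiece k τ T) i j) =
      Module.finrank k (G.chains (quotPiece k τ T') i j)) :
    ObtainedByConsecutiveCancellations (bettiTable k τ T) (bettiTable k τ T') ↔
      ∀ i (j : ℕ), Module.finrank k (G.bounds (quotPiece k τ T') i j) ≤
        Module.finrank k (G.bounds (quotPiece k τ T) i j) := by
  have hz := fun j => bettiTable_eq_homDim G hT 0 j
  have hs := fun i j => bettiTable_eq_homDim G hT (i + 1) j
  have hz' := fun j => bettiTable_eq_homDim G hT' 0 j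
  have hs' := fun i j => bettiTable_eq_homDim G hT' (i + 1) j
  simp only [KoszulMatrices.homDim] at hz hs hz' hs'
  constructor
  · rintro ⟨n, hn0, hn⟩ i j
    suffices h : ((n i j : ℕ) : ℤ) = Module.finrank k (G.bounds (quotPiece k τ T) i j) -
        Module.finrank k (G.bounds (quotPiece k τ T') i j) by omega
    induction i with
    | zero =>
      have h1 := hn0 j
      have h2 := hz j
      have h3 := hz' j
      have h4 := hchains 0 j
      omega
    | succ i ih =>
      have h1 := hn i j
      have h2 := hs i j
      have h3 := hs' i j
      have h4 := hchains (i + 1) j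
      omega
  · intro h
    refine ⟨fun i j => Module.finrank k (G.bounds (quotPiece k τ T) i j) -
      Module.finrank k (G.bounds (quotPiece k τ T') i j), fun j => ?_, fun i j => ?_⟩
    · have h1 := h 0 j
      have h2 := hz j
      have h3 := hz' j
      have h4 := hchains 0 j
      dsimp only
      omega
    · have h0 := h i j
      have h1 := h (i + 1) j
      have h2 := hs i j
      have h3 := hs' i j
      have h4 := hchains (i + 1) j
      dsimp only
      omega

end CancellationCriterion

/-! ### Koszul boundaries modulo a homogeneous ideal -/

section IdealBounds

variable {k : Type u} [Field k] {τ : Type v}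

/-- The dimension of the piece of degree `n` of an ideal of the polynomial ring `k[τ]`. -/
def idealDim (I : Ideal (MvPolynomial τ k)) (n : ℤ) : ℕ :=
  Module.finrank k ↥(I.restrictScalars k ⊓ zhom k τ n)

/-- An ideal of `k[τ]` is homogeneous if it contains the homogeneous components of its elements. -/
def IsHomogeneousIdeal (I : Ideal (MvPolynomial τ k)) : Prop :=
  ∀ p ∈ I, ∀ n : ℤ, zcomp k τ n p ∈ I

instance finiteDimensional_inf_zhom [Finite τ] (X : Submodule k (MvPolynomial τ k)) (n : ℤ) :
    FiniteDimensional k ↥(X ⊓ zhom k τ n) :=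
  Submodule.finiteDimensional_of_le inf_le_right

lemma idealDim_mono [Finite τ] {I I' : Ideal (MvPolynomial τ k)} (h : I ≤ I') (n : ℤ) :
    idealDim I n ≤ idealDim I' n :=
  Submodule.finrank_mono (inf_le_inf_right _ h)

namespace KoszulMatrices

variable (G : KoszulMatrices k τ)

/-- The preimage, in the vectors of forms of degree `m`, of the Koszul boundaries over `k[τ] / I`
of homological degree `i`. -/
def idealBounds (I : Ideal (MvPolynomial τ k)) (i : ℕ) (m : ℤ) :
    Submodule k (G.ι i → MvPolynomial τ k) where
  carrier := {v | (∀ b, v b ∈ zhom k τ m) ∧ ∃ w, ∀ b, v b - (G.diff i).mulVec w b ∈ I}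
  add_mem' := by
    rintro v v' ⟨hv, w, hw⟩ ⟨hv', w', hw'⟩
    refine ⟨fun b => Submodule.add_mem _ (hv b) (hv' b), w + w', fun b => ?_⟩
    rw [Matrix.mulVec_add, Pi.add_apply, Pi.add_apply, add_sub_add_comm]
    exact I.add_mem (hw b) (hw' b)
  zero_mem' := ⟨fun b => Submodule.zero_mem _, 0, fun b => by simp⟩
  smul_mem' := by
    rintro c v ⟨hv, w, hw⟩
    refine ⟨fun b => Submodule.smul_mem _ c (hv b), c • w, fun b => ?_⟩
    rw [Matrix.mulVec_smul, Pi.smul_apply, Pi.smul_apply, ← smul_sub]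
    exact Submodule.smul_of_tower_mem I c (hw b)

/-- The vectors of forms of degree `m` in an ideal. -/
def idealVec (I : Ideal (MvPolynomial τ k)) (i : ℕ) (m : ℤ) :
    Submodule k (G.ι i → MvPolynomial τ k) :=
  Submodule.pi Set.univ fun _ => I.restrictScalars k ⊓ zhom k τ m

variable {G}

lemma mem_idealBounds {I : Ideal (MvPolynomial τ k)} {i : ℕ} {m : ℤ}
    {v : G.ι i → MvPolynomial τ k} : v ∈ G.idealBounds I i m ↔
      (∀ b, v b ∈ zhom k τ m) ∧ ∃ w, ∀ b, v b - (G.diff i).mulVec w b ∈ I := Iff.rfl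

lemma mem_idealVec {I : Ideal (MvPolynomial τ k)} {i : ℕ} {m : ℤ}
    {v : G.ι i → MvPolynomial τ k} :
    v ∈ G.idealVec I i m ↔ ∀ b, v b ∈ I ∧ v b ∈ zhom k τ m := by
  simp [idealVec, Submodule.mem_pi]

instance [Finite τ] (I : Ideal (MvPolynomial τ k)) (i : ℕ) (m : ℤ) :
    FiniteDimensional k (G.idealVec I i m) :=
  finiteDimensional_pi _

instance [Finite τ] (I : Ideal (MvPolynomial τ k)) (i : ℕ) (m : ℤ) :
    FiniteDimensional k (G.idealBounds I i m) :=
  Submodule.finiteDimensional_of_le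
    (S₂ := Submodule.pi Set.univ fun _ : G.ι i => zhom k τ m) fun _ hv => by
      rw [Submodule.mem_pi]
      exact fun b _ => hv.1 b

lemma finrank_idealVec [Finite τ] (I : Ideal (MvPolynomial τ k)) (i : ℕ) (m : ℤ) :
    Module.finrank k (G.idealVec I i m) = Fintype.card (G.ι i) * idealDim I m := by
  rw [idealVec, finrank_submodule_pi, Finset.sum_const, smul_eq_mul, Finset.card_univ, idealDim]

lemma idealVec_mono {I I' : Ideal (MvPolynomial τ k)} (h : I ≤ I') (i : ℕ) (m : ℤ) :
    G.idealVec I i m ≤ G.idealVec I' i m :=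
  fun _ hv => mem_idealVec.2 fun b => ⟨h (mem_idealVec.1 hv b).1, (mem_idealVec.1 hv b).2⟩

lemma idealBounds_mono {I I' : Ideal (MvPolynomial τ k)} (h : I ≤ I') (i : ℕ) (m : ℤ) :
    G.idealBounds I i m ≤ G.idealBounds I' i m := by
  rintro v ⟨hv, w, hw⟩
  exact ⟨hv, w, fun b => h (hw b)⟩

lemma idealVec_le_idealBounds (I : Ideal (MvPolynomial τ k)) (i : ℕ) (m : ℤ) :
    G.idealVec I i m ≤ G.idealBounds I i m := fun v hv =>
  ⟨fun b => (mem_idealVec.1 hv b).2, 0, fun b => by simpa using (mem_idealVec.1 hv b).1⟩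

/-- The vector whose boundary witnesses membership in `idealBounds` may be taken to be
homogeneous. -/
lemma exists_graded_of_mem_idealBounds {I : Ideal (MvPolynomial τ k)} (hI : IsHomogeneousIdeal I)
    {i : ℕ} {m : ℤ} {v : G.ι i → MvPolynomial τ k} (hv : v ∈ G.idealBounds I i m) :
    ∃ w : G.ι (i + 1) → MvPolynomial τ k, (∀ b, w b ∈ zhom k τ (m - 1)) ∧
      ∀ b, v b - (G.diff i).mulVec w b ∈ I := by
  obtain ⟨hv, w, hw⟩ := hv
  refine ⟨fun b => zcomp k τ (m - 1) (w b), fun b => zcomp_mem _ _, fun b => ?_⟩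
  have := hI _ (hw b) m
  rwa [map_sub, zcomp_of_mem (hv b), zcomp_mulVec (G.diff_mem i)] at this

lemma mulVec_mem_zhom {i : ℕ} {m : ℤ} {w : G.ι (i + 1) → MvPolynomial τ k}
    (hw : ∀ b, w b ∈ zhom k τ (m - 1)) (b : G.ι i) : (G.diff i).mulVec w b ∈ zhom k τ m := by
  refine (zhom k τ m).sum_mem fun a _ => ?_
  have := mul_mem_zhom (G.diff_mem i b a) (hw a)
  rwa [sub_add_cancel] at this

/-- The codimension of `I` in `idealBounds I` decreases when the ideal grows. -/
lemma finrank_idealBounds_add_le [Finite τ] {I I' : Ideal (MvPolynomial τ k)} (h : I ≤ I')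
    (hI' : IsHomogeneousIdeal I') (i : ℕ) (m : ℤ) :
    Module.finrank k (G.idealBounds I' i m) + Fintype.card (G.ι i) * idealDim I m ≤
      Module.finrank k (G.idealBounds I i m) + Fintype.card (G.ι i) * idealDim I' m := by
  have hle : G.idealBounds I' i m ≤ G.idealBounds I i m ⊔ G.idealVec I' i m := by
    intro v hv
    obtain ⟨w, hw, hw'⟩ := exists_graded_of_mem_idealBounds hI' hv
    have hv' : v = (G.diff i).mulVec w + (v - (G.diff i).mulVec w) := by abel
    rw [hv']
    refine Submodule.add_mem_sup ⟨mulVec_mem_zhom hw, w, fun b => ?_⟩ (mem_idealVec.2 fun b => ?_)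
    · rw [sub_self]
      exact I.zero_mem
    · exact ⟨hw' b, Submodule.sub_mem _ (hv.1 b) (mulVec_mem_zhom hw b)⟩
  have h1 := Submodule.finrank_sup_add_finrank_inf_eq (G.idealBounds I i m) (G.idealVec I' i m)
  have h2 := Submodule.finrank_mono hle
  have h3 := Submodule.finrank_mono
    (le_inf (idealVec_le_idealBounds I i m) (idealVec_mono h i m) :
      G.idealVec I i m ≤ G.idealBounds I i m ⊓ G.idealVec I' i m)
  rw [finrank_idealVec] at h1 h3
  omega

variable {T : Type w} [CommRing T] [Algebra k T]
    [Algebra (MvPolynomial τ k) T] [IsScalarTower k (MvPolynomial τ k) T]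

lemma finrank_bounds_add [Finite τ] (hT : IsGradedQuotient k τ T) (i : ℕ) (m : ℤ) :
    Module.finrank k (G.bounds (quotPiece k τ T) i (i + m)) +
      Fintype.card (G.ι i) * idealDim (RingHom.ker (algebraMap (MvPolynomial τ k) T)) m =
        Module.finrank k
          (G.idealBounds (RingHom.ker (algebraMap (MvPolynomial τ k) T)) i m) := by
  set I := RingHom.ker (algebraMap (MvPolynomial τ k) T)
  have hI : IsHomogeneousIdeal I := fun p hp n => hT.zcomp_mem p n hp
  let π : (G.ι i → MvPolynomial τ k) →ₗ[k] (G.ι i → T) :=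
    (IsScalarTower.toAlgHom k (MvPolynomial τ k) T).toLinearMap.compLeft _
  have hπ : ∀ v b, π v b = algebraMap (MvPolynomial τ k) T (v b) := fun _ _ => rfl
  have hmap : (G.idealBounds I i m).map π = G.bounds (quotPiece k τ T) i (i + m) := by
    ext x
    constructor
    · rintro ⟨v, hv, rfl⟩
      obtain ⟨w, hw, hw'⟩ := exists_graded_of_mem_idealBounds hI hv
      refine ⟨fun b => algebraMap (MvPolynomial τ k) T (w b), mem_chains.2 fun b => ?_, ?_⟩
      · rw [show (i : ℤ) + m - ((i + 1 : ℕ) : ℤ) = m - 1 by push_cast; ring]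
        exact ⟨w b, hw b, rfl⟩
      · ext1 b
        have := hw' b
        rw [RingHom.mem_ker, map_sub, sub_eq_zero] at this
        rw [hπ, this, matAct_apply, Matrix.mulVec, dotProduct, map_sum]
        exact Finset.sum_congr rfl fun a _ => by rw [map_mul, Algebra.smul_def]
    · rintro ⟨y, hy, rfl⟩
      rw [SetLike.mem_coe, mem_chains,
        show (i : ℤ) + m - ((i + 1 : ℕ) : ℤ) = m - 1 by push_cast; ring] at hy
      choose w hw hw' using hy
      refine ⟨(G.diff i).mulVec w, ⟨mulVec_mem_zhom hw, w, fun b => ?_⟩, ?_⟩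
      · rw [sub_self]
        exact I.zero_mem
      · ext1 b
        rw [hπ, matAct_apply, Matrix.mulVec, dotProduct, map_sum]
        refine Finset.sum_congr rfl fun a _ => ?_
        rw [map_mul, Algebra.smul_def, ← hw']
        rfl
  have hker : G.idealBounds I i m ⊓ LinearMap.ker π = G.idealVec I i m := by
    ext v
    constructor
    · rintro ⟨hv, hv'⟩
      exact mem_idealVec.2 fun b => ⟨congrFun hv' b, hv.1 b⟩
    · intro hv
      exact ⟨idealVec_le_idealBounds _ _ _ hv, funext fun b => (mem_idealVec.1 hv b).1⟩
  have := finrank_map_add_finrank_inf_ker π (G.idealBounds I i m)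
  rwa [hmap, hker, finrank_idealVec] at this

end KoszulMatrices

variable {T : Type w} [CommRing T] [Algebra k T]
    [Algebra (MvPolynomial τ k) T] [IsScalarTower k (MvPolynomial τ k) T]
    {T' : Type w} [CommRing T'] [Algebra k T']
    [Algebra (MvPolynomial τ k) T'] [IsScalarTower k (MvPolynomial τ k) T'] [Finite τ]

lemma finrank_quotPiece_add (n : ℤ) : Module.finrank k (quotPiece k τ T n) +
    idealDim (RingHom.ker (algebraMap (MvPolynomial τ k) T)) n =
      Module.finrank k (zhom k τ n) := by
  have h := finrank_map_add_finrank_inf_ker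
    (IsScalarTower.toAlgHom k (MvPolynomial τ k) T).toLinearMap (zhom k τ n)
  rw [inf_comm] at h
  exact h

instance (n : ℤ) : FiniteDimensional k (quotPiece k τ T n) :=
  Module.Finite.map (zhom k τ n) (IsScalarTower.toAlgHom k (MvPolynomial τ k) T).toLinearMap

/-- The criterion for consecutive cancellations, in terms of subspaces of vectors of forms. -/
lemma obtainedByConsecutiveCancellations_iff_finrank_idealBounds (G : KoszulMatrices k τ)
    (hT : IsGradedQuotient k τ T) (hT' : IsGradedQuotient k τ T')
    {I I' : Ideal (MvPolynomial τ k)} (hI : RingHom.ker (algebraMap (MvPolynomial τ k) T) = I)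
    (hI' : RingHom.ker (algebraMap (MvPolynomial τ k) T') = I')
    (hdim : ∀ n, idealDim I n = idealDim I' n) :
    ObtainedByConsecutiveCancellations (bettiTable k τ T) (bettiTable k τ T') ↔
      ∀ i (m : ℕ), Module.finrank k (G.idealBounds I' i m) ≤
        Module.finrank k (G.idealBounds I i m) := by
  subst hI hI'
  rw [obtainedByConsecutiveCancellations_iff G hT hT']
  · constructor
    · intro h i m
      have h0 := h i (i + m)
      have h1 := KoszulMatrices.finrank_bounds_add (G := G) hT i m
      have h2 := KoszulMatrices.finrank_bounds_add (G := G) hT' i m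
      rw [hdim] at h1
      push_cast at h0
      omega
    · intro h i j
      rcases lt_or_ge j i with hij | hij
      · have h2 := KoszulMatrices.finrank_bounds_add (G := G) hT' i (j - i)
        have h3 : KoszulMatrices.idealBounds G (RingHom.ker (algebraMap (MvPolynomial τ k) T')) i
            (j - i) = ⊥ := by
          rw [eq_bot_iff]
          rintro v ⟨hv, -⟩
          refine (Submodule.mem_bot k).2 (funext fun b => ?_)
          have := hv b
          rwa [zhom_of_neg (by omega)] at this
        rw [h3, finrank_bot, add_sub_cancel] at h2
        omega
      · have h0 := h i (j - i)
        have h1 := KoszulMatrices.finrank_bounds_add (G := G) hT i (j - i)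
        have h2 := KoszulMatrices.finrank_bounds_add (G := G) hT' i (j - i)
        rw [add_sub_cancel] at h1 h2
        rw [Nat.cast_sub hij] at h0
        rw [hdim] at h1
        omega
  · intro i j
    have h1 := finrank_quotPiece_add (k := k) (τ := τ) (T := T) (j - i)
    have h2 := finrank_quotPiece_add (k := k) (τ := τ) (T := T') (j - i)
    rw [hdim] at h1
    rw [KoszulMatrices.finrank_chains, KoszulMatrices.finrank_chains]
    congr 1
    omega

end IdealBounds

/-! ### Stable sequences with minimal partial sums -/

section Combinatorics

/-- The sum of the first `i` terms of a sequence. -/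
def headSum (b : ℕ → ℤ) (i : ℕ) : ℤ := ∑ l ∈ Finset.range i, b l

lemma headSum_zero (b : ℕ → ℤ) : headSum b 0 = 0 := rfl

lemma headSum_succ (b : ℕ → ℤ) (i : ℕ) : headSum b (i + 1) = headSum b i + b i :=
  Finset.sum_range_succ b i

lemma headSum_succ' (b : ℕ → ℤ) (i : ℕ) :
    headSum b (i + 1) = headSum (fun l => b (l + 1)) i + b 0 :=
  Finset.sum_range_succ' b i

lemma headSum_diff (U : ℕ → ℤ) (i : ℕ) : headSum (fun l => U (l + 1) - U l) i = U i - U 0 :=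
  Finset.sum_range_sub U i

lemma headSum_mono {b b' : ℕ → ℤ} {i : ℕ} (h : ∀ l < i, b l ≤ b' l) :
    headSum b i ≤ headSum b' i :=
  Finset.sum_le_sum fun l hl => h l (Finset.mem_range.1 hl)

/-- Sequences `b 0, …, b (n - 1)` between the bounds `lo` and `hi` whose consecutive terms satisfy
the relations `Q l (b (l + 1)) (b l)`. -/
def IsStableSeq (lo hi : ℕ → ℤ) (Q : ℕ → ℤ → ℤ → Prop) (n : ℕ) (b : ℕ → ℤ) : Prop :=
  (∀ l < n, lo l ≤ b l ∧ b l ≤ hi l) ∧ ∀ l, l + 1 < n → Q l (b (l + 1)) (b l)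

/-- A stable sequence is optimal if its partial sums are minimal among those of the stable
sequences with the same total. -/
def IsOptimalSeq (lo hi : ℕ → ℤ) (Q : ℕ → ℤ → ℤ → Prop) (n : ℕ) (b : ℕ → ℤ) : Prop :=
  IsStableSeq lo hi Q n b ∧ ∀ b', IsStableSeq lo hi Q n b' → headSum b' n = headSum b n →
    ∀ i ≤ n, headSum b i ≤ headSum b' i

variable {lo hi : ℕ → ℤ} {Q : ℕ → ℤ → ℤ → Prop}

/-- The conditions on a stable sequence that involve the terms around the partial sum of index
`i`. -/
structure IsStableAt (lo hi : ℕ → ℤ) (Q : ℕ → ℤ → ℤ → Prop) (n : ℕ) (b : ℕ → ℤ) (i : ℕ) :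
    Prop where
  le_hi : i < n → b i ≤ hi i
  lo_le : ∀ j, j + 1 = i → lo j ≤ b j
  rel : ∀ j, j + 1 = i → i < n → Q j (b i) (b j)

lemma IsStableSeq.isStableAt {n : ℕ} {b : ℕ → ℤ} (h : IsStableSeq lo hi Q n b) {i : ℕ}
    (hi' : i ≤ n) : IsStableAt lo hi Q n b i :=
  ⟨fun h' => (h.1 i h').2, fun j hj => (h.1 j (by omega)).1, fun j hj h' => by
    subst hj
    exact h.2 j h'⟩

variable (hQ : ∀ l r s r' s', Q l r s → r' ≤ r → s ≤ s' → Q l r' s')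
include hQ

/-- Let `U` be such that, for every `i`, it agrees at `i`, and is bounded around `i`, by the
translated partial sums of a sequence that is stable around `i`. Then the sequence with partial
sums `U` is stable. Hence minima of partial sums of stable sequences come from stable sequences. -/
lemma isStableSeq_of_local {n : ℕ} (U : ℕ → ℤ)
    (h : ∀ i ≤ n, ∃ (b : ℕ → ℤ) (c : ℤ), IsStableAt lo hi Q n b i ∧ U i = headSum b i + c ∧
      (∀ j, j + 1 = i → U j ≤ headSum b j + c) ∧ (i < n → U (i + 1) ≤ headSum b (i + 1) + c)) :
    IsStableSeq lo hi Q n fun l => U (l + 1) - U l := by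
  refine ⟨fun l hl => ⟨?_, ?_⟩, fun l hl => ?_⟩
  · obtain ⟨b, c, hb, h1, h2, -⟩ := h (l + 1) hl
    have := h2 l rfl
    have := hb.lo_le l rfl
    rw [headSum_succ] at h1
    dsimp only
    omega
  · obtain ⟨b, c, hb, h1, -, h3⟩ := h l hl.le
    have h4 := hb.le_hi hl
    have := h3 hl
    rw [headSum_succ] at this
    dsimp only
    omega
  · obtain ⟨b, c, hb, h1, h2, h3⟩ := h (l + 1) hl.le
    have h2 := h2 l rfl
    have h3 := h3 hl
    rw [headSum_succ b l] at h1
    rw [headSum_succ b (l + 1), headSum_succ b l] at h3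
    exact hQ _ _ _ _ _ (hb.rel l rfl hl) (by dsimp only; omega) (by dsimp only; omega)

/-- Optimal sequences exist: their partial sums are the pointwise minima of the partial sums of all
stable sequences with the given total. -/
lemma exists_isOptimalSeq {n : ℕ} {b₀ : ℕ → ℤ} (h₀ : IsStableSeq lo hi Q n b₀) :
    ∃ b, IsOptimalSeq lo hi Q n b ∧ headSum b n = headSum b₀ n := by
  have hmin : ∀ i, i ≤ n → ∃ b, (IsStableSeq lo hi Q n b ∧ headSum b n = headSum b₀ n) ∧
      ∀ b', IsStableSeq lo hi Q n b' → headSum b' n = headSum b₀ n →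
        headSum b i ≤ headSum b' i := by
    intro i hi'
    obtain ⟨m, ⟨b, hb, rfl⟩, hm⟩ := Int.exists_least_of_bdd
      (P := fun z => ∃ b, (IsStableSeq lo hi Q n b ∧ headSum b n = headSum b₀ n) ∧
        headSum b i = z)
      ⟨headSum lo i, by
        rintro _ ⟨b, ⟨hb, -⟩, rfl⟩
        exact headSum_mono fun l hl => (hb.1 l (by omega)).1⟩
      ⟨_, b₀, ⟨h₀, rfl⟩, rfl⟩
    exact ⟨b, hb, fun b' h1 h2 => hm _ ⟨b', ⟨h1, h2⟩, rfl⟩⟩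
  -- `B i` has the smallest partial sum of index `i`; these sums fit together by locality
  choose! B hB hBmin using hmin
  have hU0 : headSum (B 0) 0 = 0 := rfl
  have hst := isStableSeq_of_local (lo := lo) (hi := hi) (n := n) hQ (fun i => headSum (B i) i)
    fun i hi' => ⟨B i, 0, (hB i hi').1.isStableAt hi', by simp, fun j hj => by
      simpa using hBmin j (by omega) _ (hB i hi').1 (hB i hi').2, fun hlt => by
      simpa using hBmin (i + 1) hlt _ (hB i hi').1 (hB i hi').2⟩
  have hsum : ∀ i, headSum (fun l => headSum (B (l + 1)) (l + 1) - headSum (B l) l) i =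
      headSum (B i) i := fun i => by
    rw [headSum_diff fun i => headSum (B i) i, hU0, sub_zero]
  refine ⟨_, ⟨hst, fun b' hb' hb'n i hi' => ?_⟩, ?_⟩
  · rw [hsum]
    rw [hsum, (hB n le_rfl).2] at hb'n
    exact hBmin i hi' _ hb' hb'n
  · rw [hsum]
    exact (hB n le_rfl).2

/-- If `b'` is optimal and `b` is stable, then the difference of the partial sums of `b'` and `b`
is quasiconvex. -/
lemma IsOptimalSeq.quasiconvex {n m : ℕ} {b b' : ℕ → ℤ} (hb' : IsOptimalSeq lo hi Q n b')
    (hb : IsStableSeq lo hi Q m b) (hmn : m ≤ n) {p i q : ℕ} (hpi : p ≤ i) (hiq : i ≤ q)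
    (hqm : q ≤ m) {c : ℤ} (hp : headSum b' p ≤ headSum b p + c)
    (hq : headSum b' q ≤ headSum b q + c) : headSum b' i ≤ headSum b i + c := by
  -- the partial sums of `b'`, lowered to those of `b` plus `c` between `p` and `q`
  let U : ℕ → ℤ := fun i =>
    if p ≤ i ∧ i ≤ q then min (headSum b' i) (headSum b i + c) else headSum b' i
  have hUle : ∀ i, U i ≤ headSum b' i := fun i => by
    dsimp only [U]
    split_ifs
    · exact min_le_left _ _
    · exact le_rfl
  have hUle' : ∀ i, p ≤ i → i ≤ q → U i ≤ headSum b i + c := fun i h1 h2 => by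
    dsimp only [U]
    rw [if_pos ⟨h1, h2⟩]
    exact min_le_right _ _
  have hUeq : ∀ i, ¬ (p < i ∧ i < q) → U i = headSum b' i := fun i h => by
    dsimp only [U]
    split_ifs with h1
    · rcases (by omega : i = p ∨ i = q) with rfl | rfl
      · exact min_eq_left hp
      · exact min_eq_left hq
    · rfl
  have hst := isStableSeq_of_local (lo := lo) (hi := hi) (n := n) hQ U fun i hi' => by
    by_cases hcase : U i = headSum b' i
    · exact ⟨b', 0, hb'.1.isStableAt hi', by simpa using hcase,
        fun j _ => by simpa using hUle j, fun _ => by simpa using hUle (i + 1)⟩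
    · have hin : p < i ∧ i < q := by
        by_contra h
        exact hcase (hUeq i h)
      have hUi : U i = headSum b i + c := by
        dsimp only [U] at hcase ⊢
        rw [if_pos ⟨hin.1.le, hin.2.le⟩] at hcase ⊢
        rcases min_choice (headSum b' i) (headSum b i + c) with h | h
        · exact absurd h hcase
        · exact h
      have hbi := hb.isStableAt (i := i) (by omega)
      exact ⟨b, c, ⟨fun _ => hbi.le_hi (by omega), hbi.lo_le,
        fun j hj _ => hbi.rel j hj (by omega)⟩, hUi, fun j hj => hUle' j (by omega) (by omega),
        fun _ => hUle' (i + 1) (by omega) (by omega)⟩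
  have hU0 : U 0 = 0 := (hUeq 0 (by omega)).trans rfl
  have h1 := hb'.2 _ hst (by rw [headSum_diff, hU0, sub_zero, hUeq n (by omega)]) i (by omega)
  rw [headSum_diff, hU0, sub_zero] at h1
  exact h1.trans (hUle' i hpi hiq)

/-- Comparing partial sums with an optimal sequence gives a comparison of terms. -/
lemma IsOptimalSeq.le_of_headSum_le {n : ℕ} {b b' : ℕ → ℤ} (hb' : IsOptimalSeq lo hi Q n b')
    (hb : IsStableSeq lo hi Q n b) (h : ∀ i ≤ n, headSum b i ≤ headSum b' i) {l : ℕ}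
    (hl : l < n) : b l ≤ b' l := by
  have h1 := hb'.quasiconvex hQ hb le_rfl (Nat.zero_le l) (l.le_add_right 1) hl
    (c := headSum b' (l + 1) - headSum b (l + 1)) (by
      have := h (l + 1) hl
      rw [headSum_zero, headSum_zero]
      omega) (by omega)
  rw [headSum_succ, headSum_succ] at h1
  omega

/-- Optimal sequences increase with their totals. -/
lemma IsOptimalSeq.mono {n : ℕ} {b b' : ℕ → ℤ} (hb : IsOptimalSeq lo hi Q n b)
    (hb' : IsOptimalSeq lo hi Q n b') (h : headSum b n ≤ headSum b' n) {l : ℕ} (hl : l < n) :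
    b l ≤ b' l := by
  refine hb'.le_of_headSum_le hQ hb.1 (fun i hi' => ?_) hl
  have := hb.quasiconvex hQ hb'.1 le_rfl (Nat.zero_le i) hi' le_rfl (c := 0)
    (by rw [headSum_zero, headSum_zero]; omega) (by omega)
  omega

/-- The growth of optimal sequences. Let `b` be optimal, and let `b'` be optimal for the shifted
problem, with a large enough total. Then the minimal growth of `b`, that is its shift preceded by
the least value `s₀` related to `b 0`, is at most `b'`. -/
lemma IsOptimalSeq.shift_le {lo' hi' : ℕ → ℤ} {Q' : ℕ → ℤ → ℤ → Prop}
    (hQ' : ∀ l r s r' s', Q' l r s → r' ≤ r → s ≤ s' → Q' l r' s')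
    (hlo : ∀ l, lo' (l + 1) = lo l) (hhi : ∀ l, hi' (l + 1) = hi l)
    (hrel : ∀ l, Q' (l + 1) = Q l) {n m : ℕ} {b b' : ℕ → ℤ} (hmn : m ≤ n)
    (hb : IsOptimalSeq lo hi Q n b) (hb' : IsOptimalSeq lo' hi' Q' (m + 1) b') {s : ℤ}
    (hs : Q' 0 (b 0) s) (hslo : lo' 0 ≤ s) (hshi : s ≤ hi' 0)
    (htot : s + headSum b m ≤ headSum b' (m + 1)) :
    Q' 0 (b 0) (b' 0) ∧ ∀ l < m, b l ≤ b' (l + 1) := by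
  obtain ⟨s₀, ⟨hs₀, hs₀lo⟩, hs₀min⟩ := Int.exists_least_of_bdd
    (P := fun z => Q' 0 (b 0) z ∧ lo' 0 ≤ z) ⟨lo' 0, fun z hz => hz.2⟩ ⟨s, hs, hslo⟩
  have hs₀s := hs₀min s ⟨hs, hslo⟩
  -- the tail of `b'` competes with `b` in the unshifted problem
  have hst' : IsStableSeq lo hi Q m fun l => b' (l + 1) := by
    refine ⟨fun l hl => ?_, fun l hl => ?_⟩
    · rw [← hlo, ← hhi]
      exact hb'.1.1 (l + 1) (by omega)
    · rw [← hrel]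
      exact hb'.1.2 (l + 1) (by omega)
  have htot' := headSum_succ' b' m
  have hquasi : ∀ c, 0 ≤ c → b' 0 - s₀ ≤ c → ∀ i ≤ m,
      headSum b i ≤ headSum (fun l => b' (l + 1)) i + c := fun c hc0 hc i hi'' =>
    hb.quasiconvex hQ hst' hmn (Nat.zero_le i) hi'' le_rfl
      (by rw [headSum_zero, headSum_zero]; omega) (by omega)
  -- otherwise `b 0 ≤ b' 1`, so that `b' 0`, being related to `b' 1`, is related to `b 0` as well,
  -- which contradicts the choice of `s₀`
  have hpos : s₀ ≤ b' 0 := by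
    by_contra hneg
    have h0 := hquasi 0 le_rfl (by omega)
    rcases Nat.eq_zero_or_pos m with rfl | hm
    · rw [headSum_zero] at htot htot'
      omega
    · have h1 := h0 1 hm
      rw [headSum_succ, headSum_succ, headSum_zero, headSum_zero] at h1
      exact hneg (hs₀min _ ⟨hQ' _ _ _ _ _ (hb'.1.2 0 (by omega)) (by simpa using h1) le_rfl,
        (hb'.1.1 0 (by omega)).1⟩)
  -- the shift of `b` preceded by `s₀`; its partial sums are at most those of `b'` by quasiconvexity
  let b₁ : ℕ → ℤ := fun l => Nat.casesOn l s₀ b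
  have hst : IsStableSeq lo' hi' Q' (m + 1) b₁ := by
    refine ⟨fun l hl => ?_, fun l hl => ?_⟩
    · cases l with
      | zero => exact ⟨hs₀lo, hs₀s.trans hshi⟩
      | succ l =>
        rw [hlo, hhi]
        exact hb.1.1 l (by omega)
    · cases l with
      | zero => exact hs₀
      | succ l =>
        rw [hrel]
        exact hb.1.2 l (by omega)
  have hle := fun l (hl : l < m + 1) => hb'.le_of_headSum_le hQ' hst (fun i hi'' => by
    cases i with
    | zero => exact le_rfl
    | succ i =>
      have h1 := hquasi (b' 0 - s₀) (by omega) le_rfl i (by omega)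
      rw [headSum_succ', headSum_succ']
      change headSum b i + s₀ ≤ _
      omega) hl
  exact ⟨hQ' _ _ _ _ _ hs₀ le_rfl hpos, fun l hl => hle (l + 1) (by omega)⟩

end Combinatorics

/-! ### Homogeneous ideals and their pieces -/

section Pieces

variable {k : Type u} [Field k] {τ : Type v}

lemma sum_zcomp (p : MvPolynomial τ k) :
    ∑ d ∈ Finset.range (p.totalDegree + 1), zcomp k τ d p = p := by
  simp only [zcomp_natCast]
  exact sum_homogeneousComponent p

lemma mem_of_zcomp_mem {I : Ideal (MvPolynomial τ k)} {p : MvPolynomial τ k}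
    (h : ∀ n : ℤ, zcomp k τ n p ∈ I) : p ∈ I := by
  rw [← sum_zcomp p]
  exact I.sum_mem fun d _ => h d

lemma IsHomogeneousIdeal.le {I I' : Ideal (MvPolynomial τ k)} (hI : IsHomogeneousIdeal I)
    (h : ∀ n, ∀ p ∈ I, p ∈ zhom k τ n → p ∈ I') : I ≤ I' := fun p hp =>
  mem_of_zcomp_mem fun n => h n _ (hI p hp n) (zcomp_mem n p)

lemma X_mul_mem_zhom (a : τ) {n : ℤ} {p : MvPolynomial τ k} (hp : p ∈ zhom k τ n) :
    X a * p ∈ zhom k τ (n + 1) :=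
  mul_mem_zhom (mem_zhom_natCast.2 (isHomogeneous_X k a)) hp

/-- The homogeneous ideal with given homogeneous pieces. -/
def idealOfPieces (W : ℤ → Submodule k (MvPolynomial τ k))
    (hW : ∀ n a, ∀ p ∈ W n, X a * p ∈ W (n + 1)) : Ideal (MvPolynomial τ k) where
  carrier := {p | ∀ n, zcomp k τ n p ∈ W n}
  add_mem' hp hq n := by
    rw [map_add]
    exact Submodule.add_mem _ (hp n) (hq n)
  zero_mem' n := by
    rw [map_zero]
    exact Submodule.zero_mem _
  smul_mem' r p hp := by
    change ∀ n, _ at hp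
    change ∀ n, zcomp k τ n (r * p) ∈ W n
    induction r using MvPolynomial.induction_on generalizing p with
    | C c =>
      intro n
      rw [C_mul', map_smul]
      exact Submodule.smul_mem _ _ (hp n)
    | add r s hr hs =>
      intro n
      rw [add_mul, map_add]
      exact Submodule.add_mem _ (hr p hp n) (hs p hp n)
    | mul_X r a hr =>
      rw [mul_assoc]
      refine hr _ fun n => ?_
      rw [zcomp_mul (d := 1) (mem_zhom_natCast.2 (isHomogeneous_X k a))]
      have := hW (n - 1) a _ (hp (n - 1))
      rwa [sub_add_cancel] at this

lemma mem_idealOfPieces {W : ℤ → Submodule k (MvPolynomial τ k)}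
    {hW : ∀ n a, ∀ p ∈ W n, X a * p ∈ W (n + 1)} {p : MvPolynomial τ k} :
    p ∈ idealOfPieces W hW ↔ ∀ n, zcomp k τ n p ∈ W n := Iff.rfl

lemma mem_idealOfPieces_of_mem {W : ℤ → Submodule k (MvPolynomial τ k)}
    {hW : ∀ n a, ∀ p ∈ W n, X a * p ∈ W (n + 1)} {n : ℤ} {p : MvPolynomial τ k}
    (hp : p ∈ zhom k τ n) : p ∈ idealOfPieces W hW ↔ p ∈ W n := by
  rw [mem_idealOfPieces]
  refine ⟨fun h => ?_, fun h m => ?_⟩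
  · have := h n
    rwa [zcomp_of_mem hp] at this
  · by_cases hm : m = n
    · rwa [hm, zcomp_of_mem hp]
    · rw [zcomp_of_mem_of_ne hp hm]
      exact Submodule.zero_mem _

lemma isHomogeneousIdeal_idealOfPieces (W : ℤ → Submodule k (MvPolynomial τ k))
    (hW : ∀ n a, ∀ p ∈ W n, X a * p ∈ W (n + 1)) : IsHomogeneousIdeal (idealOfPieces W hW) :=
  fun p hp n => (mem_idealOfPieces_of_mem (zcomp_mem n p)).2 (hp n)

lemma idealOfPieces_inf_zhom {W : ℤ → Submodule k (MvPolynomial τ k)}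
    {hW : ∀ n a, ∀ p ∈ W n, X a * p ∈ W (n + 1)} (n : ℤ) (hn : W n ≤ zhom k τ n) :
    (idealOfPieces W hW).restrictScalars k ⊓ zhom k τ n = W n := by
  ext p
  exact ⟨fun h => (mem_idealOfPieces_of_mem (hW := hW) h.2).1 h.1,
    fun h => ⟨(mem_idealOfPieces_of_mem (hW := hW) (hn h)).2 h, hn h⟩⟩

/-- The ideal whose pieces are those of `𝔞` in degrees below `d`, the space `W` in degree `d`, and
those of `I` in degrees above `d`. -/
lemma exists_splice {𝔞 I : Ideal (MvPolynomial τ k)} {d : ℤ}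
    {W : Submodule k (MvPolynomial τ k)} (hW : W ≤ zhom k τ d)
    (h𝔞W : 𝔞.restrictScalars k ⊓ zhom k τ d ≤ W) (h𝔞I : 𝔞 ≤ I) (h𝔞 : IsHomogeneousIdeal 𝔞)
    (hWI : ∀ a, ∀ p ∈ W, X a * p ∈ I) :
    ∃ J : Ideal (MvPolynomial τ k), IsHomogeneousIdeal J ∧ 𝔞 ≤ J ∧
      (∀ n < d, J.restrictScalars k ⊓ zhom k τ n = 𝔞.restrictScalars k ⊓ zhom k τ n) ∧
      J.restrictScalars k ⊓ zhom k τ d = W ∧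
      ∀ n, d < n → J.restrictScalars k ⊓ zhom k τ n = I.restrictScalars k ⊓ zhom k τ n := by
  let P : ℤ → Submodule k (MvPolynomial τ k) := fun n =>
    if n < d then 𝔞.restrictScalars k ⊓ zhom k τ n else if n = d then W
      else I.restrictScalars k ⊓ zhom k τ n
  have hlt : ∀ n < d, P n = 𝔞.restrictScalars k ⊓ zhom k τ n := fun n hn => if_pos hn
  have heq : P d = W := (if_neg (lt_irrefl d)).trans (if_pos rfl)
  have hgt : ∀ n, d < n → P n = I.restrictScalars k ⊓ zhom k τ n := fun n hn =>
    (if_neg hn.not_gt).trans (if_neg hn.ne')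
  have hle : ∀ n, P n ≤ zhom k τ n := by
    intro n
    rcases lt_trichotomy n d with h | rfl | h
    · rw [hlt n h]
      exact inf_le_right
    · rwa [heq]
    · rw [hgt n h]
      exact inf_le_right
  have hge : ∀ n, 𝔞.restrictScalars k ⊓ zhom k τ n ≤ P n := by
    intro n
    rcases lt_trichotomy n d with h | rfl | h
    · rw [hlt n h]
    · rwa [heq]
    · rw [hgt n h]
      exact inf_le_inf_right _ h𝔞I
  have hP : ∀ n a, ∀ p ∈ P n, X a * p ∈ P (n + 1) := by
    intro n a p hp
    rcases lt_trichotomy n d with h | rfl | h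
    · rw [hlt n h] at hp
      exact hge _ ⟨𝔞.mul_mem_left _ hp.1, X_mul_mem_zhom a hp.2⟩
    · rw [hgt _ (lt_add_one n)]
      rw [heq] at hp
      exact ⟨hWI a p hp, X_mul_mem_zhom a (hW hp)⟩
    · rw [hgt n h] at hp
      rw [hgt _ (by omega)]
      exact ⟨I.mul_mem_left _ hp.1, X_mul_mem_zhom a hp.2⟩
  refine ⟨idealOfPieces P hP, isHomogeneousIdeal_idealOfPieces P hP, ?_, fun n hn => ?_, ?_,
    fun n hn => ?_⟩
  · exact h𝔞.le fun n p hp hpn => (mem_idealOfPieces_of_mem hpn).2 (hge n ⟨hp, hpn⟩)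
  · rw [idealOfPieces_inf_zhom n (hle n), hlt n hn]
  · rw [idealOfPieces_inf_zhom d (hle d), heq]
  · rw [idealOfPieces_inf_zhom n (hle n), hgt n hn]

end Pieces

/-! ### The flags defined by an embedding of Hilbert functions -/

section Flags

variable {k : Type u} [Field k] {σ : Type v}

/-- The class of the homogeneous ideals of `A = k[σ]` that contain `𝔞`, which correspond to the
homogeneous ideals of `A / 𝔞`. -/
structure IsIdealOver (𝔞 I : Ideal (MvPolynomial σ k)) : Prop where
  isHomogeneous : IsHomogeneousIdeal I
  le : 𝔞 ≤ I

/-- An embedding of Hilbert functions for `A / 𝔞`, expressed by homogeneous ideals of `A` that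
contain `𝔞`: it replaces ideals by ideals with the same Hilbert function, and is monotone in the
Hilbert function. -/
structure IsHilbertLift (𝔞 : Ideal (MvPolynomial σ k))
    (ε : Ideal (MvPolynomial σ k) → Ideal (MvPolynomial σ k)) : Prop where
  isIdealOver : ∀ I, IsIdealOver 𝔞 I → IsIdealOver 𝔞 (ε I)
  idealDim_eq : ∀ I, IsIdealOver 𝔞 I → ∀ n, idealDim (ε I) n = idealDim I n
  mono : ∀ I I', IsIdealOver 𝔞 I → IsIdealOver 𝔞 I' → (∀ n, idealDim I n ≤ idealDim I' n) →
    ε I ≤ ε I'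

variable {𝔞 : Ideal (MvPolynomial σ k)}
  {ε : Ideal (MvPolynomial σ k) → Ideal (MvPolynomial σ k)}

lemma idealDim_congr {I I' : Ideal (MvPolynomial σ k)} {n : ℤ}
    (h : I.restrictScalars k ⊓ zhom k σ n = I'.restrictScalars k ⊓ zhom k σ n) :
    idealDim I n = idealDim I' n := by
  rw [idealDim, idealDim, h]

lemma idealDim_top (n : ℤ) :
    idealDim (⊤ : Ideal (MvPolynomial σ k)) n = Module.finrank k (zhom k σ n) := by
  rw [idealDim, Submodule.restrictScalars_top, top_inf_eq]

/-- The flag in the forms of degree `d` that is formed by the pieces of the ideals `ε I`; the index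
`r` is the dimension. -/
def flag (𝔞 : Ideal (MvPolynomial σ k)) (ε : Ideal (MvPolynomial σ k) → Ideal (MvPolynomial σ k))
    (d : ℤ) (r : ℤ) : Submodule k (MvPolynomial σ k) :=
  ⨆ (I : Ideal (MvPolynomial σ k)) (_ : IsIdealOver 𝔞 I) (_ : (idealDim I d : ℤ) ≤ r),
    (ε I).restrictScalars k ⊓ zhom k σ d

lemma flag_mono {d r r' : ℤ} (h : r ≤ r') : flag 𝔞 ε d r ≤ flag 𝔞 ε d r' :=
  iSup_mono fun _ => iSup_mono fun _ => iSup_le fun hr =>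
    le_iSup_of_le (hr.trans h) le_rfl

lemma flag_le_zhom (d r : ℤ) : flag 𝔞 ε d r ≤ zhom k σ d :=
  iSup_le fun _ => iSup_le fun _ => iSup_le fun _ => inf_le_right

/-- `R₁ · V_r ⊆ V_s` for the flags in degrees `d` and `d + 1`. -/
def FlagRel (𝔞 : Ideal (MvPolynomial σ k))
    (ε : Ideal (MvPolynomial σ k) → Ideal (MvPolynomial σ k)) (d r s : ℤ) : Prop :=
  ∀ a, ∀ p ∈ flag 𝔞 ε d r, X a * p ∈ flag 𝔞 ε (d + 1) s

lemma FlagRel.mono {d r s r' s' : ℤ} (h : FlagRel 𝔞 ε d r s) (hr : r' ≤ r) (hs : s ≤ s') :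
    FlagRel 𝔞 ε d r' s' :=
  fun a p hp => flag_mono hs (h a p (flag_mono hr hp))

variable [Finite σ]

lemma idealDim_le_finrank (I : Ideal (MvPolynomial σ k)) (n : ℤ) :
    idealDim I n ≤ Module.finrank k (zhom k σ n) :=
  Submodule.finrank_mono inf_le_right

namespace IsHilbertLift

variable (hε : IsHilbertLift 𝔞 ε) (h𝔞 : IsHomogeneousIdeal 𝔞)
include hε

lemma inf_zhom_eq_of_idealDim_eq {I I' : Ideal (MvPolynomial σ k)} (hI : IsIdealOver 𝔞 I)
    (hI' : IsIdealOver 𝔞 I') (hle : ∀ n, idealDim I n ≤ idealDim I' n) {d : ℤ}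
    (hd : idealDim I d = idealDim I' d) :
    (ε I).restrictScalars k ⊓ zhom k σ d = (ε I').restrictScalars k ⊓ zhom k σ d := by
  refine Submodule.eq_of_le_of_finrank_eq
    (inf_le_inf_right _ (hε.mono I I' hI hI' hle : (ε I).restrictScalars k ≤ _)) ?_
  change idealDim (ε I) d = idealDim (ε I') d
  rw [hε.idealDim_eq I hI, hε.idealDim_eq I' hI', hd]

include h𝔞

/-- The piece of degree `d` of `ε I` depends only on the dimension of the piece of degree `d` of
`I`, and in a monotone way: compare `I` with the ideal that agrees with `I` in degree `d`, with
`𝔞` in smaller degrees, and with the whole ring in larger degrees. -/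
lemma inf_zhom_le {I I' : Ideal (MvPolynomial σ k)} (hI : IsIdealOver 𝔞 I)
    (hI' : IsIdealOver 𝔞 I') {d : ℤ} (hd : idealDim I d ≤ idealDim I' d) :
    (ε I).restrictScalars k ⊓ zhom k σ d ≤ (ε I').restrictScalars k ⊓ zhom k σ d := by
  have key : ∀ I, IsIdealOver 𝔞 I → ∃ T, IsIdealOver 𝔞 T ∧
      (∀ n < d, idealDim T n = idealDim 𝔞 n) ∧ idealDim T d = idealDim I d ∧
      (∀ n, d < n → idealDim T n = idealDim (⊤ : Ideal (MvPolynomial σ k)) n) ∧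
      (ε I).restrictScalars k ⊓ zhom k σ d = (ε T).restrictScalars k ⊓ zhom k σ d := by
    intro I hI
    obtain ⟨L, hL, h𝔞L, hL1, hL2, hL3⟩ := exists_splice (W := I.restrictScalars k ⊓ zhom k σ d)
      inf_le_right (inf_le_inf_right _ hI.le) hI.le h𝔞 fun a p hp => I.mul_mem_left _ hp.1
    obtain ⟨T, hT, h𝔞T, hT1, hT2, hT3⟩ := exists_splice (I := ⊤)
      (W := I.restrictScalars k ⊓ zhom k σ d)
      inf_le_right (inf_le_inf_right _ hI.le) le_top h𝔞 fun a p hp => trivial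
    have hTd : idealDim T d = idealDim I d := idealDim_congr hT2
    have hLd : idealDim L d = idealDim I d := idealDim_congr hL2
    refine ⟨T, ⟨hT, h𝔞T⟩, fun n hn => idealDim_congr (hT1 n hn), hTd,
      fun n hn => idealDim_congr (hT3 n hn), ?_⟩
    rw [← hε.inf_zhom_eq_of_idealDim_eq ⟨hL, h𝔞L⟩ hI (fun n => ?_) hLd]
    · refine hε.inf_zhom_eq_of_idealDim_eq ⟨hL, h𝔞L⟩ ⟨hT, h𝔞T⟩ (fun n => ?_) (hLd.trans hTd.symm)
      rcases lt_trichotomy n d with h | rfl | h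
      · rw [idealDim_congr (hL1 n h), idealDim_congr (hT1 n h)]
      · rw [hLd, hTd]
      · rw [idealDim_congr (hT3 n h)]
        exact idealDim_mono le_top n
    · rcases lt_trichotomy n d with h | rfl | h
      · rw [idealDim_congr (hL1 n h)]
        exact idealDim_mono hI.le n
      · rw [hLd]
      · rw [idealDim_congr (hL3 n h)]
  obtain ⟨T, hT, hT1, hT2, hT3, hT4⟩ := key I hI
  obtain ⟨T', hT', hT1', hT2', hT3', hT4'⟩ := key I' hI'
  rw [hT4, hT4']
  refine inf_le_inf_right _ (hε.mono T T' hT hT' fun n => ?_ : (ε T).restrictScalars k ≤ _)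
  rcases lt_trichotomy n d with h | rfl | h
  · rw [hT1 n h, hT1' n h]
  · rwa [hT2, hT2']
  · rw [hT3 n h, hT3' n h]

end IsHilbertLift

namespace IsHilbertLift

variable (hε : IsHilbertLift 𝔞 ε) (h𝔞 : IsHomogeneousIdeal 𝔞)
include hε h𝔞

lemma inf_zhom_eq_flag {I : Ideal (MvPolynomial σ k)} (hI : IsIdealOver 𝔞 I) (d : ℤ) :
    (ε I).restrictScalars k ⊓ zhom k σ d = flag 𝔞 ε d (idealDim I d) := by
  refine le_antisymm (le_iSup_of_le I (le_iSup_of_le hI (le_iSup_of_le le_rfl le_rfl))) ?_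
  exact iSup_le fun I' => iSup_le fun hI' => iSup_le fun h =>
    hε.inf_zhom_le h𝔞 hI' hI (by exact_mod_cast h)

/-- Every subspace of the forms of degree `d` is a piece of an ideal, hence the flags are
complete. -/
lemma finrank_flag {d r : ℤ} (h₁ : (idealDim 𝔞 d : ℤ) ≤ r)
    (h₂ : r ≤ Module.finrank k (zhom k σ d)) : (Module.finrank k (flag 𝔞 ε d r) : ℤ) = r := by
  lift r to ℕ using (Int.natCast_nonneg _).trans h₁
  obtain ⟨W, hW1, hW2, hW3⟩ := exists_submodule_finrank_eq
    (inf_le_right : 𝔞.restrictScalars k ⊓ zhom k σ d ≤ zhom k σ d)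
    (by exact_mod_cast h₁ : _ ≤ r) (by exact_mod_cast h₂)
  obtain ⟨T, hT, h𝔞T, -, hT2, -⟩ := exists_splice (I := ⊤) hW2 hW1 le_top h𝔞 fun a p hp => trivial
  have hTd : idealDim T d = r := by rw [idealDim, hT2, hW3]
  have h := hε.inf_zhom_eq_flag h𝔞 ⟨hT, h𝔞T⟩ d
  rw [hTd] at h
  rw [← h, ← hTd, ← hε.idealDim_eq T ⟨hT, h𝔞T⟩ d]
  rfl

lemma le_flag {d r : ℤ} (h₁ : (idealDim 𝔞 d : ℤ) ≤ r) :
    𝔞.restrictScalars k ⊓ zhom k σ d ≤ flag 𝔞 ε d r := by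
  have h𝔞' : IsIdealOver 𝔞 𝔞 := ⟨h𝔞, le_rfl⟩
  refine le_trans ?_ (flag_mono h₁)
  rw [← hε.inf_zhom_eq_flag h𝔞 h𝔞']
  exact inf_le_inf_right _ ((hε.isIdealOver 𝔞 h𝔞').le : 𝔞.restrictScalars k ≤ _)

/-- If `𝔪 I ⊆ I' ⊆ I`, then the dimensions of the pieces of `I` and `I'` in consecutive degrees
are related. -/
lemma flagRel {I I' : Ideal (MvPolynomial σ k)} (hI : IsIdealOver 𝔞 I) (hI' : IsIdealOver 𝔞 I')
    (hmul : ∀ a, ∀ p ∈ I, X a * p ∈ I') (d : ℤ) :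
    FlagRel 𝔞 ε d (idealDim I d) (idealDim I' (d + 1)) := by
  obtain ⟨J, hJ, h𝔞J, -, hJ2, hJ3⟩ := exists_splice (W := I.restrictScalars k ⊓ zhom k σ d)
      inf_le_right (inf_le_inf_right _ hI.le) hI'.le h𝔞 fun a p hp => hmul a p hp.1
  have h1 := hε.inf_zhom_eq_flag h𝔞 ⟨hJ, h𝔞J⟩ d
  have h2 := hε.inf_zhom_eq_flag h𝔞 ⟨hJ, h𝔞J⟩ (d + 1)
  rw [show idealDim J d = idealDim I d from idealDim_congr hJ2] at h1
  rw [show idealDim J (d + 1) = idealDim I' (d + 1) from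
    idealDim_congr (hJ3 _ (lt_add_one d))] at h2
  intro a p hp
  rw [← h1] at hp
  rw [← h2]
  exact ⟨(ε J).mul_mem_left _ hp.1, X_mul_mem_zhom a hp.2⟩

/-- The ideals all of whose pieces belong to the flags are fixed by `ε`. -/
lemma eq_of_flag {I : Ideal (MvPolynomial σ k)} (hI : IsIdealOver 𝔞 I)
    (h : ∀ n, I.restrictScalars k ⊓ zhom k σ n = flag 𝔞 ε n (idealDim I n)) : ε I = I := by
  have heq : ∀ n, (ε I).restrictScalars k ⊓ zhom k σ n = I.restrictScalars k ⊓ zhom k σ n :=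
    fun n => (hε.inf_zhom_eq_flag h𝔞 hI n).trans (h n).symm
  refine le_antisymm ((hε.isIdealOver I hI).isHomogeneous.le fun n p hp hpn => ?_)
    (hI.isHomogeneous.le fun n p hp hpn => ?_)
  · have : p ∈ (ε I).restrictScalars k ⊓ zhom k σ n := ⟨hp, hpn⟩
    rw [heq] at this
    exact this.1
  · have : p ∈ I.restrictScalars k ⊓ zhom k σ n := ⟨hp, hpn⟩
    rw [← heq] at this
    exact this.1

end IsHilbertLift

end Flags

/-! ### Coefficients with respect to `z` -/

section ZCoeff

variable {k : Type u} [Field k] {σ : Type v}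

/-- The coefficient of `z ^ l` of an element of `B = A[z]`. -/
def zCoeff (l : ℕ) : MvPolynomial (Option σ) k →ₗ[k] MvPolynomial σ k where
  toFun p := (optionEquivLeft k σ p).coeff l
  map_add' p q := by rw [map_add, Polynomial.coeff_add]
  map_smul' c p := by rw [map_smul, Polynomial.coeff_smul, RingHom.id_apply]

lemma zCoeff_apply (l : ℕ) (p : MvPolynomial (Option σ) k) :
    zCoeff l p = (optionEquivLeft k σ p).coeff l := rfl

lemma optionEquivLeft_incl (a : MvPolynomial σ k) :
    optionEquivLeft k σ (incl k σ a) = Polynomial.C a := by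
  have h : ((optionEquivLeft k σ : MvPolynomial (Option σ) k →ₐ[k] _).comp (incl k σ)) =
      (Algebra.ofId (MvPolynomial σ k) (Polynomial (MvPolynomial σ k))).restrictScalars k := by
    ext1 s
    simp [incl, optionEquivLeft_X_some, Algebra.ofId_apply]
  exact DFunLike.congr_fun h a

lemma zCoeff_mul (l : ℕ) (p q : MvPolynomial (Option σ) k) : zCoeff l (p * q) =
    ∑ x ∈ Finset.HasAntidiagonal.antidiagonal l, zCoeff x.1 p * zCoeff x.2 q := by
  rw [zCoeff_apply, map_mul, Polynomial.coeff_mul]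
  rfl

lemma zCoeff_incl_mul (l : ℕ) (a : MvPolynomial σ k) (p : MvPolynomial (Option σ) k) :
    zCoeff l (incl k σ a * p) = a * zCoeff l p := by
  rw [zCoeff_apply, map_mul, optionEquivLeft_incl, Polynomial.coeff_C_mul, zCoeff_apply]

lemma zCoeff_zero_z_mul (p : MvPolynomial (Option σ) k) : zCoeff 0 (X none * p) = 0 := by
  rw [zCoeff_apply, map_mul, optionEquivLeft_X_none, Polynomial.coeff_X_mul_zero]

lemma zCoeff_succ_z_mul (l : ℕ) (p : MvPolynomial (Option σ) k) :
    zCoeff (l + 1) (X none * p) = zCoeff l p := by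
  rw [zCoeff_apply, map_mul, optionEquivLeft_X_none, Polynomial.coeff_X_mul, zCoeff_apply]

lemma zCoeff_incl_mul_pow (l m : ℕ) (a : MvPolynomial σ k) :
    zCoeff l (incl k σ a * X none ^ m) = if l = m then a else 0 := by
  rw [zCoeff_apply, map_mul, map_pow, optionEquivLeft_incl, optionEquivLeft_X_none,
    Polynomial.coeff_C_mul_X_pow]

lemma zCoeff_ext {p q : MvPolynomial (Option σ) k} (h : ∀ l, zCoeff l p = zCoeff l q) : p = q :=
  (optionEquivLeft k σ).injective (Polynomial.ext h)

lemma coeff_zCoeff (l : ℕ) (u : σ →₀ ℕ) (p : MvPolynomial (Option σ) k) :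
    coeff u (zCoeff l p) = coeff (u.optionElim l) p :=
  optionEquivLeft_coeff_coeff k p l u

lemma exists_sum_zCoeff (p : MvPolynomial (Option σ) k) :
    ∃ N, p = ∑ l ∈ Finset.range N, incl k σ (zCoeff l p) * X none ^ l := by
  refine ⟨(optionEquivLeft k σ p).natDegree + 1, zCoeff_ext fun l => ?_⟩
  rw [map_sum]
  simp only [zCoeff_incl_mul_pow]
  rw [Finset.sum_ite_eq]
  split_ifs with h
  · rfl
  · exact Polynomial.coeff_eq_zero_of_natDegree_lt (by simpa using h)

lemma optionElim_eq_add (l : ℕ) (u : σ →₀ ℕ) :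
    u.optionElim l = Finsupp.single none l + u.embDomain Function.Embedding.some := by
  classical
  ext o
  cases o with
  | none =>
    have : u.embDomain Function.Embedding.some none = 0 :=
      Finsupp.embDomain_of_notMem_range _ _ _ (by simp)
    simp [this]
  | some s =>
    have := Finsupp.embDomain_apply_self Function.Embedding.some u s
    simp only [Function.Embedding.some_apply] at this
    simp [this]

lemma degree_optionElim (l : ℕ) (u : σ →₀ ℕ) : (u.optionElim l).degree = l + u.degree := by
  rw [optionElim_eq_add, map_add, Finsupp.degree_single, Finsupp.degree_apply,
    Finsupp.degree_apply, Finsupp.support_embDomain, Finset.sum_map]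
  simp only [Finsupp.embDomain_apply_self]

lemma mem_zhom_iff_zCoeff {n : ℤ} {p : MvPolynomial (Option σ) k} :
    p ∈ zhom k (Option σ) n ↔ ∀ l : ℕ, zCoeff l p ∈ zhom k σ (n - l) := by
  constructor
  · intro hp l u hu
    rw [coeff_zCoeff] at hu
    have := hp _ hu
    rw [degree_optionElim] at this
    push_cast at this
    omega
  · intro h u hu
    have hu' : u = u.some.optionElim (u none) := u.optionElim_some.symm
    rw [hu', ← coeff_zCoeff] at hu
    have := h _ _ hu
    rw [hu', degree_optionElim]
    push_cast
    omega

lemma incl_mul_pow_mem_zhom {n : ℤ} {a : MvPolynomial σ k} (l : ℕ) (ha : a ∈ zhom k σ (n - l)) :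
    incl k σ a * X none ^ l ∈ zhom k (Option σ) n := by
  rw [mem_zhom_iff_zCoeff]
  intro m
  rw [zCoeff_incl_mul_pow]
  split_ifs with h
  · rwa [h]
  · exact Submodule.zero_mem _

lemma zcomp_incl_mul_pow (n : ℤ) (l : ℕ) (a : MvPolynomial σ k) :
    zcomp k (Option σ) n (incl k σ a * X none ^ l) =
      incl k σ (zcomp k σ (n - l) a) * X none ^ l := by
  conv_lhs => rw [← sum_zcomp a]
  rw [map_sum, Finset.sum_mul, map_sum]
  conv_rhs => rw [← sum_zcomp a]
  rw [map_sum, map_sum, Finset.sum_mul]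
  refine Finset.sum_congr rfl fun d _ => ?_
  by_cases h : (d : ℤ) = n - l
  · rw [zcomp_of_mem (incl_mul_pow_mem_zhom l (by rw [← h]; exact zcomp_mem _ _)), ← h,
      zcomp_of_mem (zcomp_mem _ _)]
  · rw [zcomp_of_mem_of_ne (m := d + l) (incl_mul_pow_mem_zhom l
      (by rw [add_sub_cancel_right]; exact zcomp_mem _ _)) (by omega),
      zcomp_of_mem_of_ne (zcomp_mem _ _) (Ne.symm h), map_zero, zero_mul]

/-! ### Ideals of `A[z]` that are graded by the powers of `z` -/

/-- The ideal `⨁ J_l z^l` of `A[z]`, for an increasing sequence of ideals `J_l` of `A`. -/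
def ofSlices (𝒥 : ℕ → Ideal (MvPolynomial σ k)) (h𝒥 : Monotone 𝒥) :
    Ideal (MvPolynomial (Option σ) k) where
  carrier := {p | ∀ l, zCoeff l p ∈ 𝒥 l}
  add_mem' hp hq l := by
    rw [map_add]
    exact (𝒥 l).add_mem (hp l) (hq l)
  zero_mem' l := by
    rw [map_zero]
    exact (𝒥 l).zero_mem
  smul_mem' r p hp l := by
    rw [smul_eq_mul, zCoeff_mul]
    refine (𝒥 l).sum_mem fun x hx => (𝒥 l).mul_mem_left _ (h𝒥 ?_ (hp x.2))
    have := Finset.HasAntidiagonal.mem_antidiagonal.1 hx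
    omega

/-- The ideal `{a ∈ A | a z^l ∈ J}` of `A`, for an ideal `J` of `A[z]`. -/
def slicesOf (J : Ideal (MvPolynomial (Option σ) k)) (l : ℕ) : Ideal (MvPolynomial σ k) where
  carrier := {a | incl k σ a * X none ^ l ∈ J}
  add_mem' ha hb := by
    rw [Set.mem_ofPred_eq, map_add, add_mul]
    exact J.add_mem ha hb
  zero_mem' := by
    rw [Set.mem_ofPred_eq, map_zero, zero_mul]
    exact J.zero_mem
  smul_mem' r a ha := by
    rw [Set.mem_ofPred_eq, smul_eq_mul, map_mul, mul_assoc]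
    exact J.mul_mem_left _ ha

lemma mem_ofSlices {𝒥 : ℕ → Ideal (MvPolynomial σ k)} {h𝒥 : Monotone 𝒥}
    {p : MvPolynomial (Option σ) k} : p ∈ ofSlices 𝒥 h𝒥 ↔ ∀ l, zCoeff l p ∈ 𝒥 l := Iff.rfl

lemma mem_slicesOf {J : Ideal (MvPolynomial (Option σ) k)} {l : ℕ} {a : MvPolynomial σ k} :
    a ∈ slicesOf J l ↔ incl k σ a * X none ^ l ∈ J := Iff.rfl

lemma monotone_slicesOf (J : Ideal (MvPolynomial (Option σ) k)) : Monotone (slicesOf J) :=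
  monotone_nat_of_le_succ fun l a ha => by
    rw [mem_slicesOf, pow_succ, ← mul_assoc]
    exact J.mul_mem_right _ ha

lemma slicesOf_ofSlices (𝒥 : ℕ → Ideal (MvPolynomial σ k)) (h𝒥 : Monotone 𝒥) :
    slicesOf (ofSlices 𝒥 h𝒥) = 𝒥 := by
  ext l a
  rw [mem_slicesOf, mem_ofSlices]
  refine ⟨fun h => ?_, fun h m => ?_⟩
  · simpa [zCoeff_incl_mul_pow] using h l
  · rw [zCoeff_incl_mul_pow]
    split_ifs with hm
    · rwa [hm]
    · exact (𝒥 m).zero_mem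

lemma isHomogeneousIdeal_ofSlices {𝒥 : ℕ → Ideal (MvPolynomial σ k)} (h𝒥 : Monotone 𝒥)
    (h : ∀ l, IsHomogeneousIdeal (𝒥 l)) : IsHomogeneousIdeal (ofSlices 𝒥 h𝒥) := by
  intro p hp n l
  have h1 : zCoeff l (zcomp k (Option σ) n p) = zcomp k σ (n - l) (zCoeff l p) := by
    obtain ⟨N, hN⟩ := exists_sum_zCoeff p
    conv_lhs => rw [hN]
    rw [map_sum, map_sum]
    simp only [zcomp_incl_mul_pow, zCoeff_incl_mul_pow]
    conv_rhs => rw [hN]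
    rw [map_sum, map_sum]
    refine Finset.sum_congr rfl fun m _ => ?_
    rw [zCoeff_incl_mul_pow]
    split_ifs with hm
    · rw [hm]
    · rw [map_zero]
  rw [h1]
  exact h l _ (hp l) _

/-- `J` contains the components of its elements for the grading by the powers of `z`. -/
def IsZGraded (J : Ideal (MvPolynomial (Option σ) k)) : Prop :=
  ∀ p ∈ J, ∀ l, incl k σ (zCoeff l p) * X none ^ l ∈ J

lemma IsZGraded.ofSlices_slicesOf {J : Ideal (MvPolynomial (Option σ) k)} (hJ : IsZGraded J) :
    ofSlices (slicesOf J) (monotone_slicesOf J) = J := by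
  ext p
  rw [mem_ofSlices]
  refine ⟨fun h => ?_, fun h l => hJ p h l⟩
  obtain ⟨N, hN⟩ := exists_sum_zCoeff p
  rw [hN]
  exact J.sum_mem fun l _ => h l

lemma ofSlices_congr {𝒥 𝒥' : ℕ → Ideal (MvPolynomial σ k)} {h𝒥 : Monotone 𝒥}
    {h𝒥' : Monotone 𝒥'} (h : 𝒥 = 𝒥') : ofSlices 𝒥 h𝒥 = ofSlices 𝒥' h𝒥' := by
  subst h
  rfl

lemma ofSlices_mono {𝒥 𝒥' : ℕ → Ideal (MvPolynomial σ k)} {h𝒥 : Monotone 𝒥}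
    {h𝒥' : Monotone 𝒥'} (h : ∀ l, 𝒥 l ≤ 𝒥' l) : ofSlices 𝒥 h𝒥 ≤ ofSlices 𝒥' h𝒥' :=
  fun _ hp l => h l (hp l)

/-- The vector of the first `N` coefficients with respect to `z`. -/
def zCoeffs (N : ℕ) : MvPolynomial (Option σ) k →ₗ[k] (Fin N → MvPolynomial σ k) :=
  LinearMap.pi fun l => zCoeff l

/-- A polynomial of degree `D` is determined by its coefficients at `z^l` for `l ≤ D`. -/
lemma eq_zero_of_zCoeff {D : ℕ} {p : MvPolynomial (Option σ) k} (hp : p ∈ zhom k (Option σ) D)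
    (h : ∀ l < D + 1, zCoeff l p = 0) : p = 0 := by
  refine zCoeff_ext fun l => ?_
  rw [map_zero]
  by_cases hl : l < D + 1
  · exact h l hl
  · have := mem_zhom_iff_zCoeff.1 hp l
    rwa [zhom_of_neg (by omega)] at this

lemma zCoeff_sum_incl_mul_pow {N : ℕ} (a : Fin N → MvPolynomial σ k) (l : ℕ) :
    zCoeff l (∑ m : Fin N, incl k σ (a m) * X none ^ (m : ℕ)) =
      if h : l < N then a ⟨l, h⟩ else 0 := by
  rw [map_sum]
  simp only [zCoeff_incl_mul_pow]
  split_ifs with h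
  · rw [Finset.sum_eq_single ⟨l, h⟩]
    · simp
    · intro m _ hm
      rw [if_neg fun h' => hm (Fin.ext h'.symm)]
    · simp
  · refine Finset.sum_eq_zero fun m _ => if_neg fun h' => h (by rw [show l = m from h']; exact m.2)

lemma idealDim_ofSlices [Finite σ] {𝒥 : ℕ → Ideal (MvPolynomial σ k)} (h𝒥 : Monotone 𝒥)
    (D : ℕ) : idealDim (ofSlices 𝒥 h𝒥) D =
      ∑ l ∈ Finset.range (D + 1), idealDim (𝒥 l) ((D : ℤ) - l) := by
  have hinj : ∀ p ∈ (ofSlices 𝒥 h𝒥).restrictScalars k ⊓ zhom k (Option σ) D,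
      zCoeffs (D + 1) p = 0 → p = 0 := fun p hp h =>
    eq_zero_of_zCoeff hp.2 fun l hl => congrFun h ⟨l, hl⟩
  have hmap : ((ofSlices 𝒥 h𝒥).restrictScalars k ⊓ zhom k (Option σ) D).map (zCoeffs (D + 1)) =
      Submodule.pi Set.univ fun l : Fin (D + 1) =>
        (𝒥 l).restrictScalars k ⊓ zhom k σ ((D : ℤ) - (l : ℕ)) := by
    ext a
    constructor
    · rintro ⟨p, hp, rfl⟩ l -
      exact ⟨hp.1 l, mem_zhom_iff_zCoeff.1 hp.2 l⟩
    · intro ha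
      have ha' : ∀ l : Fin (D + 1), a l ∈ 𝒥 l ∧ a l ∈ zhom k σ ((D : ℤ) - (l : ℕ)) :=
        fun l => ha l trivial
      refine ⟨∑ m, incl k σ (a m) * X none ^ (m : ℕ), ⟨fun l => ?_, ?_⟩, ?_⟩
      · rw [zCoeff_sum_incl_mul_pow]
        split_ifs with h
        · exact (ha' ⟨l, h⟩).1
        · exact (𝒥 l).zero_mem
      · exact (zhom k (Option σ) D).sum_mem fun m _ => incl_mul_pow_mem_zhom m (ha' m).2
      · ext1 l
        exact (zCoeff_sum_incl_mul_pow a l).trans (dif_pos l.2)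
  rw [idealDim, ← finrank_map_of_injOn (zCoeffs (D + 1)) hinj, hmap, finrank_submodule_pi,
    Finset.sum_range]
  rfl

end ZCoeff

/-! ### Graded ideals of quotients of polynomial rings -/

section QuotientIdeals

/-- Ideals generated by elements of a prescribed kind correspond to each other under the
passage to a quotient ring. -/
lemma eq_span_inter_iff_comap {P : Type*} [CommRing P] {𝔟 : Ideal P} (E : Set P)
    (h𝔟 : 𝔟 ≤ Ideal.span {p | p ∈ 𝔟 ∧ p ∈ E}) (I : Ideal (P ⧸ 𝔟)) :
    I = Ideal.span {x | x ∈ I ∧ x ∈ Ideal.Quotient.mk 𝔟 '' E} ↔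
      I.comap (Ideal.Quotient.mk 𝔟) =
        Ideal.span {p | p ∈ I.comap (Ideal.Quotient.mk 𝔟) ∧ p ∈ E} := by
  have hle : 𝔟 ≤ I.comap (Ideal.Quotient.mk 𝔟) := fun p hp => by
    rw [Ideal.mem_comap, Ideal.Quotient.eq_zero_iff_mem.2 hp]
    exact I.zero_mem
  have hmap : (Ideal.span {p | p ∈ I.comap (Ideal.Quotient.mk 𝔟) ∧ p ∈ E}).map
      (Ideal.Quotient.mk 𝔟) = Ideal.span {x | x ∈ I ∧ x ∈ Ideal.Quotient.mk 𝔟 '' E} := by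
    rw [Ideal.map_span]
    congr 1
    ext x
    constructor
    · rintro ⟨p, hp, rfl⟩
      exact ⟨hp.1, p, hp.2, rfl⟩
    · rintro ⟨hx, p, hp, rfl⟩
      exact ⟨p, ⟨hx, hp⟩, rfl⟩
  constructor
  · intro h
    conv_lhs => rw [h]
    rw [← hmap, Ideal.comap_map_of_surjective _ Ideal.Quotient.mk_surjective,
      ← RingHom.ker_eq_comap_bot, Ideal.mk_ker]
    exact sup_eq_left.2 (h𝔟.trans (Ideal.span_mono fun p hp => ⟨hle hp.1, hp.2⟩))
  · intro h
    conv_lhs => rw [← Ideal.map_comap_of_surjective _ Ideal.Quotient.mk_surjective I, h]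
    rw [hmap]

variable {k : Type u} [Field k] {τ : Type v}

lemma isHomogeneousIdeal_iff {I : Ideal (MvPolynomial τ k)} : IsHomogeneousIdeal I ↔
    I = Ideal.span {p | p ∈ I ∧ ∃ d, p ∈ homogeneousSubmodule τ k d} := by
  constructor
  · intro hI
    refine le_antisymm (fun p hp => ?_) (Ideal.span_le.2 fun p hp => hp.1)
    rw [← sum_zcomp p]
    exact Ideal.sum_mem _ fun d _ => Ideal.subset_span
      ⟨hI p hp d, d, mem_zhom_natCast.1 (zcomp_mem _ _)⟩
  · intro h p hp
    rw [h] at hp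
    refine Submodule.span_induction (fun q hq n => ?_) (fun n => ?_)
      (fun q r _ _ hq hr n => ?_) (fun r q _ hq n => ?_) hp
    · obtain ⟨hq, d, hd⟩ := hq
      by_cases hn : n = d
      · rwa [hn, zcomp_of_mem (mem_zhom_natCast.2 hd)]
      · rw [zcomp_of_mem_of_ne (mem_zhom_natCast.2 hd) hn]
        exact I.zero_mem
    · rw [map_zero]
      exact I.zero_mem
    · rw [map_add]
      exact I.add_mem (hq n) (hr n)
    · rw [smul_eq_mul, ← sum_zcomp r, Finset.sum_mul, map_sum]
      refine I.sum_mem fun d _ => ?_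
      rw [zcomp_mul (zcomp_mem _ _)]
      exact I.mul_mem_left _ (hq _)

lemma isHomogeneousIdeal_of_isGradedIdeal {I : Ideal (MvPolynomial τ k)}
    (h : IsGradedIdeal (homogeneousSubmodule τ k) I) : IsHomogeneousIdeal I :=
  isHomogeneousIdeal_iff.2 h

variable {𝔟 : Ideal (MvPolynomial τ k)}

lemma le_comap_mk {P : Type*} [CommRing P] (𝔟 : Ideal P) (I : Ideal (P ⧸ 𝔟)) :
    𝔟 ≤ I.comap (Ideal.Quotient.mk 𝔟) := fun p hp => by
  rw [Ideal.mem_comap, Ideal.Quotient.eq_zero_iff_mem.2 hp]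
  exact I.zero_mem

lemma mem_idealPoset_iff (h𝔟 : IsHomogeneousIdeal 𝔟) (I : Ideal (MvPolynomial τ k ⧸ 𝔟)) :
    I ∈ idealPoset k τ (MvPolynomial τ k ⧸ 𝔟) ↔
      IsHomogeneousIdeal (I.comap (Ideal.Quotient.mk 𝔟)) := by
  rw [isHomogeneousIdeal_iff]
  refine Iff.trans ?_ (eq_span_inter_iff_comap {p | ∃ d, p ∈ homogeneousSubmodule τ k d}
    (isHomogeneousIdeal_iff.1 h𝔟).le I)
  have : {x | x ∈ I ∧ ∃ d, x ∈ piece k τ (MvPolynomial τ k ⧸ 𝔟) d} =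
      {x | x ∈ I ∧ x ∈ Ideal.Quotient.mk 𝔟 '' {p | ∃ d, p ∈ homogeneousSubmodule τ k d}} := by
    ext x
    constructor
    · rintro ⟨hx, d, p, hp, rfl⟩
      exact ⟨hx, p, ⟨d, hp⟩, rfl⟩
    · rintro ⟨hx, p, ⟨d, hp⟩, rfl⟩
      exact ⟨hx, d, p, hp, rfl⟩
  rw [← this]
  rfl

/-- The Hilbert function of an ideal of the quotient by `𝔟` differs from that of its preimage by the
Hilbert function of `𝔟`. -/
lemma hilb_add_idealDim [Finite τ] (I : Ideal (MvPolynomial τ k ⧸ 𝔟)) (d : ℕ) :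
    hilb k τ I d + idealDim 𝔟 d = idealDim (I.comap (Ideal.Quotient.mk 𝔟)) d := by
  have h := finrank_map_add_finrank_inf_ker
    (IsScalarTower.toAlgHom k (MvPolynomial τ k) (MvPolynomial τ k ⧸ 𝔟)).toLinearMap
    ((I.comap (Ideal.Quotient.mk 𝔟)).restrictScalars k ⊓ zhom k τ d)
  have h1 : ((I.comap (Ideal.Quotient.mk 𝔟)).restrictScalars k ⊓ zhom k τ d).map
      (IsScalarTower.toAlgHom k (MvPolynomial τ k) (MvPolynomial τ k ⧸ 𝔟)).toLinearMap =
      I.restrictScalars k ⊓ piece k τ (MvPolynomial τ k ⧸ 𝔟) d := by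
    ext x
    constructor
    · rintro ⟨p, hp, rfl⟩
      exact ⟨hp.1, p, mem_zhom_natCast.1 hp.2, rfl⟩
    · rintro ⟨hx, p, hp, rfl⟩
      exact ⟨p, ⟨hx, mem_zhom_natCast.2 hp⟩, rfl⟩
  have h2 : (I.comap (Ideal.Quotient.mk 𝔟)).restrictScalars k ⊓ zhom k τ d ⊓
      LinearMap.ker
        (IsScalarTower.toAlgHom k (MvPolynomial τ k) (MvPolynomial τ k ⧸ 𝔟)).toLinearMap =
      𝔟.restrictScalars k ⊓ zhom k τ d := by
    ext p
    constructor
    · rintro ⟨⟨-, hp⟩, h⟩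
      exact ⟨Ideal.Quotient.eq_zero_iff_mem.1 h, hp⟩
    · rintro ⟨h, hp⟩
      exact ⟨⟨le_comap_mk 𝔟 I h, hp⟩, Ideal.Quotient.eq_zero_iff_mem.2 h⟩
  rw [h1, h2] at h
  exact h

lemma hilb_le_iff [Finite τ] {I I' : Ideal (MvPolynomial τ k ⧸ 𝔟)} :
    hilb k τ I ≤ hilb k τ I' ↔ ∀ d : ℕ, idealDim (I.comap (Ideal.Quotient.mk 𝔟)) d ≤
      idealDim (I'.comap (Ideal.Quotient.mk 𝔟)) d := by
  refine forall_congr' fun d => ?_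
  rw [← hilb_add_idealDim, ← hilb_add_idealDim]
  exact (Nat.add_le_add_iff_right).symm

lemma idealDim_of_neg {I : Ideal (MvPolynomial τ k)} {n : ℤ} (hn : n < 0) : idealDim I n = 0 := by
  rw [idealDim, zhom_of_neg hn, inf_bot_eq, finrank_bot]

lemma ker_algebraMap_quotient (I : Ideal (MvPolynomial τ k ⧸ 𝔟)) :
    RingHom.ker (algebraMap (MvPolynomial τ k) ((MvPolynomial τ k ⧸ 𝔟) ⧸ I)) =
      I.comap (Ideal.Quotient.mk 𝔟) := by
  ext p
  exact Ideal.Quotient.eq_zero_iff_mem (I := I) (a := Ideal.Quotient.mk 𝔟 p)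

lemma isGradedQuotient_quotient {I : Ideal (MvPolynomial τ k ⧸ 𝔟)}
    (hI : IsHomogeneousIdeal (I.comap (Ideal.Quotient.mk 𝔟))) :
    IsGradedQuotient k τ ((MvPolynomial τ k ⧸ 𝔟) ⧸ I) where
  surjective := Ideal.Quotient.mk_surjective.comp Ideal.Quotient.mk_surjective
  zcomp_mem p n hp := by
    have h := ker_algebraMap_quotient I
    have hp' : p ∈ I.comap (Ideal.Quotient.mk 𝔟) := h ▸ hp
    have := hI p hp' n
    rwa [← h] at this

end QuotientIdeals

/-! ### Bigraded ideals of `A[z]` -/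

section Bigraded

variable {k : Type u} [Field k] {σ : Type v}

lemma weight_bidegree_optionElim (l : ℕ) (u : σ →₀ ℕ) :
    Finsupp.weight bidegree (u.optionElim l) = (u.degree, l) := by
  rw [optionElim_eq_add, map_add, Finsupp.weight_single, Finsupp.weight_apply,
    Finsupp.sum_embDomain, Finsupp.degree_apply, Finsupp.sum]
  refine Prod.ext ?_ ?_
  · rw [Prod.fst_add, Prod.fst_sum]
    simp [bidegree]
  · rw [Prod.snd_add, Prod.snd_sum]
    simp [bidegree]

/-- The elements of bidegree `(d, l)` are the products `a z^l` with a form `a` of degree `d`. -/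
lemma mem_weightedHomogeneousSubmodule_bidegree {d l : ℕ} {p : MvPolynomial (Option σ) k} :
    p ∈ weightedHomogeneousSubmodule k bidegree (d, l) ↔
      ∃ a ∈ zhom k σ d, p = incl k σ a * X none ^ l := by
  rw [mem_weightedHomogeneousSubmodule]
  constructor
  · intro h
    have h1 : ∀ m u, coeff u (zCoeff m p) ≠ 0 → u.degree = d ∧ m = l := by
      intro m u hu
      rw [coeff_zCoeff] at hu
      have := h hu
      rw [weight_bidegree_optionElim] at this
      exact ⟨congrArg Prod.fst this, congrArg Prod.snd this⟩
    refine ⟨zCoeff l p, fun u hu => ?_, zCoeff_ext fun m => ?_⟩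
    · exact_mod_cast (h1 l u hu).1
    · rw [zCoeff_incl_mul_pow]
      split_ifs with hm
      · rw [hm]
      · ext u
        by_contra hne
        rw [coeff_zero] at hne
        exact hm (h1 m u hne).2
  · rintro ⟨a, ha, rfl⟩ u hu
    have hu' : u = u.some.optionElim (u none) := u.optionElim_some.symm
    rw [hu', ← coeff_zCoeff, zCoeff_incl_mul_pow] at hu
    rw [hu', weight_bidegree_optionElim]
    split_ifs at hu with h
    · have := ha _ hu
      rw [Prod.mk.injEq]
      exact ⟨by exact_mod_cast this, h⟩
    · exact absurd (coeff_zero _) hu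

/-- The bihomogeneous elements of `A[z]`. -/
def bihomogeneousElements (k : Type u) [Field k] (σ : Type v) :
    Set (MvPolynomial (Option σ) k) :=
  {p | ∃ d, p ∈ weightedHomogeneousSubmodule k bidegree d}

lemma mem_bihomogeneousElements {p : MvPolynomial (Option σ) k} :
    p ∈ bihomogeneousElements k σ ↔
      ∃ d l : ℕ, ∃ a ∈ zhom k σ d, p = incl k σ a * X none ^ l := by
  constructor
  · rintro ⟨⟨d, l⟩, h⟩
    exact ⟨d, l, mem_weightedHomogeneousSubmodule_bidegree.1 h⟩
  · rintro ⟨d, l, h⟩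
    exact ⟨(d, l), mem_weightedHomogeneousSubmodule_bidegree.2 h⟩

lemma isHomogeneousIdeal_of_eq_span_bihomogeneous {J : Ideal (MvPolynomial (Option σ) k)}
    (hJ : J = Ideal.span {p | p ∈ J ∧ p ∈ bihomogeneousElements k σ}) : IsHomogeneousIdeal J := by
  refine isHomogeneousIdeal_iff.2 (le_antisymm ?_ (Ideal.span_le.2 fun p hp => hp.1))
  conv_lhs => rw [hJ]
  refine Ideal.span_mono fun p hp => ⟨hp.1, ?_⟩
  obtain ⟨d, l, a, ha, rfl⟩ := mem_bihomogeneousElements.1 hp.2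
  refine ⟨d + l, mem_zhom_natCast.1 (incl_mul_pow_mem_zhom l ?_)⟩
  push_cast
  rwa [add_sub_cancel_right]

lemma isZGraded_of_eq_span_bihomogeneous {J : Ideal (MvPolynomial (Option σ) k)}
    (hJ : J = Ideal.span {p | p ∈ J ∧ p ∈ bihomogeneousElements k σ}) : IsZGraded J := by
  intro p hp
  rw [hJ] at hp
  refine Submodule.span_induction (fun q hq l => ?_) (fun l => ?_)
    (fun q r _ _ hq hr l => ?_) (fun r q _ hq l => ?_) hp
  · obtain ⟨hq, hq'⟩ := hq
    obtain ⟨d, m, a, ha, rfl⟩ := mem_bihomogeneousElements.1 hq'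
    rw [zCoeff_incl_mul_pow]
    split_ifs with h
    · rwa [h]
    · rw [map_zero, zero_mul]
      exact J.zero_mem
  · rw [map_zero, map_zero, zero_mul]
    exact J.zero_mem
  · rw [map_add, map_add, add_mul]
    exact J.add_mem (hq l) (hr l)
  · rw [smul_eq_mul, zCoeff_mul, map_sum, Finset.sum_mul]
    refine J.sum_mem fun x hx => ?_
    rw [← Finset.HasAntidiagonal.mem_antidiagonal.1 hx, map_mul, pow_add, mul_mul_mul_comm]
    exact J.mul_mem_left _ (hq _)

lemma eq_span_bihomogeneous_ofSlices {𝒥 : ℕ → Ideal (MvPolynomial σ k)} (h𝒥 : Monotone 𝒥)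
    (h : ∀ l, IsHomogeneousIdeal (𝒥 l)) : ofSlices 𝒥 h𝒥 =
      Ideal.span {p | p ∈ ofSlices 𝒥 h𝒥 ∧ p ∈ bihomogeneousElements k σ} := by
  refine le_antisymm (fun p hp => ?_) (Ideal.span_le.2 fun p hp => hp.1)
  obtain ⟨N, hN⟩ := exists_sum_zCoeff p
  rw [hN]
  refine Ideal.sum_mem _ fun l _ => ?_
  rw [← sum_zcomp (zCoeff l p), map_sum, Finset.sum_mul]
  refine Ideal.sum_mem _ fun d _ => Ideal.subset_span ⟨?_, ?_⟩
  · rw [← mem_slicesOf, slicesOf_ofSlices]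
    exact h l _ (hp l) _
  · exact mem_bihomogeneousElements.2 ⟨d, l, _, zcomp_mem _ _, rfl⟩

lemma isHomogeneousIdeal_slicesOf {J : Ideal (MvPolynomial (Option σ) k)}
    (hJ : IsHomogeneousIdeal J) (l : ℕ) : IsHomogeneousIdeal (slicesOf J l) := by
  intro a ha n
  have := hJ _ ha (n + l)
  rwa [zcomp_incl_mul_pow, add_sub_cancel_right] at this

end Bigraded

/-! ### Families of slices of `z`-stable ideals -/

section StableFamily

variable {k : Type u} [Field k] {σ : Type v}

/-- The sequences `J_⟨0⟩ ⊆ J_⟨1⟩ ⊆ …` that belong to the `z`-stable ideals `J` of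
`S = R[z] / (z^t)`, where `R = A / 𝔞`, expressed by ideals of `A`. -/
structure IsStableFamily (𝔞 : Ideal (MvPolynomial σ k)) (t : ℕ∞)
    (𝒥 : ℕ → Ideal (MvPolynomial σ k)) : Prop where
  isIdealOver : ∀ l, IsIdealOver 𝔞 (𝒥 l)
  monotone : Monotone 𝒥
  eq_top : ∀ l : ℕ, t ≤ l → 𝒥 l = ⊤
  X_mul_mem : ∀ l : ℕ, ((l + 1 : ℕ) : ℕ∞) < t → ∀ a, ∀ p ∈ 𝒥 (l + 1), X a * p ∈ 𝒥 l

variable {𝔞 : Ideal (MvPolynomial σ k)} {t : ℕ∞}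

lemma zPow_eq_zero_or : zPow k σ t = 0 ∨ ∃ m : ℕ, t = m ∧ zPow k σ t = X none ^ m := by
  cases t with
  | top => exact Or.inl rfl
  | coe m => exact Or.inr ⟨m, rfl, rfl⟩

lemma incl_mem_extIdeal {a : MvPolynomial σ k} (ha : a ∈ 𝔞) : incl k σ a ∈ extIdeal 𝔞 t :=
  Ideal.mem_sup_left (Ideal.mem_map_of_mem _ ha)

lemma pow_mem_extIdeal {l : ℕ} (hl : t ≤ l) : X none ^ l ∈ extIdeal 𝔞 t := by
  cases t with
  | top => exact absurd hl (by simp)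
  | coe m =>
    refine Ideal.mem_sup_right (Ideal.mem_span_singleton.2 (pow_dvd_pow _ ?_))
    exact_mod_cast hl

lemma IsStableFamily.extIdeal_le {𝒥 : ℕ → Ideal (MvPolynomial σ k)}
    (h : IsStableFamily 𝔞 t 𝒥) : extIdeal 𝔞 t ≤ ofSlices 𝒥 h.monotone := by
  refine sup_le (Ideal.map_le_iff_le_comap.2 fun a ha => ?_)
    ((Ideal.span_singleton_le_iff_mem _).2 ?_)
  · intro l
    have := zCoeff_incl_mul_pow l 0 a
    rw [pow_zero, mul_one] at this
    change zCoeff l (incl k σ a) ∈ _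
    rw [this]
    split_ifs
    · exact (h.isIdealOver l).le ha
    · exact (𝒥 l).zero_mem
  · rcases zPow_eq_zero_or (k := k) (σ := σ) (t := t) with h0 | ⟨m, hm, h0⟩
    · rw [h0]
      exact Ideal.zero_mem _
    · intro l
      have := zCoeff_incl_mul_pow l m (1 : MvPolynomial σ k)
      rw [map_one, one_mul] at this
      rw [h0, this]
      split_ifs with hl
      · rw [h.eq_top l (by rw [hl, hm])]
        trivial
      · exact (𝒥 l).zero_mem

lemma extIdeal_le_span (h𝔞 : IsHomogeneousIdeal 𝔞) : extIdeal 𝔞 t ≤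
    Ideal.span {p | p ∈ extIdeal 𝔞 t ∧ p ∈ bihomogeneousElements k σ} := by
  refine sup_le (Ideal.map_le_iff_le_comap.2 fun a ha => ?_)
    ((Ideal.span_singleton_le_iff_mem _).2 ?_)
  · rw [Ideal.mem_comap, ← sum_zcomp a, map_sum]
    refine Ideal.sum_mem _ fun d _ => Ideal.subset_span
      ⟨incl_mem_extIdeal (h𝔞 a ha d), mem_bihomogeneousElements.2
        ⟨d, 0, zcomp k σ d a, zcomp_mem _ _, ?_⟩⟩
    rw [pow_zero, mul_one]
    rfl
  · rcases zPow_eq_zero_or (k := k) (σ := σ) (t := t) with h0 | ⟨m, hm, h0⟩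
    · rw [h0]
      exact Ideal.zero_mem _
    · refine Ideal.subset_span ⟨Ideal.mem_sup_right (Ideal.mem_span_singleton_self _),
        mem_bihomogeneousElements.2 ⟨0, m, 1, ?_, ?_⟩⟩
      · exact mem_zhom_natCast.2 (isHomogeneous_one σ k)
      · rw [h0, map_one, one_mul]

lemma isGradedIdeal_bipiece_iff (h𝔞 : IsHomogeneousIdeal 𝔞) (J : Ideal (ExtRing 𝔞 t)) :
    IsGradedIdeal (bipiece 𝔞 t) J ↔ J.comap (Ideal.Quotient.mk (extIdeal 𝔞 t)) =
      Ideal.span {p | p ∈ J.comap (Ideal.Quotient.mk (extIdeal 𝔞 t)) ∧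
        p ∈ bihomogeneousElements k σ} := by
  refine Iff.trans ?_ (eq_span_inter_iff_comap _ (extIdeal_le_span h𝔞) J)
  have : {x | x ∈ J ∧ ∃ d, x ∈ bipiece 𝔞 t d} =
      {x | x ∈ J ∧ x ∈ Ideal.Quotient.mk (extIdeal 𝔞 t) '' bihomogeneousElements k σ} := by
    ext x
    constructor
    · rintro ⟨hx, d, p, hp, rfl⟩
      exact ⟨hx, p, ⟨d, hp⟩, rfl⟩
    · rintro ⟨hx, p, ⟨d, hp⟩, rfl⟩
      exact ⟨hx, d, p, hp, rfl⟩
  rw [← this]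
  rfl

lemma comap_slice (J : Ideal (ExtRing 𝔞 t)) (l : ℕ) :
    (slice J l).comap (Ideal.Quotient.mk 𝔞) =
      slicesOf (J.comap (Ideal.Quotient.mk (extIdeal 𝔞 t))) l := by
  ext a
  rw [mem_slicesOf, Ideal.mem_comap, slice, Ideal.mem_comap, Submodule.mem_colon_singleton,
    Ideal.mem_comap, map_mul, map_pow]
  rfl

lemma maxIdeal_mul_le_iff {I I' : Ideal (BaseRing 𝔞)} : maxIdeal 𝔞 * I ≤ I' ↔
    ∀ a, ∀ p ∈ I.comap (Ideal.Quotient.mk 𝔞), X a * p ∈ I'.comap (Ideal.Quotient.mk 𝔞) := by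
  constructor
  · intro h a p hp
    rw [Ideal.mem_comap, map_mul]
    exact h (Ideal.mul_mem_mul (Ideal.subset_span ⟨a, rfl⟩) hp)
  · intro h
    refine Ideal.mul_le.2 fun r hr x hx => ?_
    obtain ⟨p, rfl⟩ := Ideal.Quotient.mk_surjective x
    induction hr using Submodule.span_induction with
    | mem r hr =>
      obtain ⟨a, rfl⟩ := hr
      have := h a p hx
      rwa [Ideal.mem_comap, map_mul] at this
    | zero =>
      rw [zero_mul]
      exact I'.zero_mem
    | add r s _ _ hr hs =>
      rw [add_mul]
      exact I'.add_mem hr hs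
    | smul c r _ hr =>
      rw [smul_eq_mul, mul_assoc]
      exact I'.mul_mem_left _ hr

/-- The slices of a `z`-stable ideal. -/
lemma IsZStable.isStableFamily (h𝔞 : IsHomogeneousIdeal 𝔞) {J : Ideal (ExtRing 𝔞 t)}
    (hJ : IsZStable J) : IsStableFamily 𝔞 t
      (slicesOf (J.comap (Ideal.Quotient.mk (extIdeal 𝔞 t)))) where
  isIdealOver l := ⟨isHomogeneousIdeal_slicesOf (isHomogeneousIdeal_of_eq_span_bihomogeneous
    ((isGradedIdeal_bipiece_iff h𝔞 J).1 hJ.1)) l, fun a ha =>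
      Ideal.mul_mem_right _ _ (le_comap_mk _ J (incl_mem_extIdeal ha))⟩
  monotone := monotone_slicesOf _
  eq_top l hl := (Ideal.eq_top_iff_one _).2 (by
    rw [mem_slicesOf, map_one, one_mul]
    exact le_comap_mk _ J (pow_mem_extIdeal hl))
  X_mul_mem l hl := by
    rw [← comap_slice, ← comap_slice]
    exact maxIdeal_mul_le_iff.1 (hJ.2 l hl)

lemma IsZStable.comap_eq (h𝔞 : IsHomogeneousIdeal 𝔞) {J : Ideal (ExtRing 𝔞 t)}
    (hJ : IsZStable J) : J.comap (Ideal.Quotient.mk (extIdeal 𝔞 t)) =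
      ofSlices _ (hJ.isStableFamily h𝔞).monotone :=
  (isZGraded_of_eq_span_bihomogeneous
    ((isGradedIdeal_bipiece_iff h𝔞 J).1 hJ.1)).ofSlices_slicesOf.symm

lemma IsZStable.mem_idealPoset (h𝔞 : IsHomogeneousIdeal 𝔞) {J : Ideal (ExtRing 𝔞 t)}
    (hJ : IsZStable J) : J ∈ idealPoset k (Option σ) (ExtRing 𝔞 t) := by
  have hext : IsHomogeneousIdeal (extIdeal 𝔞 t) := isHomogeneousIdeal_of_eq_span_bihomogeneous
    (le_antisymm (extIdeal_le_span h𝔞) (Ideal.span_le.2 fun p hp => hp.1))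
  exact (mem_idealPoset_iff hext J).2 (isHomogeneousIdeal_of_eq_span_bihomogeneous
    ((isGradedIdeal_bipiece_iff h𝔞 J).1 hJ.1))

namespace IsStableFamily

variable {𝒥 : ℕ → Ideal (MvPolynomial σ k)} (h : IsStableFamily 𝔞 t 𝒥)

/-- The ideal `⨁ 𝒥_l z^l` of `S`. -/
def toIdeal : Ideal (ExtRing 𝔞 t) :=
  (ofSlices 𝒥 h.monotone).map (Ideal.Quotient.mk (extIdeal 𝔞 t))

lemma comap_toIdeal : h.toIdeal.comap (Ideal.Quotient.mk (extIdeal 𝔞 t)) =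
    ofSlices 𝒥 h.monotone := by
  rw [toIdeal, Ideal.comap_map_of_surjective _ Ideal.Quotient.mk_surjective,
    ← RingHom.ker_eq_comap_bot, Ideal.mk_ker, sup_eq_left]
  exact h.extIdeal_le

lemma comap_slice_toIdeal (l : ℕ) :
    (slice h.toIdeal l).comap (Ideal.Quotient.mk 𝔞) = 𝒥 l := by
  rw [comap_slice, comap_toIdeal, slicesOf_ofSlices]

lemma isZStable_toIdeal (h𝔞 : IsHomogeneousIdeal 𝔞) : IsZStable h.toIdeal := by
  refine ⟨(isGradedIdeal_bipiece_iff h𝔞 _).2 ?_, fun l hl => maxIdeal_mul_le_iff.2 ?_⟩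
  · rw [comap_toIdeal]
    exact eq_span_bihomogeneous_ofSlices _ fun l => (h.isIdealOver l).isHomogeneous
  · rw [comap_slice_toIdeal, comap_slice_toIdeal]
    exact h.X_mul_mem l hl

end IsStableFamily

/-- The family that agrees with `𝒥` below `i` and is trivial from `i` on. -/
def truncate (𝒥 : ℕ → Ideal (MvPolynomial σ k)) (i l : ℕ) : Ideal (MvPolynomial σ k) :=
  if l < i then 𝒥 l else ⊤

lemma monotone_truncate {𝒥 : ℕ → Ideal (MvPolynomial σ k)} (h𝒥 : Monotone 𝒥) (i : ℕ) :
    Monotone (truncate 𝒥 i) := by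
  intro l m hlm
  by_cases hm : m < i
  · rw [truncate, truncate, if_pos hm, if_pos (by omega)]
    exact h𝒥 hlm
  · rw [truncate, truncate, if_neg hm]
    exact le_top

/-- Adding `z^i` to an ideal of `S` amounts to truncating its family of slices. -/
lemma comap_sup_span {J : Ideal (ExtRing 𝔞 t)} {𝒥 : ℕ → Ideal (MvPolynomial σ k)}
    (h𝒥 : Monotone 𝒥) (hJ : J.comap (Ideal.Quotient.mk (extIdeal 𝔞 t)) = ofSlices 𝒥 h𝒥) (i : ℕ) :
    (J ⊔ Ideal.span {zElt 𝔞 t ^ i}).comap (Ideal.Quotient.mk (extIdeal 𝔞 t)) =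
      ofSlices (truncate 𝒥 i) (monotone_truncate h𝒥 i) := by
  have h1 : J ⊔ Ideal.span {zElt 𝔞 t ^ i} =
      (ofSlices 𝒥 h𝒥 ⊔ Ideal.span {X none ^ i}).map (Ideal.Quotient.mk (extIdeal 𝔞 t)) := by
    rw [Ideal.map_sup, ← hJ, Ideal.map_comap_of_surjective _ Ideal.Quotient.mk_surjective,
      Ideal.map_span, Set.image_singleton, map_pow]
    rfl
  have h2 : ofSlices 𝒥 h𝒥 ⊔ Ideal.span {X none ^ i} =
      ofSlices (truncate 𝒥 i) (monotone_truncate h𝒥 i) := by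
    refine le_antisymm (sup_le (ofSlices_mono fun l => ?_)
      ((Ideal.span_singleton_le_iff_mem _).2 fun l => ?_)) fun p hp => ?_
    · rw [truncate]
      split_ifs
      · exact le_rfl
      · exact le_top
    · have := zCoeff_incl_mul_pow l i (1 : MvPolynomial σ k)
      rw [map_one, one_mul] at this
      rw [this]
      split_ifs with hl
      · rw [truncate, if_neg (by omega)]
        trivial
      · exact Ideal.zero_mem _
    · obtain ⟨N, hN⟩ := exists_sum_zCoeff p
      rw [hN]
      refine Ideal.sum_mem _ fun l _ => ?_
      by_cases hl : l < i
      · refine Ideal.mem_sup_left ?_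
        have := hp l
        rw [truncate, if_pos hl] at this
        rwa [← mem_slicesOf, slicesOf_ofSlices]
      · exact Ideal.mem_sup_right (Ideal.mul_mem_left _ _
          (Ideal.mem_span_singleton.2 (pow_dvd_pow _ (by omega))))
  rw [h1, Ideal.comap_map_of_surjective _ Ideal.Quotient.mk_surjective,
    ← RingHom.ker_eq_comap_bot, Ideal.mk_ker, h2, sup_eq_left, ← h2, ← hJ]
  exact (le_comap_mk _ J).trans le_sup_left

end StableFamily

/-! ### The family induced by an embedding of Hilbert functions -/

section Induced

variable {k : Type u} [Field k] {σ : Type v}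

/-- The number of the slices `J_⟨l⟩`, `l < t`, that contribute to the degree `D` of an ideal. -/
def sliceCount (t : ℕ∞) (D : ℕ) : ℕ := (min t (D + 1 : ℕ)).toNat

lemma lt_sliceCount {t : ℕ∞} {D l : ℕ} : l < sliceCount t D ↔ (l : ℕ∞) < t ∧ l ≤ D := by
  cases t with
  | top =>
    rw [sliceCount, min_eq_right le_top, ENat.toNat_natCast, Nat.lt_succ_iff]
    simp
  | coe m =>
    rw [sliceCount, ← (Nat.mono_cast (α := ℕ∞)).map_min, ENat.toNat_natCast]
    norm_cast
    omega

/-- The total dimension of the first `i` slices in the degree `D`. -/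
def familyDim (𝒥 : ℕ → Ideal (MvPolynomial σ k)) (D i : ℕ) : ℕ :=
  ∑ l ∈ Finset.range i, idealDim (𝒥 l) ((D : ℤ) - l)

/-- The dimensions of the slices in the degree `D`. -/
def dimSeq (𝒥 : ℕ → Ideal (MvPolynomial σ k)) (D l : ℕ) : ℤ := idealDim (𝒥 l) ((D : ℤ) - l)

lemma headSum_dimSeq (𝒥 : ℕ → Ideal (MvPolynomial σ k)) (D i : ℕ) :
    headSum (dimSeq 𝒥 D) i = familyDim 𝒥 D i := by
  rw [headSum, familyDim]
  push_cast
  rfl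

/-- The relation between the dimensions of the slices `l + 1` and `l` in the degree `D`. -/
def SliceRel (𝔞 : Ideal (MvPolynomial σ k))
    (ε : Ideal (MvPolynomial σ k) → Ideal (MvPolynomial σ k)) (D l : ℕ) (r s : ℤ) : Prop :=
  FlagRel 𝔞 ε ((D : ℤ) - l - 1) r s

lemma sliceRel_mono (𝔞 : Ideal (MvPolynomial σ k))
    (ε : Ideal (MvPolynomial σ k) → Ideal (MvPolynomial σ k)) (D l : ℕ) (r s r' s' : ℤ)
    (h : SliceRel 𝔞 ε D l r s) (hr : r' ≤ r) (hs : s ≤ s') : SliceRel 𝔞 ε D l r' s' :=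
  FlagRel.mono h hr hs

lemma sliceRel_succ (𝔞 : Ideal (MvPolynomial σ k))
    (ε : Ideal (MvPolynomial σ k) → Ideal (MvPolynomial σ k)) (D l : ℕ) :
    SliceRel 𝔞 ε (D + 1) (l + 1) = SliceRel 𝔞 ε D l := by
  funext r s
  rw [SliceRel, SliceRel]
  congr 1
  push_cast
  omega

/-- The least possible dimension of the `l`-th slice in the degree `D`. -/
def sliceMin (𝔞 : Ideal (MvPolynomial σ k)) (D l : ℕ) : ℤ := idealDim 𝔞 ((D : ℤ) - l)

/-- The largest possible dimension of the `l`-th slice in the degree `D`. -/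
def sliceMax (k : Type u) [Field k] (σ : Type v) (D l : ℕ) : ℤ :=
  Module.finrank k (zhom k σ ((D : ℤ) - l))

variable {𝔞 : Ideal (MvPolynomial σ k)} {t : ℕ∞}
  {ε : Ideal (MvPolynomial σ k) → Ideal (MvPolynomial σ k)}
  {𝒥 𝒥' : ℕ → Ideal (MvPolynomial σ k)}

/-- The slices of degree `D` of a sequence of dimensions are optimal. -/
abbrev IsOptimalInDegree (𝔞 : Ideal (MvPolynomial σ k)) (t : ℕ∞)
    (ε : Ideal (MvPolynomial σ k) → Ideal (MvPolynomial σ k)) (D : ℕ) (b : ℕ → ℤ) : Prop :=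
  IsOptimalSeq (sliceMin 𝔞 D) (sliceMax k σ D) (SliceRel 𝔞 ε D) (sliceCount t D) b

/-- In each total degree the dimensions of the slices of a `z`-stable ideal form a stable
sequence. -/
lemma IsStableFamily.isStableSeq [Finite σ] (h : IsStableFamily 𝔞 t 𝒥) (hε : IsHilbertLift 𝔞 ε)
    (h𝔞 : IsHomogeneousIdeal 𝔞) (D : ℕ) :
    IsStableSeq (sliceMin 𝔞 D) (sliceMax k σ D) (SliceRel 𝔞 ε D) (sliceCount t D)
      (dimSeq 𝒥 D) := by
  refine ⟨fun l hl => ⟨?_, ?_⟩, fun l hl => ?_⟩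
  · exact Int.ofNat_le.2 (idealDim_mono (h.isIdealOver l).le _)
  · exact Int.ofNat_le.2 (idealDim_le_finrank _ _)
  · have := hε.flagRel h𝔞 (h.isIdealOver (l + 1)) (h.isIdealOver l)
      (h.X_mul_mem l (lt_sliceCount.1 hl).1) ((D : ℤ) - l - 1)
    rw [sub_add_cancel] at this
    rw [SliceRel, dimSeq, dimSeq, show (D : ℤ) - (l + 1 : ℕ) = D - l - 1 by push_cast; ring]
    exact this

open Classical in
/-- The optimal sequence for the degree `D`, with the same total as the dimensions of the slices
of `𝒥`. -/
def optSeq (𝔞 : Ideal (MvPolynomial σ k)) (t : ℕ∞)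
    (ε : Ideal (MvPolynomial σ k) → Ideal (MvPolynomial σ k))
    (𝒥 : ℕ → Ideal (MvPolynomial σ k)) (D : ℕ) : ℕ → ℤ :=
  if h : ∃ b, IsOptimalInDegree 𝔞 t ε D b ∧
    headSum b (sliceCount t D) = headSum (dimSeq 𝒥 D) (sliceCount t D) then h.choose else 0

section

variable [Finite σ] (h : IsStableFamily 𝔞 t 𝒥) (hε : IsHilbertLift 𝔞 ε) (h𝔞 : IsHomogeneousIdeal 𝔞)
include h hε h𝔞

lemma optSeq_spec (D : ℕ) : IsOptimalInDegree 𝔞 t ε D (optSeq 𝔞 t ε 𝒥 D) ∧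
    headSum (optSeq 𝔞 t ε 𝒥 D) (sliceCount t D) = headSum (dimSeq 𝒥 D) (sliceCount t D) := by
  have hex := exists_isOptimalSeq (sliceRel_mono 𝔞 ε D) (h.isStableSeq hε h𝔞 D)
  rw [optSeq, dif_pos hex]
  exact hex.choose_spec

lemma headSum_optSeq_le {D i : ℕ} (hi : i ≤ sliceCount t D) :
    headSum (optSeq 𝔞 t ε 𝒥 D) i ≤ headSum (dimSeq 𝒥 D) i :=
  (optSeq_spec h hε h𝔞 D).1.2 _ (h.isStableSeq hε h𝔞 D) (optSeq_spec h hε h𝔞 D).2.symm i hi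

lemma le_optSeq {D l : ℕ} (hl : l < sliceCount t D) :
    (idealDim 𝔞 ((D : ℤ) - l) : ℤ) ≤ optSeq 𝔞 t ε 𝒥 D l :=
  ((optSeq_spec h hε h𝔞 D).1.1.1 l hl).1

lemma optSeq_le {D l : ℕ} (hl : l < sliceCount t D) :
    optSeq 𝔞 t ε 𝒥 D l ≤ Module.finrank k (zhom k σ ((D : ℤ) - l)) :=
  ((optSeq_spec h hε h𝔞 D).1.1.1 l hl).2

lemma optSeq_mono (h' : IsStableFamily 𝔞 t 𝒥') {D : ℕ}
    (hle : headSum (dimSeq 𝒥 D) (sliceCount t D) ≤ headSum (dimSeq 𝒥' D) (sliceCount t D))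
    {l : ℕ} (hl : l < sliceCount t D) : optSeq 𝔞 t ε 𝒥 D l ≤ optSeq 𝔞 t ε 𝒥' D l := by
  refine (optSeq_spec h hε h𝔞 D).1.mono (sliceRel_mono 𝔞 ε D)
    (optSeq_spec h' hε h𝔞 D).1 ?_ hl
  rw [(optSeq_spec h hε h𝔞 D).2, (optSeq_spec h' hε h𝔞 D).2]
  exact hle

/-- The optimal sequences for consecutive total degrees. The first statement makes the first slice
of the induced family closed under multiplication by variables, and the second one makes the slices
increase. -/
lemma optSeq_shift (ht : 1 ≤ t) (D : ℕ) :
    FlagRel 𝔞 ε D (optSeq 𝔞 t ε 𝒥 D 0) (optSeq 𝔞 t ε 𝒥 (D + 1) 0) ∧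
      ∀ l, l + 1 < sliceCount t (D + 1) →
        optSeq 𝔞 t ε 𝒥 D l ≤ optSeq 𝔞 t ε 𝒥 (D + 1) (l + 1) := by
  have ht' : ((0 : ℕ) : ℕ∞) < t := lt_of_lt_of_le (by simp) ht
  have h0 : 0 < sliceCount t D := lt_sliceCount.2 ⟨ht', Nat.zero_le _⟩
  have h0' : 0 < sliceCount t (D + 1) := lt_sliceCount.2 ⟨ht', Nat.zero_le _⟩
  obtain ⟨m, hm⟩ := Nat.exists_eq_add_of_lt h0'
  rw [zero_add] at hm
  have hmn : m ≤ sliceCount t D := by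
    by_contra hlt
    have h1 : sliceCount t D < sliceCount t (D + 1) := by omega
    have h2 := lt_sliceCount.1 h1
    have h3 : sliceCount t D + 1 < sliceCount t (D + 1) := by omega
    have h4 := lt_sliceCount.1 h3
    exact lt_irrefl _ (lt_sliceCount.2 ⟨h2.1, by omega⟩ : sliceCount t D < sliceCount t D)
  have hopt' := (optSeq_spec h hε h𝔞 (D + 1)).1
  have htot' := (optSeq_spec h hε h𝔞 (D + 1)).2
  rw [IsOptimalInDegree, hm] at hopt'
  rw [hm] at htot' ⊢
  have hcast : ((D + 1 : ℕ) : ℤ) - (0 : ℕ) = D + 1 := by push_cast; ring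
  have hcast' : ∀ l : ℕ, ((D + 1 : ℕ) : ℤ) - (l + 1 : ℕ) = D - l := fun l => by push_cast; ring
  have hrel0 : SliceRel 𝔞 ε (D + 1) 0 = FlagRel 𝔞 ε D := by
    funext r s
    rw [SliceRel]
    congr 1
    push_cast
    ring
  have hfirst : optSeq 𝔞 t ε 𝒥 D 0 ≤ idealDim (𝒥 0) D := by
    have := headSum_optSeq_le h hε h𝔞 (Nat.succ_le_of_lt h0)
    rw [headSum_succ, headSum_succ, headSum_zero, headSum_zero, zero_add, zero_add, dimSeq,
      Nat.cast_zero, sub_zero] at this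
    exact this
  -- the value `s` needed for the bound on the total is the dimension of `𝒥 0` in degree `D + 1`
  have := (optSeq_spec h hε h𝔞 D).1.shift_le (lo' := sliceMin 𝔞 (D + 1))
    (hi' := sliceMax k σ (D + 1)) (Q' := SliceRel 𝔞 ε (D + 1))
    (sliceRel_mono 𝔞 ε D) (sliceRel_mono 𝔞 ε (D + 1))
    (fun l => by rw [sliceMin, sliceMin, hcast']) (fun l => by rw [sliceMax, sliceMax, hcast'])
    (fun l => sliceRel_succ 𝔞 ε D l) hmn hopt' (s := dimSeq 𝒥 (D + 1) 0)
    (by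
      rw [hrel0, dimSeq, hcast]
      exact (hε.flagRel h𝔞 (h.isIdealOver 0) (h.isIdealOver 0)
        (fun a p hp => (𝒥 0).mul_mem_left _ hp) D).mono hfirst le_rfl)
    (Int.ofNat_le.2 (idealDim_mono (h.isIdealOver 0).le _))
    (Int.ofNat_le.2 (idealDim_le_finrank _ _))
    (by
      rw [htot', headSum_succ', add_comm]
      refine Int.add_le_add_right ((headSum_optSeq_le h hε h𝔞 hmn).trans
        (headSum_mono fun l _ => ?_)) _
      rw [dimSeq, dimSeq, hcast']
      exact Int.ofNat_le.2 (idealDim_mono (h.monotone l.le_succ) _))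
  rw [hrel0] at this
  exact ⟨this.1, fun l hl => this.2 l (by omega)⟩

end

/-- The pieces of the `l`-th slice of the induced family: in degree `m` it is the member of the flag
whose dimension is prescribed by the optimal sequence for the degree `m + l`. -/
def inducedPiece (𝔞 : Ideal (MvPolynomial σ k)) (t : ℕ∞)
    (ε : Ideal (MvPolynomial σ k) → Ideal (MvPolynomial σ k))
    (𝒥 : ℕ → Ideal (MvPolynomial σ k)) (l : ℕ) (m : ℤ) : Submodule k (MvPolynomial σ k) :=
  flag 𝔞 ε m (optSeq 𝔞 t ε 𝒥 (m + l).toNat l)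

lemma inducedPiece_natCast (l m : ℕ) :
    inducedPiece 𝔞 t ε 𝒥 l m = flag 𝔞 ε m (optSeq 𝔞 t ε 𝒥 (m + l) l) := by
  rw [inducedPiece]
  congr 2

lemma inducedPiece_le (l : ℕ) (m : ℤ) : inducedPiece 𝔞 t ε 𝒥 l m ≤ zhom k σ m :=
  flag_le_zhom _ _

lemma eq_zero_of_mem_inducedPiece {l : ℕ} {m : ℤ} (hm : m < 0) {p : MvPolynomial σ k}
    (hp : p ∈ inducedPiece 𝔞 t ε 𝒥 l m) : p = 0 := by
  have := inducedPiece_le l m hp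
  rwa [zhom_of_neg hm] at this

section

variable [Finite σ] (h : IsStableFamily 𝔞 t 𝒥) (hε : IsHilbertLift 𝔞 ε) (h𝔞 : IsHomogeneousIdeal 𝔞)
include h hε h𝔞

lemma inducedPiece_mono {l : ℕ} (ht : ((l + 1 : ℕ) : ℕ∞) < t) (m : ℤ) :
    inducedPiece 𝔞 t ε 𝒥 l m ≤ inducedPiece 𝔞 t ε 𝒥 (l + 1) m := by
  rcases lt_or_ge m 0 with hm | hm
  · intro p hp
    rw [eq_zero_of_mem_inducedPiece hm hp]
    exact Submodule.zero_mem _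
  · lift m to ℕ using hm
    rw [inducedPiece_natCast, inducedPiece_natCast]
    exact flag_mono ((optSeq_shift h hε h𝔞 (le_trans (by norm_cast; omega) ht.le) (m + l)).2 l
      (lt_sliceCount.2 ⟨ht, by omega⟩))

/-- The relation of `z`-stability for the induced family. -/
lemma X_mul_mem_inducedPiece_of_succ {l : ℕ} (ht : ((l + 1 : ℕ) : ℕ∞) < t) (m : ℤ) (a : σ)
    {p : MvPolynomial σ k} (hp : p ∈ inducedPiece 𝔞 t ε 𝒥 (l + 1) m) :
    X a * p ∈ inducedPiece 𝔞 t ε 𝒥 l (m + 1) := by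
  rcases lt_or_ge m 0 with hm | hm
  · rw [eq_zero_of_mem_inducedPiece hm hp, mul_zero]
    exact Submodule.zero_mem _
  · lift m to ℕ using hm
    rw [inducedPiece_natCast] at hp
    have h1 := (optSeq_spec h hε h𝔞 (m + (l + 1))).1.1.2 l (lt_sliceCount.2 ⟨ht, by omega⟩)
    rw [SliceRel, show ((m + (l + 1) : ℕ) : ℤ) - l - 1 = m by push_cast; ring] at h1
    have h2 := h1 a p hp
    rw [show (m : ℤ) + 1 = (m + 1 : ℕ) by push_cast; rfl] at h2 ⊢
    rwa [inducedPiece_natCast, add_assoc, add_comm 1 l]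

lemma X_mul_mem_inducedPiece {l : ℕ} (ht : (l : ℕ∞) < t) (m : ℤ) (a : σ)
    {p : MvPolynomial σ k} (hp : p ∈ inducedPiece 𝔞 t ε 𝒥 l m) :
    X a * p ∈ inducedPiece 𝔞 t ε 𝒥 l (m + 1) := by
  -- for positive `l` pass through the preceding slice, as `𝔪 L_l ⊆ L_{l-1} ⊆ L_l`
  cases l with
  | succ l =>
    exact inducedPiece_mono h hε h𝔞 ht _ (X_mul_mem_inducedPiece_of_succ h hε h𝔞 ht m a hp)
  | zero =>
    rcases lt_or_ge m 0 with hm | hm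
    · rw [eq_zero_of_mem_inducedPiece hm hp, mul_zero]
      exact Submodule.zero_mem _
    · lift m to ℕ using hm
      rw [inducedPiece_natCast] at hp
      have h2 := (optSeq_shift h hε h𝔞 (Order.one_le_iff_pos.2 ht) m).1 a p hp
      rw [show (m : ℤ) + 1 = (m + 1 : ℕ) by push_cast; rfl] at h2 ⊢
      rwa [inducedPiece_natCast]

end

open Classical in
/-- The slices of the ideal that the induced embedding assigns to the Hilbert function of the
ideal with the slices `𝒥`. -/
def inducedFamily (𝔞 : Ideal (MvPolynomial σ k)) (t : ℕ∞)
    (ε : Ideal (MvPolynomial σ k) → Ideal (MvPolynomial σ k))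
    (𝒥 : ℕ → Ideal (MvPolynomial σ k)) (l : ℕ) : Ideal (MvPolynomial σ k) :=
  if hW : (l : ℕ∞) < t ∧
      ∀ m a, ∀ p ∈ inducedPiece 𝔞 t ε 𝒥 l m, X a * p ∈ inducedPiece 𝔞 t ε 𝒥 l (m + 1)
  then idealOfPieces _ hW.2 else ⊤

lemma inducedFamily_eq_top {l : ℕ} (hl : t ≤ l) : inducedFamily 𝔞 t ε 𝒥 l = ⊤ :=
  dif_neg fun h => h.1.not_ge hl

section

variable [Finite σ] (h : IsStableFamily 𝔞 t 𝒥) (hε : IsHilbertLift 𝔞 ε) (h𝔞 : IsHomogeneousIdeal 𝔞)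
include h hε h𝔞

lemma inducedFamily_of_lt {l : ℕ} (hl : (l : ℕ∞) < t) : inducedFamily 𝔞 t ε 𝒥 l =
    idealOfPieces _ fun m a _ hp => X_mul_mem_inducedPiece h hε h𝔞 hl m a hp :=
  dif_pos ⟨hl, fun m a _ hp => X_mul_mem_inducedPiece h hε h𝔞 hl m a hp⟩

lemma isHomogeneousIdeal_inducedFamily (l : ℕ) :
    IsHomogeneousIdeal (inducedFamily 𝔞 t ε 𝒥 l) := by
  rcases lt_or_ge (l : ℕ∞) t with hl | hl
  · rw [inducedFamily_of_lt h hε h𝔞 hl]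
    exact isHomogeneousIdeal_idealOfPieces _ _
  · rw [inducedFamily_eq_top hl]
    exact fun _ _ _ => trivial

lemma inducedFamily_inf_zhom {l : ℕ} (hl : (l : ℕ∞) < t) (m : ℤ) :
    (inducedFamily 𝔞 t ε 𝒥 l).restrictScalars k ⊓ zhom k σ m = inducedPiece 𝔞 t ε 𝒥 l m := by
  rw [inducedFamily_of_lt h hε h𝔞 hl]
  exact idealOfPieces_inf_zhom m (inducedPiece_le l m)

lemma mem_inducedFamily {l : ℕ} (hl : (l : ℕ∞) < t) {m : ℤ} {p : MvPolynomial σ k}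
    (hp : p ∈ zhom k σ m) : p ∈ inducedFamily 𝔞 t ε 𝒥 l ↔ p ∈ inducedPiece 𝔞 t ε 𝒥 l m := by
  rw [← inducedFamily_inf_zhom h hε h𝔞 hl]
  exact ⟨fun h => ⟨h, hp⟩, fun h => h.1⟩

lemma idealDim_inducedFamily {l : ℕ} (hl : (l : ℕ∞) < t) (m : ℕ) :
    (idealDim (inducedFamily 𝔞 t ε 𝒥 l) m : ℤ) = optSeq 𝔞 t ε 𝒥 (m + l) l := by
  have hlt : l < sliceCount t (m + l) := lt_sliceCount.2 ⟨hl, by omega⟩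
  have h1 := le_optSeq h hε h𝔞 hlt
  have h2 := optSeq_le h hε h𝔞 hlt
  rw [show ((m + l : ℕ) : ℤ) - l = m by push_cast; ring] at h1 h2
  rw [idealDim, inducedFamily_inf_zhom h hε h𝔞 hl, inducedPiece_natCast]
  exact hε.finrank_flag h𝔞 h1 h2

lemma isIdealOver_inducedFamily (l : ℕ) : IsIdealOver 𝔞 (inducedFamily 𝔞 t ε 𝒥 l) := by
  refine ⟨isHomogeneousIdeal_inducedFamily h hε h𝔞 l, ?_⟩
  rcases lt_or_ge (l : ℕ∞) t with hl | hl
  · refine h𝔞.le fun n p hp hpn => (mem_inducedFamily h hε h𝔞 hl hpn).2 ?_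
    rcases lt_or_ge n 0 with hn | hn
    · rw [zhom_of_neg hn] at hpn
      rw [(Submodule.mem_bot k).1 hpn]
      exact Submodule.zero_mem _
    · lift n to ℕ using hn
      rw [inducedPiece_natCast]
      have h1 := le_optSeq h hε h𝔞 (lt_sliceCount.2 ⟨hl, by omega⟩ : l < sliceCount t (n + l))
      rw [show ((n + l : ℕ) : ℤ) - l = n by push_cast; ring] at h1
      exact hε.le_flag h𝔞 h1 ⟨hp, hpn⟩
  · rw [inducedFamily_eq_top hl]
    exact le_top

lemma isStableFamily_inducedFamily : IsStableFamily 𝔞 t (inducedFamily 𝔞 t ε 𝒥) where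
  isIdealOver := isIdealOver_inducedFamily h hε h𝔞
  monotone := monotone_nat_of_le_succ fun l => by
    rcases lt_or_ge ((l + 1 : ℕ) : ℕ∞) t with hl | hl
    · have hl' : (l : ℕ∞) < t := lt_of_le_of_lt (by norm_cast; omega) hl
      refine (isHomogeneousIdeal_inducedFamily h hε h𝔞 l).le fun n p hp hpn => ?_
      rw [mem_inducedFamily h hε h𝔞 hl hpn]
      exact inducedPiece_mono h hε h𝔞 hl n ((mem_inducedFamily h hε h𝔞 hl' hpn).1 hp)
    · rw [inducedFamily_eq_top hl]
      exact le_top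
  eq_top _ hl := inducedFamily_eq_top hl
  X_mul_mem l hl a := by
    have hl' : (l : ℕ∞) < t := lt_of_le_of_lt (by norm_cast; omega) hl
    intro p hp
    rw [← sum_zcomp p, Finset.mul_sum]
    refine Ideal.sum_mem _ fun d _ => ?_
    have hd := zcomp_mem (k := k) (τ := σ) d p
    rw [mem_inducedFamily h hε h𝔞 hl' (X_mul_mem_zhom a hd)]
    exact X_mul_mem_inducedPiece_of_succ h hε h𝔞 hl _ _ ((mem_inducedFamily h hε h𝔞 hl hd).1
      (isHomogeneousIdeal_inducedFamily h hε h𝔞 (l + 1) p hp d))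

/-- The slices of the induced family are values of `ε`. -/
lemma map_inducedFamily {l : ℕ} (hl : (l : ℕ∞) < t) :
    ε (inducedFamily 𝔞 t ε 𝒥 l) = inducedFamily 𝔞 t ε 𝒥 l := by
  refine hε.eq_of_flag h𝔞 (isIdealOver_inducedFamily h hε h𝔞 l) fun n => ?_
  rcases lt_or_ge n 0 with hn | hn
  · have := flag_le_zhom (𝔞 := 𝔞) (ε := ε) n (idealDim (inducedFamily 𝔞 t ε 𝒥 l) n)
    rw [zhom_of_neg hn] at this ⊢
    rw [le_bot_iff.1 this, inf_bot_eq]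
  · lift n to ℕ using hn
    rw [inducedFamily_inf_zhom h hε h𝔞 hl, idealDim_inducedFamily h hε h𝔞 hl,
      inducedPiece_natCast]

lemma dimSeq_inducedFamily {D l : ℕ} (hl : l < sliceCount t D) :
    dimSeq (inducedFamily 𝔞 t ε 𝒥) D l = optSeq 𝔞 t ε 𝒥 D l := by
  obtain ⟨hl', hD⟩ := lt_sliceCount.1 hl
  obtain ⟨m, rfl⟩ := Nat.exists_eq_add_of_le' hD
  rw [dimSeq, show ((m + l : ℕ) : ℤ) - l = m by push_cast; ring]
  exact idealDim_inducedFamily h hε h𝔞 hl' m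

/-- The truncations of the induced family have the smallest dimensions. -/
lemma familyDim_inducedFamily_le {D i : ℕ} (hi : i ≤ sliceCount t D) :
    familyDim (inducedFamily 𝔞 t ε 𝒥) D i ≤ familyDim 𝒥 D i := by
  have h1 := headSum_optSeq_le h hε h𝔞 hi
  have h2 : headSum (dimSeq (inducedFamily 𝔞 t ε 𝒥) D) i = headSum (optSeq 𝔞 t ε 𝒥 D) i :=
    Finset.sum_congr rfl fun l hl =>
      dimSeq_inducedFamily h hε h𝔞 (lt_of_lt_of_le (Finset.mem_range.1 hl) hi)
  rw [← h2, headSum_dimSeq, headSum_dimSeq] at h1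
  exact_mod_cast h1

end

lemma sliceCount_le (t : ℕ∞) (D : ℕ) : sliceCount t D ≤ D + 1 := by
  by_contra h
  have := (lt_sliceCount.1 (not_le.1 h)).2
  omega

/-- In total degree `D`, the first `sliceCount t D` slices determine the dimension: the remaining
slices are the whole ring. -/
lemma familyDim_eq (h : IsStableFamily 𝔞 t 𝒥) (D : ℕ) : familyDim 𝒥 D (D + 1) =
    familyDim 𝒥 D (sliceCount t D) +
      ∑ l ∈ Finset.Ico (sliceCount t D) (D + 1), Module.finrank k (zhom k σ ((D : ℤ) - l)) := by
  rw [familyDim, familyDim, Finset.range_eq_Ico, Finset.range_eq_Ico,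
    ← Finset.sum_Ico_consecutive _ (Nat.zero_le _) (sliceCount_le t D)]
  congr 1
  refine Finset.sum_congr rfl fun l hl => ?_
  obtain ⟨h1, h2⟩ := Finset.mem_Ico.1 hl
  rw [h.eq_top l, idealDim_top]
  by_contra hlt
  exact absurd (lt_sliceCount.2 ⟨not_le.1 hlt, by omega⟩) h1.not_gt

lemma familyDim_inducedFamily [Finite σ] (h : IsStableFamily 𝔞 t 𝒥) (hε : IsHilbertLift 𝔞 ε)
    (h𝔞 : IsHomogeneousIdeal 𝔞) (D : ℕ) :
    familyDim (inducedFamily 𝔞 t ε 𝒥) D (D + 1) = familyDim 𝒥 D (D + 1) := by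
  rw [familyDim_eq h, familyDim_eq (isStableFamily_inducedFamily h hε h𝔞)]
  congr 1
  have h1 := (optSeq_spec h hε h𝔞 D).2
  have h2 : headSum (dimSeq (inducedFamily 𝔞 t ε 𝒥) D) (sliceCount t D) =
      headSum (optSeq 𝔞 t ε 𝒥 D) (sliceCount t D) :=
    Finset.sum_congr rfl fun l hl => dimSeq_inducedFamily h hε h𝔞 (Finset.mem_range.1 hl)
  rw [← h2, headSum_dimSeq, headSum_dimSeq] at h1
  exact_mod_cast h1

/-- The induced family depends on the Hilbert function only, in a monotone way. -/
lemma inducedFamily_mono [Finite σ] (h : IsStableFamily 𝔞 t 𝒥) (h' : IsStableFamily 𝔞 t 𝒥')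
    (hε : IsHilbertLift 𝔞 ε) (h𝔞 : IsHomogeneousIdeal 𝔞)
    (hle : ∀ D, familyDim 𝒥 D (D + 1) ≤ familyDim 𝒥' D (D + 1)) (l : ℕ) :
    inducedFamily 𝔞 t ε 𝒥 l ≤ inducedFamily 𝔞 t ε 𝒥' l := by
  rcases lt_or_ge (l : ℕ∞) t with hl | hl
  · refine (isHomogeneousIdeal_inducedFamily h hε h𝔞 l).le fun n p hp hpn => ?_
    rw [mem_inducedFamily h hε h𝔞 hl hpn] at hp
    rw [mem_inducedFamily h' hε h𝔞 hl hpn]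
    rcases lt_or_ge n 0 with hn | hn
    · rw [eq_zero_of_mem_inducedPiece hn hp]
      exact Submodule.zero_mem _
    · lift n to ℕ using hn
      rw [inducedPiece_natCast] at hp ⊢
      refine flag_mono (optSeq_mono h hε h𝔞 h' ?_ (lt_sliceCount.2 ⟨hl, by omega⟩)) hp
      have := hle (n + l)
      rw [familyDim_eq h, familyDim_eq h'] at this
      rw [headSum_dimSeq, headSum_dimSeq]
      exact_mod_cast Nat.le_of_add_le_add_right this
  · rw [inducedFamily_eq_top hl, inducedFamily_eq_top hl]

/-- The Hilbert functions of the truncations of a stable family determine the dimensions of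
all its pieces. -/
lemma idealDim_eq_of_familyDim_eq
    (hle : ∀ D i, i ≤ sliceCount t D → familyDim 𝒥 D i = familyDim 𝒥' D i) {l : ℕ}
    (hl : (l : ℕ∞) < t) (m : ℕ) : idealDim (𝒥 l) m = idealDim (𝒥' l) m := by
  have hlt : l < sliceCount t (m + l) := lt_sliceCount.2 ⟨hl, by omega⟩
  have h1 := hle (m + l) l hlt.le
  have h2 := hle (m + l) (l + 1) hlt
  rw [familyDim, familyDim, Finset.sum_range_succ, Finset.sum_range_succ] at h2
  rw [familyDim, familyDim] at h1
  rw [show ((m + l : ℕ) : ℤ) - l = m by push_cast; ring] at h2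
  omega

/-- The Hilbert function of `J + (z ^ i)` in terms of the first `i` slices of `J`. -/
lemma idealDim_truncate [Finite σ] (h𝒥 : Monotone 𝒥) {D i : ℕ} (hi : i ≤ D + 1) :
    idealDim (ofSlices (truncate 𝒥 i) (monotone_truncate h𝒥 i)) D = familyDim 𝒥 D i +
      ∑ l ∈ Finset.Ico i (D + 1), Module.finrank k (zhom k σ ((D : ℤ) - l)) := by
  rw [idealDim_ofSlices, familyDim, Finset.range_eq_Ico, Finset.range_eq_Ico,
    ← Finset.sum_Ico_consecutive _ (Nat.zero_le _) hi]
  congr 1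
  · refine Finset.sum_congr rfl fun l hl => ?_
    rw [truncate, if_pos (Finset.mem_Ico.1 hl).2]
  · refine Finset.sum_congr rfl fun l hl => ?_
    rw [truncate, if_neg (Finset.mem_Ico.1 hl).1.not_gt, idealDim_top]

end Induced

/-! ### Koszul boundaries modulo a `z`-stable ideal -/

section ConeBounds

variable {k : Type u} [Field k] {σ : Type v}

lemma zCoeff_inclMatrix_mulVec {α β : Type} [Fintype β] (D : Matrix α β (MvPolynomial σ k))
    (w : β → MvPolynomial (Option σ) k) (l : ℕ) (a : α) :
    zCoeff l ((inclMatrix D).mulVec w a) = D.mulVec (fun b => zCoeff l (w b)) a := by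
  simp only [Matrix.mulVec, dotProduct, map_sum, inclMatrix, Matrix.map_apply, zCoeff_incl_mul]

lemma zCoeff_incl (l : ℕ) (a : MvPolynomial σ k) :
    zCoeff l (incl k σ a) = if l = 0 then a else 0 := by
  have := zCoeff_incl_mul_pow l 0 a
  rwa [pow_zero, mul_one] at this

lemma mul_mem_of_X_mul_mem {I I' : Ideal (MvPolynomial σ k)}
    (h : ∀ a, ∀ p ∈ I, X a * p ∈ I') {f p : MvPolynomial σ k} (hf : f ∈ zhom k σ 1)
    (hp : p ∈ I) : f * p ∈ I' := by
  rw [f.as_sum, Finset.sum_mul]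
  refine I'.sum_mem fun u hu => ?_
  have hu1 : u.degree = 1 := by exact_mod_cast hf u (mem_support_iff.1 hu)
  obtain ⟨a, rfl⟩ : u ∈ Set.range fun a : σ => Finsupp.single a 1 := by
    rw [Finsupp.range_single_one]
    exact hu1
  rw [← mul_one (coeff _ f), ← C_mul_monomial, mul_assoc]
  exact I'.mul_mem_left _ (h a p hp)

variable {𝔞 : Ideal (MvPolynomial σ k)} {t : ℕ∞} {𝒥 : ℕ → Ideal (MvPolynomial σ k)}

namespace KoszulMatrices

variable (G : KoszulMatrices k σ)

/-- `D 𝒥_{l+1} ⊆ 𝒥_l` for a matrix `D` of linear forms, since `𝔪 𝒥_{l+1} ⊆ 𝒥_l`. -/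
lemma mulVec_mem_of_isStableFamily (h : IsStableFamily 𝔞 t 𝒥) {l : ℕ}
    (hl : ((l + 1 : ℕ) : ℕ∞) < t) {i : ℕ} {v : G.ι (i + 1) → MvPolynomial σ k}
    (hv : ∀ b, v b ∈ 𝒥 (l + 1)) (b : G.ι i) : (G.diff i).mulVec v b ∈ 𝒥 l := by
  exact (𝒥 l).sum_mem fun a _ =>
    mul_mem_of_X_mul_mem (h.X_mul_mem l hl) (G.diff_mem i b a) (hv a)

open Classical in
/-- The condition on the `l`-th coefficients in the description of the Koszul boundaries modulo the
ideal `⨁ 𝒥_l z^l`: boundaries modulo `𝒥_l` for the last slice `l = t - 1`, and vectors in `𝒥_l`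
for the other slices. -/
def lowerPiece (t : ℕ∞) (𝒥 : ℕ → Ideal (MvPolynomial σ k)) (i : ℕ) (m : ℤ) (l : ℕ) :
    Submodule k (G.ι i → MvPolynomial σ k) :=
  if ((l + 1 : ℕ) : ℕ∞) = t then G.idealBounds (𝒥 l) i (m - l) else G.idealVec (𝒥 l) i (m - l)

lemma lowerPiece_of_eq {l : ℕ} (hl : ((l + 1 : ℕ) : ℕ∞) = t) (i : ℕ) (m : ℤ) :
    G.lowerPiece t 𝒥 i m l = G.idealBounds (𝒥 l) i (m - l) := if_pos hl

lemma lowerPiece_of_ne {l : ℕ} (hl : ((l + 1 : ℕ) : ℕ∞) ≠ t) (i : ℕ) (m : ℤ) :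
    G.lowerPiece t 𝒥 i m l = G.idealVec (𝒥 l) i (m - l) := if_neg hl

instance [Finite σ] (i : ℕ) (m : ℤ) (l : ℕ) : FiniteDimensional k (G.lowerPiece t 𝒥 i m l) := by
  by_cases h : ((l + 1 : ℕ) : ℕ∞) = t
  · rw [lowerPiece_of_eq G h]
    infer_instance
  · rw [lowerPiece_of_ne G h]
    infer_instance

variable {G}

/-- In homological degree `0` the coefficients of the positive powers of `z` are arbitrary, because
multiples of `z` are boundaries. -/
lemma mem_cone_idealBounds_zero {h𝒥 : Monotone 𝒥} {m : ℕ}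
    {x : G.ι 0 → MvPolynomial (Option σ) k} :
    x ∈ G.cone.idealBounds (ofSlices 𝒥 h𝒥) 0 m ↔ (∀ b, x b ∈ zhom k (Option σ) m) ∧
      (fun b => zCoeff 0 (x b)) ∈ G.idealBounds (𝒥 0) 0 m := by
  rw [mem_idealBounds]
  refine and_congr_right fun hx => ⟨?_, ?_⟩
  · rintro ⟨y, hy⟩
    have hy1 : ∀ b, x b - (G.coneDiff 0).mulVec
        (Sum.elim (fun a => y (Sum.inl a)) fun a => y (Sum.inr a)) b ∈ ofSlices 𝒥 h𝒥 := by
      intro b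
      rw [show Sum.elim (fun a => y (Sum.inl a)) (fun a => y (Sum.inr a)) = y from
        funext fun o => by cases o <;> rfl]
      exact hy b
    refine ⟨fun b => ?_, fun a => zCoeff 0 (y (Sum.inl a)), fun b => ?_⟩
    · have := mem_zhom_iff_zCoeff.1 (hx b) 0
      simpa using this
    · have := hy1 b 0
      rw [coneDiff_zero_mulVec, Pi.add_apply, Pi.smul_apply, smul_eq_mul, map_sub, map_add,
        zCoeff_zero_z_mul, add_zero, zCoeff_inclMatrix_mulVec] at this
      exact this
  · rintro ⟨-, w, hw⟩
    refine ⟨Sum.elim (fun a => incl k σ (w a)) fun b => ∑ l : Fin (m + 1),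
      incl k σ (zCoeff (l + 1) (x b)) * X none ^ (l : ℕ), ?_⟩
    intro (b : G.ι 0) l
    change zCoeff l (x b - (G.coneDiff 0).mulVec _ b) ∈ 𝒥 l
    rw [coneDiff_zero_mulVec, Pi.add_apply, Pi.smul_apply, smul_eq_mul, map_sub, map_add,
      inclMatrix_mulVec]
    rw [zCoeff_incl]
    cases l with
    | zero =>
      rw [zCoeff_zero_z_mul, add_zero, if_pos rfl]
      exact hw b
    | succ l =>
      rw [zCoeff_succ_z_mul, if_neg (Nat.succ_ne_zero l), zero_add,
        zCoeff_sum_incl_mul_pow (fun l : Fin (m + 1) => zCoeff (l + 1) (x b)) l]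
      split_ifs with hl
      · rw [sub_self]
        exact Ideal.zero_mem _
      · have := mem_zhom_iff_zCoeff.1 (hx b) (l + 1)
        rw [zhom_of_neg (by push_cast; omega)] at this
        rw [(Submodule.mem_bot k).1 this, sub_zero]
        exact Ideal.zero_mem _

/-- Koszul boundaries of `A[z]` modulo `⨁ 𝒥_l z^l` in terms of the coefficients `p_l` and `q_l` of
the two components of a vector. The boundary of a pair `(u, v)` is `(D' u + z v, -D v)`. So `(p, q)` is
a boundary modulo the ideal if `p_0 - D' u_0 ∈ 𝒥_0`, `p_{l+1} - D' u_{l+1} - v_l ∈ 𝒥_{l+1}` and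
`q_l + D v_l ∈ 𝒥_l` for suitable `u` and `v`. The vectors `u_{l+1}` and `v_l` can be eliminated: if
`l + 1 < t` the last two conditions imply `q_l + D p_{l+1} ∈ 𝒥_l`, as `D D' = 0` and
`D 𝒥_{l+1} ⊆ 𝒥_l`, whereas `𝒥_{l+1}` is the whole ring if `l + 1 = t`. -/
lemma mem_cone_idealBounds_succ (h : IsStableFamily 𝔞 t 𝒥) {i m : ℕ}
    {x : G.ι (i + 1) ⊕ G.ι i → MvPolynomial (Option σ) k} :
    x ∈ G.cone.idealBounds (ofSlices 𝒥 h.monotone) (i + 1) m ↔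
      (∀ b, x b ∈ zhom k (Option σ) m) ∧
      (fun b => zCoeff 0 (x (Sum.inl b))) ∈ G.idealBounds (𝒥 0) (i + 1) m ∧
      ∀ l, (fun b => zCoeff l (x (Sum.inr b)) +
        (G.diff i).mulVec (fun a => zCoeff (l + 1) (x (Sum.inl a))) b) ∈
          G.lowerPiece t 𝒥 i m l := by
  rw [mem_idealBounds]
  refine and_congr_right fun hx => ⟨?_, ?_⟩
  · rintro ⟨y, hy⟩
    have hy1 : ∀ b, x b - (G.coneDiff (i + 1)).mulVec
        (Sum.elim (fun a => y (Sum.inl a)) fun a => y (Sum.inr a)) b ∈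
          ofSlices 𝒥 h.monotone := by
      intro b
      rw [show Sum.elim (fun a => y (Sum.inl a)) (fun a => y (Sum.inr a)) = y from
        funext fun o => by cases o <;> rfl]
      exact hy b
    set u : G.ι (i + 2) → MvPolynomial (Option σ) k := fun a => y (Sum.inl a)
    set v : G.ι (i + 1) → MvPolynomial (Option σ) k := fun a => y (Sum.inr a)
    have hl : ∀ l b, zCoeff l (x (Sum.inl b)) - ((G.diff (i + 1)).mulVec
        (fun a => zCoeff l (u a)) b + zCoeff l (X none * v b)) ∈ 𝒥 l := by
      intro l b
      have := hy1 (Sum.inl b) l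
      rw [coneDiff_succ_mulVec, Sum.elim_inl, Pi.add_apply, Pi.smul_apply, smul_eq_mul, map_sub,
        map_add, zCoeff_inclMatrix_mulVec] at this
      exact this
    have hr : ∀ l b, zCoeff l (x (Sum.inr b)) + (G.diff i).mulVec (fun a => zCoeff l (v a)) b
        ∈ 𝒥 l := by
      intro l b
      have := hy1 (Sum.inr b) l
      rw [coneDiff_succ_mulVec, Sum.elim_inr, Pi.neg_apply, map_sub, map_neg,
        zCoeff_inclMatrix_mulVec, sub_neg_eq_add] at this
      exact this
    refine ⟨⟨fun b => ?_, fun a => zCoeff 0 (u a), fun b => ?_⟩, fun l => ?_⟩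
    · have := mem_zhom_iff_zCoeff.1 (hx (Sum.inl b)) 0
      simpa using this
    · have := hl 0 b
      rwa [zCoeff_zero_z_mul, add_zero] at this
    · have hdeg : ∀ b, zCoeff l (x (Sum.inr b)) + (G.diff i).mulVec
          (fun a => zCoeff (l + 1) (x (Sum.inl a))) b ∈ zhom k σ ((m : ℤ) - l) := by
        refine fun b => Submodule.add_mem _ (mem_zhom_iff_zCoeff.1 (hx _) l)
          (mulVec_mem_zhom (fun a => ?_) b)
        have := mem_zhom_iff_zCoeff.1 (hx (Sum.inl a)) (l + 1)
        rwa [Nat.cast_succ, ← sub_sub] at this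
      by_cases ht : ((l + 1 : ℕ) : ℕ∞) = t
      · rw [lowerPiece_of_eq G ht]
        refine ⟨hdeg, fun a => zCoeff (l + 1) (x (Sum.inl a)) - zCoeff l (v a), fun b => ?_⟩
        have h1 := Matrix.mulVec_sub (G.diff i) (fun a => zCoeff (l + 1) (x (Sum.inl a)))
          (fun a => zCoeff l (v a))
        have h2 := congrFun h1 b
        rw [Pi.sub_apply] at h2
        change (G.diff i).mulVec (fun a => _ - _) b = _ at h2
        rw [h2]
        convert hr l b using 1
        ring
      · rw [lowerPiece_of_ne G ht, mem_idealVec]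
        refine fun b => ⟨?_, hdeg b⟩
        rcases lt_or_gt_of_ne ht with hlt | hgt
        · have h3 : ∀ a, zCoeff (l + 1) (x (Sum.inl a)) - ((G.diff (i + 1)).mulVec
            (fun a => zCoeff (l + 1) (u a)) a + zCoeff l (v a)) ∈ 𝒥 (l + 1) := fun a => by
            have := hl (l + 1) a
            rwa [zCoeff_succ_z_mul] at this
          have h4 := G.mulVec_mem_of_isStableFamily h hlt h3 b
          have h5 : (fun a => zCoeff (l + 1) (x (Sum.inl a)) - ((G.diff (i + 1)).mulVec
            (fun a => zCoeff (l + 1) (u a)) a + zCoeff l (v a))) =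
            (fun a => zCoeff (l + 1) (x (Sum.inl a))) - ((G.diff (i + 1)).mulVec
              (fun a => zCoeff (l + 1) (u a)) + fun a => zCoeff l (v a)) := rfl
          rw [h5, Matrix.mulVec_sub, Matrix.mulVec_add, Matrix.mulVec_mulVec, G.diff_mul,
            Matrix.zero_mulVec, zero_add, Pi.sub_apply] at h4
          have := (𝒥 l).add_mem (hr l b) h4
          rwa [add_add_sub_cancel] at this
        · rw [h.eq_top l (Order.le_of_lt_add_one (by exact_mod_cast hgt))]
          trivial
  · rintro ⟨⟨-, w, hw⟩, hU⟩
    -- take `u_{l+1} = 0` and `v_l = p_{l+1}`, with a correction that is free if `l + 1 = t`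
    have hex : ∀ l, ∃ v : G.ι (i + 1) → MvPolynomial σ k,
        (∀ b, zCoeff (l + 1) (x (Sum.inl b)) - v b ∈ 𝒥 (l + 1)) ∧
        ∀ b, zCoeff l (x (Sum.inr b)) + (G.diff i).mulVec v b ∈ 𝒥 l := by
      intro l
      by_cases ht : ((l + 1 : ℕ) : ℕ∞) = t
      · have := hU l
        rw [lowerPiece_of_eq G ht] at this
        obtain ⟨-, w', hw'⟩ := this
        refine ⟨(fun a => zCoeff (l + 1) (x (Sum.inl a))) - w', fun b => ?_, fun b => ?_⟩
        · rw [h.eq_top (l + 1) ht.ge]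
          trivial
        · rw [Matrix.mulVec_sub, Pi.sub_apply, ← add_sub_assoc]
          exact hw' b
      · have := hU l
        rw [lowerPiece_of_ne G ht, mem_idealVec] at this
        refine ⟨fun a => zCoeff (l + 1) (x (Sum.inl a)), fun b => ?_, fun b => (this b).1⟩
        rw [sub_self]
        exact Ideal.zero_mem _
    choose v hv1 hv2 using hex
    have hvz : ∀ l b, zCoeff l (∑ l : Fin (m + 1), incl k σ (v l b) * X none ^ (l : ℕ)) =
        if l < m + 1 then v l b else 0 := fun l b =>
      (zCoeff_sum_incl_mul_pow (fun l : Fin (m + 1) => v l b) l).trans (by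
        split_ifs <;> rfl)
    refine ⟨Sum.elim (fun a => incl k σ (w a)) fun b => ∑ l : Fin (m + 1),
      incl k σ (v l b) * X none ^ (l : ℕ), ?_⟩
    rintro (b | b) l
    · change zCoeff l (x (Sum.inl b) - (G.coneDiff (i + 1)).mulVec _ (Sum.inl b)) ∈ 𝒥 l
      rw [coneDiff_succ_mulVec, Sum.elim_inl, Pi.add_apply, Pi.smul_apply, smul_eq_mul, map_sub,
        map_add, inclMatrix_mulVec, zCoeff_incl]
      cases l with
      | zero =>
        rw [zCoeff_zero_z_mul, add_zero, if_pos rfl]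
        exact hw b
      | succ l =>
        rw [zCoeff_succ_z_mul, if_neg (Nat.succ_ne_zero l), zero_add, hvz]
        split_ifs with hl
        · exact hv1 l b
        · have := mem_zhom_iff_zCoeff.1 (hx (Sum.inl b)) (l + 1)
          rw [zhom_of_neg (by push_cast; omega)] at this
          rw [(Submodule.mem_bot k).1 this, sub_zero]
          exact Ideal.zero_mem _
    · change zCoeff l (x (Sum.inr b) - (G.coneDiff (i + 1)).mulVec _ (Sum.inr b)) ∈ 𝒥 l
      rw [coneDiff_succ_mulVec, Sum.elim_inr, Pi.neg_apply, sub_neg_eq_add, map_add,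
        zCoeff_inclMatrix_mulVec]
      simp only [hvz]
      by_cases hl : l < m + 1
      · simp only [if_pos hl]
        exact hv2 l b
      · have := mem_zhom_iff_zCoeff.1 (hx (Sum.inr b)) l
        rw [zhom_of_neg (by omega)] at this
        simp only [if_neg hl]
        rw [(Submodule.mem_bot k).1 this, zero_add]
        change (G.diff i).mulVec 0 b ∈ 𝒥 l
        rw [Matrix.mulVec_zero]
        exact Ideal.zero_mem _

lemma idealBounds_of_neg {I : Ideal (MvPolynomial σ k)} {i : ℕ} {m : ℤ} (hm : m < 0) :
    G.idealBounds I i m = ⊥ := by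
  refine eq_bot_iff.2 fun v hv => (Submodule.mem_bot k).2 (funext fun b => ?_)
  have := hv.1 b
  rwa [zhom_of_neg hm] at this

/-- The family with the first slice `𝒥 0` and all other slices equal to the whole ring: being a
boundary is a condition for `l = 0` only. -/
lemma mem_idealBounds_truncate {i : ℕ} {m l : ℕ} {v : G.ι i → MvPolynomial σ k} :
    v ∈ G.idealBounds (truncate 𝒥 1 l) i ((m : ℤ) - l) ↔
      (∀ b, v b ∈ zhom k σ ((m : ℤ) - l)) ∧ (l = 0 → v ∈ G.idealBounds (𝒥 0) i m) := by
  by_cases hl : l = 0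
  · subst hl
    rw [truncate, if_pos one_pos, Nat.cast_zero, sub_zero]
    exact ⟨fun h => ⟨h.1, fun _ => h⟩, fun h => h.2 rfl⟩
  · rw [truncate, if_neg (by omega)]
    exact ⟨fun h => ⟨h.1, fun h' => absurd h' hl⟩, fun h => ⟨h.1, 0, fun _ => trivial⟩⟩

variable (G)

/-- The coefficients with respect to `z` of a vector. -/
def vecCoeffs (k : Type u) [Field k] (σ : Type v) (α : Type) (m : ℕ) :
    (α → MvPolynomial (Option σ) k) →ₗ[k] (Fin (m + 1) → α → MvPolynomial σ k) where
  toFun x l b := zCoeff l (x b)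
  map_add' x y := by
    funext l b
    exact map_add _ _ _
  map_smul' c x := by
    funext l b
    exact (zCoeff (l : ℕ)).map_smul c (x b)

/-- The coefficients of vectors `p` and `q` over `A[z]`, the latter modified to
`q_l + D p_{l+1}`. -/
def pairCoeffs (i m : ℕ) : (G.ι (i + 1) ⊕ G.ι i → MvPolynomial (Option σ) k) →ₗ[k]
    (Fin (m + 1) → G.ι (i + 1) → MvPolynomial σ k) × (Fin (m + 1) → G.ι i → MvPolynomial σ k) where
  toFun x := (fun l b => zCoeff l (x (Sum.inl b)), fun l b => zCoeff l (x (Sum.inr b)) +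
    (G.diff i).mulVec (fun a => zCoeff (l + 1) (x (Sum.inl a))) b)
  map_add' x y := by
    refine Prod.ext ?_ ?_ <;> funext l b
    · exact map_add _ _ _
    · have h : (fun a => zCoeff ((l : ℕ) + 1) ((x + y) (Sum.inl a))) =
          (fun a => zCoeff ((l : ℕ) + 1) (x (Sum.inl a))) +
            fun a => zCoeff ((l : ℕ) + 1) (y (Sum.inl a)) := funext fun a => map_add _ _ _
      dsimp only
      rw [h, Matrix.mulVec_add, Pi.add_apply, Pi.add_apply, map_add]
      exact add_add_add_comm _ _ _ _
  map_smul' c x := by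
    refine Prod.ext ?_ ?_ <;> funext l b
    · exact (zCoeff (l : ℕ)).map_smul c _
    · have h : (fun a => zCoeff ((l : ℕ) + 1) ((c • x) (Sum.inl a))) =
          c • (fun a => zCoeff ((l : ℕ) + 1) (x (Sum.inl a))) :=
        funext fun a => (zCoeff ((l : ℕ) + 1)).map_smul c _
      dsimp only
      rw [h, Matrix.mulVec_smul, Pi.smul_apply, Pi.smul_apply, map_smul]
      exact (smul_add _ _ _).symm

variable [Finite σ]

/-- Only the first slice contributes to the boundaries in homological degree `0`. -/
lemma finrank_cone_idealBounds_zero (h𝒥 : Monotone 𝒥) (m : ℕ) :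
    Module.finrank k (G.cone.idealBounds (ofSlices 𝒥 h𝒥) 0 m) =
      ∑ l : Fin (m + 1), Module.finrank k
        (G.idealBounds (truncate 𝒥 1 l) 0 ((m : ℤ) - (l : ℕ))) := by
  let Φ : (G.cone.ι 0 → MvPolynomial (Option σ) k) →ₗ[k] (Fin (m + 1) → G.ι 0 → MvPolynomial σ k) :=
    vecCoeffs k σ (G.ι 0) m
  have hinj : ∀ x ∈ G.cone.idealBounds (ofSlices 𝒥 h𝒥) 0 m, Φ x = 0 → x = 0 := by
    refine fun x hx h => funext fun b => eq_zero_of_zCoeff (hx.1 b) fun l hl => ?_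
    have := congrFun (congrFun h ⟨l, hl⟩) b
    exact this
  have hmap : (G.cone.idealBounds (ofSlices 𝒥 h𝒥) 0 m).map Φ = Submodule.pi Set.univ
      fun l : Fin (m + 1) => G.idealBounds (truncate 𝒥 1 l) 0 ((m : ℤ) - (l : ℕ)) := ?_
  · rw [← finrank_map_of_injOn Φ hinj, hmap, finrank_submodule_pi]
  ext a
  constructor
  · rintro ⟨x, hx, rfl⟩ l -
    have hx' := mem_cone_idealBounds_zero.1 hx
    refine mem_idealBounds_truncate.2 ⟨fun b => mem_zhom_iff_zCoeff.1 (hx'.1 b) l, fun hl => ?_⟩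
    convert hx'.2 using 1
    funext b
    change zCoeff (l : ℕ) (x b) = _
    rw [hl]
  · intro ha
    have ha' := fun l : Fin (m + 1) => mem_idealBounds_truncate.1 (ha l trivial)
    have hz : ∀ l b, zCoeff l (∑ l : Fin (m + 1), incl k σ (a l b) * X none ^ (l : ℕ)) =
        if h : l < m + 1 then a ⟨l, h⟩ b else 0 := fun l b =>
      zCoeff_sum_incl_mul_pow (fun l => a l b) l
    refine ⟨fun b => ∑ l : Fin (m + 1), incl k σ (a l b) * X none ^ (l : ℕ),
      mem_cone_idealBounds_zero.2 ⟨fun b => (zhom k (Option σ) m).sum_mem fun l _ =>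
        incl_mul_pow_mem_zhom l ((ha' l).1 b), ?_⟩, ?_⟩
    · have := (ha' 0).2 rfl
      convert this using 1
      funext b
      rw [hz, dif_pos (Nat.succ_pos m)]
      rfl
    · funext l b
      exact (hz l b).trans (dif_pos l.2)

/-- The rank of the boundaries in positive homological degrees, in terms of slices: `pairCoeffs`
maps the boundaries isomorphically to a product of spaces attached to the slices. -/
lemma finrank_cone_idealBounds_succ (h : IsStableFamily 𝔞 t 𝒥) (i m : ℕ) :
    Module.finrank k (G.cone.idealBounds (ofSlices 𝒥 h.monotone) (i + 1) m) =
      ∑ l : Fin (m + 1), Module.finrank k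
        (G.idealBounds (truncate 𝒥 1 l) (i + 1) ((m : ℤ) - (l : ℕ))) +
      ∑ l : Fin (m + 1), Module.finrank k (G.lowerPiece t 𝒥 i m l) := by
  let Φ : (G.cone.ι (i + 1) → MvPolynomial (Option σ) k) →ₗ[k]
      (Fin (m + 1) → G.ι (i + 1) → MvPolynomial σ k) × (Fin (m + 1) → G.ι i → MvPolynomial σ k) :=
    G.pairCoeffs i m
  have hinj : ∀ x ∈ G.cone.idealBounds (ofSlices 𝒥 h.monotone) (i + 1) m,
      Φ x = 0 → x = 0 := by
    intro x hx h0
    have h1 : ∀ b, x (Sum.inl b) = 0 := fun b => eq_zero_of_zCoeff (hx.1 (Sum.inl b))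
      fun l hl => by
      have := congrFun (congrFun (congrArg Prod.fst h0) ⟨l, hl⟩) b
      exact this
    have h2 : ∀ b, x (Sum.inr b) = 0 := fun b => eq_zero_of_zCoeff (hx.1 (Sum.inr b)) fun l hl => by
      have := congrFun (congrFun (congrArg Prod.snd h0) ⟨l, hl⟩) b
      change zCoeff l (x (Sum.inr b)) +
        (G.diff i).mulVec (fun a => zCoeff (l + 1) (x (Sum.inl a))) b = 0 at this
      simp only [h1, map_zero] at this
      rw [← this, left_eq_add]
      exact congrFun (Matrix.mulVec_zero _) b
    exact funext fun o => o.rec h1 h2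
  have hmap : (G.cone.idealBounds (ofSlices 𝒥 h.monotone) (i + 1) m).map Φ =
      (Submodule.pi Set.univ fun l : Fin (m + 1) =>
        G.idealBounds (truncate 𝒥 1 l) (i + 1) ((m : ℤ) - (l : ℕ))).prod
      (Submodule.pi Set.univ fun l : Fin (m + 1) => G.lowerPiece t 𝒥 i m l) := ?_
  · have := finiteDimensional_pi fun l : Fin (m + 1) =>
      G.idealBounds (truncate 𝒥 1 l) (i + 1) ((m : ℤ) - (l : ℕ))
    have := finiteDimensional_pi fun l : Fin (m + 1) => G.lowerPiece t 𝒥 i m l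
    rw [← finrank_map_of_injOn Φ hinj, hmap, finrank_submodule_prod, finrank_submodule_pi,
      finrank_submodule_pi]
  ext a
  constructor
  · rintro ⟨x, hx, rfl⟩
    have hx' := (mem_cone_idealBounds_succ h).1 hx
    refine ⟨fun l _ => mem_idealBounds_truncate.2
      ⟨fun b => mem_zhom_iff_zCoeff.1 (hx'.1 (Sum.inl b)) l, fun hl => ?_⟩, fun l _ => hx'.2.2 l⟩
    convert hx'.2.1 using 1
    funext b
    change zCoeff (l : ℕ) (x (Sum.inl b)) = _
    rw [hl]
  · rintro ⟨ha1, ha2⟩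
    obtain ⟨p, q⟩ := a
    have hp := fun l : Fin (m + 1) => mem_idealBounds_truncate.1 (ha1 l trivial)
    have hq : ∀ l : Fin (m + 1), q l ∈ G.lowerPiece t 𝒥 i m l := fun l => ha2 l trivial
    dsimp only at hp
    -- the inverse of `pairCoeffs`: subtract `D p_{l+1}` from the second component
    set p' : ℕ → G.ι (i + 1) → MvPolynomial σ k := fun l b =>
      if h : l < m + 1 then p ⟨l, h⟩ b else 0
    set q' : Fin (m + 1) → G.ι i → MvPolynomial σ k := fun l b =>
      q l b - (G.diff i).mulVec (p' (l + 1)) b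
    have hp' : ∀ (l : ℕ) b, p' l b ∈ zhom k σ ((m : ℤ) - l) := by
      intro l b
      by_cases hl : l < m + 1
      · rw [show p' l b = p ⟨l, hl⟩ b from dif_pos hl]
        exact (hp ⟨l, hl⟩).1 b
      · rw [show p' l b = 0 from dif_neg hl]
        exact Submodule.zero_mem _
    have hqdeg : ∀ (l : Fin (m + 1)) b, q l b ∈ zhom k σ ((m : ℤ) - (l : ℕ)) := by
      intro l b
      have := hq l
      by_cases ht : (((l : ℕ) + 1 : ℕ) : ℕ∞) = t
      · rw [lowerPiece_of_eq G ht] at this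
        exact this.1 b
      · rw [lowerPiece_of_ne G ht, mem_idealVec] at this
        exact (this b).2
    have hq' : ∀ (l : Fin (m + 1)) b, q' l b ∈ zhom k σ ((m : ℤ) - (l : ℕ)) := by
      refine fun l b => Submodule.sub_mem _ (hqdeg l b) (mulVec_mem_zhom (fun a => ?_) b)
      have := hp' (l + 1) a
      rwa [Nat.cast_succ, ← sub_sub] at this
    have hzp : ∀ l b, zCoeff l (∑ l : Fin (m + 1), incl k σ (p l b) * X none ^ (l : ℕ)) =
        p' l b := fun l b => zCoeff_sum_incl_mul_pow (fun l => p l b) l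
    have hzq : ∀ (l : Fin (m + 1)) b,
        zCoeff l (∑ l : Fin (m + 1), incl k σ (q' l b) * X none ^ (l : ℕ)) = q' l b := fun l b =>
      (zCoeff_sum_incl_mul_pow (fun l => q' l b) l).trans (dif_pos l.2)
    set x : G.ι (i + 1) ⊕ G.ι i → MvPolynomial (Option σ) k := Sum.elim
      (fun b => ∑ l : Fin (m + 1), incl k σ (p l b) * X none ^ (l : ℕ))
      (fun b => ∑ l : Fin (m + 1), incl k σ (q' l b) * X none ^ (l : ℕ))
    have hx : ∀ b, x b ∈ zhom k (Option σ) m := by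
      rintro (b | b)
      · exact (zhom k (Option σ) m).sum_mem fun l _ => incl_mul_pow_mem_zhom l ((hp l).1 b)
      · exact (zhom k (Option σ) m).sum_mem fun l _ => incl_mul_pow_mem_zhom l (hq' l b)
    have hxq : ∀ l : Fin (m + 1), (fun b => zCoeff l (x (Sum.inr b)) +
        (G.diff i).mulVec (fun a => zCoeff (l + 1) (x (Sum.inl a))) b) = q l := by
      intro l
      funext b
      change zCoeff l (∑ l : Fin (m + 1), incl k σ (q' l b) * X none ^ (l : ℕ)) +
        (G.diff i).mulVec (fun a => zCoeff (l + 1)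
          (∑ l : Fin (m + 1), incl k σ (p l a) * X none ^ (l : ℕ))) b = q l b
      simp only [hzp, hzq]
      exact sub_add_cancel _ _
    refine ⟨x, (mem_cone_idealBounds_succ h).2 ⟨hx, ?_, fun l => ?_⟩, ?_⟩
    · have := (hp 0).2 rfl
      convert this using 1
      funext b
      exact (hzp 0 b).trans (dif_pos (Nat.succ_pos m))
    · by_cases hl : l < m + 1
      · have := hq ⟨l, hl⟩
        rw [← hxq ⟨l, hl⟩] at this
        exact this
      · have h0 : (fun b => zCoeff l (x (Sum.inr b)) +
            (G.diff i).mulVec (fun a => zCoeff (l + 1) (x (Sum.inl a))) b) = 0 := by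
          have h1 : ∀ b, zCoeff l (x b) = 0 := fun b => by
            have := mem_zhom_iff_zCoeff.1 (hx b) l
            rwa [zhom_of_neg (by omega)] at this
          have h2 : ∀ b, zCoeff (l + 1) (x b) = 0 := fun b => by
            have := mem_zhom_iff_zCoeff.1 (hx b) (l + 1)
            rwa [zhom_of_neg (by push_cast; omega)] at this
          funext b
          simp only [h1, h2, zero_add]
          exact congrFun (Matrix.mulVec_zero _) b
        rw [h0]
        exact Submodule.zero_mem _
    · refine Prod.ext ?_ (funext hxq)
      funext l b
      exact (hzp l b).trans (dif_pos l.2)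

end KoszulMatrices

variable [Finite σ] {G : KoszulMatrices k σ} {ℒ : ℕ → Ideal (MvPolynomial σ k)}

/-- The comparison of Koszul boundaries modulo two `z`-stable ideals with the same Hilbert function:
only the first and the last slice matter. -/
lemma finrank_cone_idealBounds_le (h : IsStableFamily 𝔞 t 𝒥) (hL : IsStableFamily 𝔞 t ℒ)
    (hdim : ∀ D, familyDim ℒ D (D + 1) = familyDim 𝒥 D (D + 1))
    (hfirst : ∀ i m, Module.finrank k (G.idealBounds (ℒ 0) i m) ≤
      Module.finrank k (G.idealBounds (𝒥 0) i m))
    (hlast : ∀ l : ℕ, ((l + 1 : ℕ) : ℕ∞) = t → ∀ i m,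
      Module.finrank k (G.idealBounds (ℒ l) i m) + Fintype.card (G.ι i) * idealDim (𝒥 l) m ≤
        Module.finrank k (G.idealBounds (𝒥 l) i m) + Fintype.card (G.ι i) * idealDim (ℒ l) m)
    (i m : ℕ) : Module.finrank k (G.cone.idealBounds (ofSlices ℒ hL.monotone) i m) ≤
      Module.finrank k (G.cone.idealBounds (ofSlices 𝒥 h.monotone) i m) := by
  have h1 : ∀ i, ∑ l : Fin (m + 1), Module.finrank k
        (G.idealBounds (truncate ℒ 1 l) i ((m : ℤ) - (l : ℕ))) ≤
      ∑ l : Fin (m + 1), Module.finrank k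
        (G.idealBounds (truncate 𝒥 1 l) i ((m : ℤ) - (l : ℕ))) := by
    refine fun i => Finset.sum_le_sum fun l _ => ?_
    by_cases hl : (l : ℕ) < 1
    · rw [truncate, truncate, if_pos hl, if_pos hl, Nat.lt_one_iff.1 hl]
      exact hfirst i _
    · rw [truncate, truncate, if_neg hl, if_neg hl]
  cases i with
  | zero =>
    rw [KoszulMatrices.finrank_cone_idealBounds_zero, KoszulMatrices.finrank_cone_idealBounds_zero]
    exact h1 0
  | succ i =>
    rw [KoszulMatrices.finrank_cone_idealBounds_succ G h,
      KoszulMatrices.finrank_cone_idealBounds_succ G hL]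
    refine Nat.add_le_add (h1 (i + 1)) ?_
    have h2 : ∀ l : ℕ, Module.finrank k (G.lowerPiece t ℒ i m l) +
        Fintype.card (G.ι i) * idealDim (𝒥 l) ((m : ℤ) - l) ≤
        Module.finrank k (G.lowerPiece t 𝒥 i m l) +
        Fintype.card (G.ι i) * idealDim (ℒ l) ((m : ℤ) - l) := by
      intro l
      by_cases ht : ((l + 1 : ℕ) : ℕ∞) = t
      · rw [KoszulMatrices.lowerPiece_of_eq G ht, KoszulMatrices.lowerPiece_of_eq G ht]
        exact hlast l ht i _
      · rw [KoszulMatrices.lowerPiece_of_ne G ht, KoszulMatrices.lowerPiece_of_ne G ht,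
          KoszulMatrices.finrank_idealVec, KoszulMatrices.finrank_idealVec, add_comm]
    -- the dimensions of the slices cancel after summation, since the Hilbert functions agree
    have h3 := Finset.sum_le_sum fun (l : Fin (m + 1)) (_ : l ∈ Finset.univ) => h2 l
    have h4 : ∀ 𝒥 : ℕ → Ideal (MvPolynomial σ k), ∑ l : Fin (m + 1),
        Fintype.card (G.ι i) * idealDim (𝒥 l) ((m : ℤ) - (l : ℕ)) =
        Fintype.card (G.ι i) * familyDim 𝒥 m (m + 1) := by
      intro 𝒥
      rw [familyDim, Finset.sum_range, Finset.mul_sum]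
    rw [Finset.sum_add_distrib, Finset.sum_add_distrib, h4, h4, hdim] at h3
    exact Nat.le_of_add_le_add_right h3

/-- If the passage from `I` to `ε I` lowers the ranks of Koszul boundaries, then so does the passage
from a `z`-stable ideal to the induced one. -/
lemma finrank_cone_idealBounds_inducedFamily_le
    {ε : Ideal (MvPolynomial σ k) → Ideal (MvPolynomial σ k)} (h : IsStableFamily 𝔞 t 𝒥)
    (hε : IsHilbertLift 𝔞 ε) (h𝔞 : IsHomogeneousIdeal 𝔞) (ht : 1 ≤ t)
    (hB : ∀ I, IsIdealOver 𝔞 I → ∀ i (m : ℕ), Module.finrank k (G.idealBounds (ε I) i m) ≤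
      Module.finrank k (G.idealBounds I i m)) (i m : ℕ) :
    Module.finrank k (G.cone.idealBounds (ofSlices (inducedFamily 𝔞 t ε 𝒥)
        (isStableFamily_inducedFamily h hε h𝔞).monotone) i m) ≤
      Module.finrank k (G.cone.idealBounds (ofSlices 𝒥 h.monotone) i m) := by
  have hB' : ∀ I, IsIdealOver 𝔞 I → ∀ i (m : ℤ), Module.finrank k (G.idealBounds (ε I) i m) ≤
      Module.finrank k (G.idealBounds I i m) := by
    intro I hI i m
    rcases lt_or_ge m 0 with hm | hm
    · rw [KoszulMatrices.idealBounds_of_neg hm, KoszulMatrices.idealBounds_of_neg hm]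
    · lift m to ℕ using hm
      exact hB I hI i m
  have hL := isStableFamily_inducedFamily h hε h𝔞
  have ht0 : ((0 : ℕ) : ℕ∞) < t := lt_of_lt_of_le (by simp) ht
  refine finrank_cone_idealBounds_le h hL (familyDim_inducedFamily h hε h𝔞) (fun i m => ?_)
    (fun l hl i m => ?_) i m
  -- the first slice of the induced family is contained in `ε (𝒥 0)`, as its dimensions are smaller
  · refine le_trans (Submodule.finrank_mono (KoszulMatrices.idealBounds_mono ?_ i m))
      (hB' _ (h.isIdealOver 0) i m)
    rw [← map_inducedFamily h hε h𝔞 ht0]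
    refine hε.mono _ _ (hL.isIdealOver 0) (h.isIdealOver 0) fun n => ?_
    rcases lt_or_ge n 0 with hn | hn
    · rw [idealDim_of_neg hn, idealDim_of_neg hn]
    · lift n to ℕ using hn
      have := familyDim_inducedFamily_le h hε h𝔞
        (Nat.succ_le_of_lt (lt_sliceCount.2 ⟨ht0, Nat.zero_le n⟩))
      simpa [familyDim] using this
  · have hlt : (l : ℕ∞) < t := by
      rw [← hl]
      exact Nat.cast_lt.2 l.lt_succ_self
    -- the dimensions of the last slice are larger, because the total is fixed and the sums over the
    -- preceding slices are smaller
    have hle : ε (𝒥 l) ≤ inducedFamily 𝔞 t ε 𝒥 l := by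
      rw [← map_inducedFamily h hε h𝔞 hlt]
      refine hε.mono _ _ (h.isIdealOver l) (hL.isIdealOver l) fun n => ?_
      rcases lt_or_ge n 0 with hn | hn
      · rw [idealDim_of_neg hn, idealDim_of_neg hn]
      · lift n to ℕ using hn
        have hc : sliceCount t (n + l) = l + 1 := by
          refine le_antisymm ?_ (lt_sliceCount.2 ⟨hlt, by omega⟩)
          by_contra hc
          have := (lt_sliceCount.1 (not_le.1 hc)).1
          rw [hl] at this
          exact lt_irrefl _ this
        have h1 := familyDim_inducedFamily_le h hε h𝔞 (D := n + l) (i := l) (by omega)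
        have h2 := familyDim_inducedFamily h hε h𝔞 (n + l)
        rw [familyDim_eq h, familyDim_eq hL, hc] at h2
        have h3 := Nat.add_right_cancel h2
        rw [familyDim, familyDim, Finset.sum_range_succ, Finset.sum_range_succ] at h3
        rw [familyDim, familyDim] at h1
        rw [show ((n + l : ℕ) : ℤ) - l = n by push_cast; ring] at h3
        omega
    have h1 := KoszulMatrices.finrank_idealBounds_add_le (G := G) hle
      (hL.isIdealOver l).isHomogeneous i m
    rw [hε.idealDim_eq _ (h.isIdealOver l)] at h1
    exact h1.trans (Nat.add_le_add_right (hB' _ (h.isIdealOver l) i m) _)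

end ConeBounds

/-! ### The embedding induced on Hilbert series of `z`-stable ideals -/

section Embedding

variable {k : Type u} [Field k] {σ : Type v} {𝔞 : Ideal (MvPolynomial σ k)} {t : ℕ∞}

lemma comap_map_mk {P : Type*} [CommRing P] {𝔟 I : Ideal P} (h : 𝔟 ≤ I) :
    (I.map (Ideal.Quotient.mk 𝔟)).comap (Ideal.Quotient.mk 𝔟) = I := by
  rw [Ideal.comap_map_of_surjective _ Ideal.Quotient.mk_surjective,
    ← RingHom.ker_eq_comap_bot, Ideal.mk_ker, sup_eq_left]
  exact h

lemma IsIdealOver.map_mem_idealPoset (h𝔞 : IsHomogeneousIdeal 𝔞) {I : Ideal (MvPolynomial σ k)}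
    (hI : IsIdealOver 𝔞 I) : I.map (Ideal.Quotient.mk 𝔞) ∈ idealPoset k σ (BaseRing 𝔞) := by
  rw [mem_idealPoset_iff h𝔞, comap_map_mk hI.le]
  exact hI.isHomogeneous

open Classical in
/-- An embedding of Hilbert series of `R`-ideals, as an operation on ideals of `A`. -/
def liftEmbedding (h𝔞 : IsHomogeneousIdeal 𝔞)
    (εR : ↥(hilbertPoset k σ (BaseRing 𝔞)) ↪o ↥(idealPoset k σ (BaseRing 𝔞)))
    (I : Ideal (MvPolynomial σ k)) : Ideal (MvPolynomial σ k) :=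
  if hI : IsIdealOver 𝔞 I then
    (εR (hilbOf ⟨I.map (Ideal.Quotient.mk 𝔞), hI.map_mem_idealPoset h𝔞⟩)).1.comap
      (Ideal.Quotient.mk 𝔞)
  else I

lemma isIdealOver_comap (h𝔞 : IsHomogeneousIdeal 𝔞) (I : ↥(idealPoset k σ (BaseRing 𝔞))) :
    IsIdealOver 𝔞 (I.1.comap (Ideal.Quotient.mk 𝔞)) :=
  ⟨(mem_idealPoset_iff h𝔞 I.1).1 I.2, le_comap_mk 𝔞 I.1⟩

lemma liftEmbedding_of_isIdealOver (h𝔞 : IsHomogeneousIdeal 𝔞)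
    (εR : ↥(hilbertPoset k σ (BaseRing 𝔞)) ↪o ↥(idealPoset k σ (BaseRing 𝔞)))
    {I : Ideal (MvPolynomial σ k)} (hI : IsIdealOver 𝔞 I) : liftEmbedding h𝔞 εR I =
      (εR (hilbOf ⟨I.map (Ideal.Quotient.mk 𝔞), hI.map_mem_idealPoset h𝔞⟩)).1.comap
        (Ideal.Quotient.mk 𝔞) :=
  dif_pos hI

/-- The family of slices of a `z`-stable ideal with a given Hilbert series. -/
def someFamily (h : ↥(stableHilbertPoset 𝔞 t)) : ℕ → Ideal (MvPolynomial σ k) :=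
  slicesOf (h.2.choose.comap (Ideal.Quotient.mk (extIdeal 𝔞 t)))

lemma isStableFamily_someFamily (h𝔞 : IsHomogeneousIdeal 𝔞) (h : ↥(stableHilbertPoset 𝔞 t)) :
    IsStableFamily 𝔞 t (someFamily h) :=
  h.2.choose_spec.1.isStableFamily h𝔞

variable [Finite σ]
  {εR : ↥(hilbertPoset k σ (BaseRing 𝔞)) ↪o ↥(idealPoset k σ (BaseRing 𝔞))}

lemma idealDim_eq_of_hilb_eq {τ : Type*} [Finite τ] {𝔟 : Ideal (MvPolynomial τ k)}
    {I I' : Ideal (MvPolynomial τ k ⧸ 𝔟)} (h : hilb k τ I = hilb k τ I') (n : ℤ) :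
    idealDim (I.comap (Ideal.Quotient.mk 𝔟)) n = idealDim (I'.comap (Ideal.Quotient.mk 𝔟)) n := by
  rcases lt_or_ge n 0 with hn | hn
  · rw [idealDim_of_neg hn, idealDim_of_neg hn]
  · lift n to ℕ using hn
    exact le_antisymm (hilb_le_iff.1 h.le n) (hilb_le_iff.1 h.ge n)

/-- `liftEmbedding` is the given embedding of posets read on the preimages in `A`. -/
lemma isHilbertLift_liftEmbedding (h𝔞 : IsHomogeneousIdeal 𝔞) (hεR : IsHilbertEmbedding εR) :
    IsHilbertLift 𝔞 (liftEmbedding h𝔞 εR) where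
  isIdealOver I hI := by
    rw [liftEmbedding_of_isIdealOver h𝔞 εR hI]
    exact isIdealOver_comap h𝔞 _
  idealDim_eq I hI n := by
    rw [liftEmbedding_of_isIdealOver h𝔞 εR hI, idealDim_eq_of_hilb_eq (hεR _) n]
    change idealDim ((I.map (Ideal.Quotient.mk 𝔞)).comap (Ideal.Quotient.mk 𝔞)) n = _
    rw [comap_map_mk hI.le]
  mono I I' hI hI' hle := by
    rw [liftEmbedding_of_isIdealOver h𝔞 εR hI, liftEmbedding_of_isIdealOver h𝔞 εR hI']
    refine Ideal.comap_mono (εR.monotone ?_)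
    change hilb k σ (I.map (Ideal.Quotient.mk 𝔞)) ≤ hilb k σ (I'.map (Ideal.Quotient.mk 𝔞))
    rw [hilb_le_iff, comap_map_mk hI.le, comap_map_mk hI'.le]
    exact fun d => hle d

lemma idealDim_truncate_of_ge {𝒥 : ℕ → Ideal (MvPolynomial σ k)} (h𝒥 : Monotone 𝒥) {D i : ℕ}
    (hi : D + 1 ≤ i) : idealDim (ofSlices (truncate 𝒥 i) (monotone_truncate h𝒥 i)) D =
      familyDim 𝒥 D (D + 1) := by
  rw [idealDim_ofSlices, familyDim]
  refine Finset.sum_congr rfl fun l hl => ?_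
  rw [truncate, if_pos ((Finset.mem_range.1 hl).trans_le hi)]

lemma hilb_add_eq_familyDim {J : Ideal (ExtRing 𝔞 t)} {𝒥 : ℕ → Ideal (MvPolynomial σ k)}
    (h𝒥 : Monotone 𝒥) (hJ : J.comap (Ideal.Quotient.mk (extIdeal 𝔞 t)) = ofSlices 𝒥 h𝒥) (D : ℕ) :
    hilb k (Option σ) J D + idealDim (extIdeal 𝔞 t) D = familyDim 𝒥 D (D + 1) := by
  rw [hilb_add_idealDim, hJ, idealDim_ofSlices, familyDim]

lemma familyDim_someFamily (h𝔞 : IsHomogeneousIdeal 𝔞) (h : ↥(stableHilbertPoset 𝔞 t)) (D : ℕ) :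
    h.1 D + idealDim (extIdeal 𝔞 t) D = familyDim (someFamily h) D (D + 1) := by
  have := hilb_add_eq_familyDim _ (h.2.choose_spec.1.comap_eq h𝔞) D
  rwa [h.2.choose_spec.2] at this

section

variable (h𝔞 : IsHomogeneousIdeal 𝔞) (hεR : IsHilbertEmbedding εR)

/-- The slices of the value of the induced embedding at a Hilbert series. -/
def embeddingFamily (t : ℕ∞)
    (εR : ↥(hilbertPoset k σ (BaseRing 𝔞)) ↪o ↥(idealPoset k σ (BaseRing 𝔞)))
    (h : ↥(stableHilbertPoset 𝔞 t)) : ℕ → Ideal (MvPolynomial σ k) :=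
  inducedFamily 𝔞 t (liftEmbedding h𝔞 εR) (someFamily h)

include hεR in
lemma isStableFamily_embeddingFamily (h : ↥(stableHilbertPoset 𝔞 t)) :
    IsStableFamily 𝔞 t (embeddingFamily h𝔞 t εR h) :=
  isStableFamily_inducedFamily (isStableFamily_someFamily h𝔞 h)
    (isHilbertLift_liftEmbedding h𝔞 hεR) h𝔞

include hεR in
/-- The value of the induced embedding does not depend on the choice of an ideal with the given
Hilbert series. -/
lemma embeddingFamily_stableHilbOf (J : {J : Ideal (ExtRing 𝔞 t) // IsZStable J}) :
    embeddingFamily h𝔞 t εR (stableHilbOf J) = inducedFamily 𝔞 t (liftEmbedding h𝔞 εR)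
      (slicesOf (J.1.comap (Ideal.Quotient.mk (extIdeal 𝔞 t)))) := by
  have h1 := isStableFamily_someFamily h𝔞 (stableHilbOf J)
  have h2 := J.2.isStableFamily h𝔞
  have heq : ∀ D, familyDim (someFamily (stableHilbOf J)) D (D + 1) = familyDim
      (slicesOf (J.1.comap (Ideal.Quotient.mk (extIdeal 𝔞 t)))) D (D + 1) := fun D => by
    rw [← familyDim_someFamily h𝔞, ← hilb_add_eq_familyDim _ (J.2.comap_eq h𝔞)]
    rfl
  have hε := isHilbertLift_liftEmbedding h𝔞 hεR
  exact funext fun l => le_antisymm (inducedFamily_mono h1 h2 hε h𝔞 (fun D => (heq D).le) l)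
    (inducedFamily_mono h2 h1 hε h𝔞 (fun D => (heq D).ge) l)

/-- The values of the induced embedding. -/
def embeddingFun (h : ↥(stableHilbertPoset 𝔞 t)) : ↥(idealPoset k (Option σ) (ExtRing 𝔞 t)) :=
  ⟨(isStableFamily_embeddingFamily h𝔞 hεR h).toIdeal,
    ((isStableFamily_embeddingFamily h𝔞 hεR h).isZStable_toIdeal h𝔞).mem_idealPoset h𝔞⟩

lemma comap_embeddingFun (h : ↥(stableHilbertPoset 𝔞 t)) :
    (embeddingFun h𝔞 hεR h).1.comap (Ideal.Quotient.mk (extIdeal 𝔞 t)) =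
      ofSlices _ (isStableFamily_embeddingFamily h𝔞 hεR h).monotone :=
  (isStableFamily_embeddingFamily h𝔞 hεR h).comap_toIdeal

lemma hilb_embeddingFun (h : ↥(stableHilbertPoset 𝔞 t)) :
    hilb k (Option σ) (embeddingFun h𝔞 hεR h).1 = h.1 := by
  funext D
  have h1 := hilb_add_eq_familyDim _ (comap_embeddingFun h𝔞 hεR h) D
  have h2 := familyDim_someFamily h𝔞 h D
  have h3 := familyDim_inducedFamily (isStableFamily_someFamily h𝔞 h)
    (isHilbertLift_liftEmbedding h𝔞 hεR) h𝔞 D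
  rw [embeddingFamily] at h1
  omega

lemma embeddingFun_le_iff (a b : ↥(stableHilbertPoset 𝔞 t)) :
    embeddingFun h𝔞 hεR a ≤ embeddingFun h𝔞 hεR b ↔ a ≤ b := by
  constructor
  · intro h
    have : hilb k (Option σ) (embeddingFun h𝔞 hεR a).1 ≤
        hilb k (Option σ) (embeddingFun h𝔞 hεR b).1 :=
      hilb_le_iff.2 fun d => idealDim_mono (Ideal.comap_mono h) d
    rwa [hilb_embeddingFun, hilb_embeddingFun] at this
  · intro h
    refine Ideal.map_mono (ofSlices_mono fun l => inducedFamily_mono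
      (isStableFamily_someFamily h𝔞 a) (isStableFamily_someFamily h𝔞 b)
      (isHilbertLift_liftEmbedding h𝔞 hεR) h𝔞 (fun D => ?_) l)
    rw [← familyDim_someFamily h𝔞, ← familyDim_someFamily h𝔞]
    exact Nat.add_le_add_right (h D) _

/-- The embedding induced on the Hilbert series of `z`-stable ideals. -/
def inducedEmbedding :
    ↥(stableHilbertPoset 𝔞 t) ↪o ↥(idealPoset k (Option σ) (ExtRing 𝔞 t)) :=
  OrderEmbedding.ofMapLEIff (embeddingFun h𝔞 hεR) (embeddingFun_le_iff h𝔞 hεR)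

lemma isInducedEmbedding_inducedEmbedding :
    IsInducedEmbedding εR (inducedEmbedding (t := t) h𝔞 hεR) where
  hilb_eq := hilb_embeddingFun h𝔞 hεR
  isZStable h := (isStableFamily_embeddingFamily h𝔞 hεR h).isZStable_toIdeal h𝔞
  slice_mem h i hi := by
    have h1 := map_inducedFamily (isStableFamily_someFamily h𝔞 h)
      (isHilbertLift_liftEmbedding h𝔞 hεR) h𝔞 hi
    have h2 := isStableFamily_embeddingFamily h𝔞 hεR h
    change liftEmbedding h𝔞 εR (embeddingFamily h𝔞 t εR h i) = embeddingFamily h𝔞 t εR h i at h1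
    rw [liftEmbedding_of_isIdealOver h𝔞 εR (h2.isIdealOver i)] at h1
    refine ⟨_, Ideal.comap_injective_of_surjective _ Ideal.Quotient.mk_surjective (h1.trans ?_)⟩
    exact (h2.comap_slice_toIdeal i).symm
  restriction J i hi := by
    have h1 := J.2.isStableFamily h𝔞
    have hε := isHilbertLift_liftEmbedding h𝔞 hεR
    refine hilb_le_iff.2 fun D => ?_
    have h2 := comap_sup_span _ (comap_embeddingFun h𝔞 hεR (stableHilbOf J)) i
    rw [comap_sup_span _ (J.2.comap_eq h𝔞) i]
    refine (congrArg (idealDim · (D : ℤ)) h2).le.trans ?_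
    rcases Nat.le_total i (D + 1) with hD | hD
    · rw [idealDim_truncate (isStableFamily_embeddingFamily h𝔞 hεR _).monotone hD,
        idealDim_truncate h1.monotone hD, embeddingFamily_stableHilbOf h𝔞 hεR]
      refine Nat.add_le_add_right (familyDim_inducedFamily_le h1 hε h𝔞 ?_) _
      rcases hD.lt_or_eq with hlt | rfl
      · exact (lt_sliceCount.2 ⟨hi, by omega⟩).le
      · exact lt_sliceCount.2 ⟨(Nat.cast_lt.2 D.lt_succ_self).trans hi, le_rfl⟩
    · rw [idealDim_truncate_of_ge (isStableFamily_embeddingFamily h𝔞 hεR _).monotone hD,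
        idealDim_truncate_of_ge h1.monotone hD,
        embeddingFamily_stableHilbOf h𝔞 hεR]
      exact (familyDim_inducedFamily h1 hε h𝔞 D).le

end

/-- The conditions on the Hilbert functions of truncations, applied to two induced embeddings in
both directions, force the slices to have the same Hilbert functions, so that they are equal. -/
lemma IsInducedEmbedding.eq (h𝔞 : IsHomogeneousIdeal 𝔞) (hεR : IsHilbertEmbedding εR)
    {εS εS' : ↥(stableHilbertPoset 𝔞 t) ↪o ↥(idealPoset k (Option σ) (ExtRing 𝔞 t))}
    (hS : IsInducedEmbedding εR εS) (hS' : IsInducedEmbedding εR εS') : εS = εS' := by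
  -- minimality of the one embedding among the `z`-stable ideals is applied to the other one
  have key : ∀ {εS εS' : ↥(stableHilbertPoset 𝔞 t) ↪o ↥(idealPoset k (Option σ) (ExtRing 𝔞 t))},
      IsInducedEmbedding εR εS → IsInducedEmbedding εR εS' → ∀ h, ∀ i : ℕ, (i : ℕ∞) < t →
        hilb k (Option σ) ((εS h).1 ⊔ Ideal.span {zElt 𝔞 t ^ i}) ≤
          hilb k (Option σ) ((εS' h).1 ⊔ Ideal.span {zElt 𝔞 t ^ i}) := by
    intro εS εS' hS hS' h i hi
    have := hS.restriction ⟨(εS' h).1, hS'.isZStable h⟩ i hi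
    rwa [show stableHilbOf ⟨(εS' h).1, hS'.isZStable h⟩ = h from
      Subtype.ext (hS'.hilb_eq h)] at this
  refine DFunLike.ext _ _ fun h => Subtype.ext ?_
  have hJ := hS.isZStable h
  have hJ' := hS'.isZStable h
  have hF := hJ.isStableFamily h𝔞
  have hF' := hJ'.isStableFamily h𝔞
  have hdim : ∀ D i, i ≤ sliceCount t D →
      familyDim (slicesOf ((εS h).1.comap (Ideal.Quotient.mk (extIdeal 𝔞 t)))) D i =
      familyDim (slicesOf ((εS' h).1.comap (Ideal.Quotient.mk (extIdeal 𝔞 t)))) D i := by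
    intro D i hi
    rcases hi.lt_or_eq with hlt | rfl
    · obtain ⟨hit, hiD⟩ := lt_sliceCount.1 hlt
      have heq := idealDim_eq_of_hilb_eq
        (le_antisymm (key hS hS' h i hit) (key hS' hS h i hit)) D
      rw [comap_sup_span _ (hJ.comap_eq h𝔞), comap_sup_span _ (hJ'.comap_eq h𝔞),
        idealDim_truncate hF.monotone (by omega),
        idealDim_truncate hF'.monotone (by omega)] at heq
      exact Nat.add_right_cancel heq
    · have h1 := hilb_add_eq_familyDim _ (hJ.comap_eq h𝔞) D
      have h2 := hilb_add_eq_familyDim _ (hJ'.comap_eq h𝔞) D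
      rw [hS.hilb_eq, familyDim_eq hF] at h1
      rw [hS'.hilb_eq, familyDim_eq hF'] at h2
      exact Nat.add_right_cancel (h1.symm.trans h2)
  -- slices in the image of the given embedding are determined by their Hilbert series
  have hslice : ∀ l : ℕ, (l : ℕ∞) < t → slice (εS h).1 l = slice (εS' h).1 l := by
    intro l hl
    obtain ⟨g, hg⟩ := hS.slice_mem h l hl
    obtain ⟨g', hg'⟩ := hS'.slice_mem h l hl
    rw [← hg, ← hg']
    congr 2
    refine Subtype.ext ?_
    rw [← hεR g, ← hεR g', hg, hg']
    funext m
    have h1 := hilb_add_idealDim (slice (εS h).1 l) m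
    have h2 := hilb_add_idealDim (slice (εS' h).1 l) m
    rw [comap_slice, idealDim_eq_of_familyDim_eq hdim hl m, ← comap_slice, ← h2] at h1
    exact Nat.add_right_cancel h1
  refine Ideal.comap_injective_of_surjective _ Ideal.Quotient.mk_surjective ?_
  rw [hJ.comap_eq h𝔞, hJ'.comap_eq h𝔞]
  refine ofSlices_congr (funext fun l => ?_)
  rcases lt_or_ge (l : ℕ∞) t with hl | hl
  · rw [← comap_slice, ← comap_slice, hslice l hl]
  · rw [hF.eq_top l hl, hF'.eq_top l hl]

lemma obtainedByConsecutiveCancellations_inducedEmbedding (h𝔞 : IsHomogeneousIdeal 𝔞)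
    (hεR : IsHilbertEmbedding εR) (ht : 1 ≤ t)
    (hB : ∀ I : ↥(idealPoset k σ (BaseRing 𝔞)), ObtainedByConsecutiveCancellations
      (bettiTable k σ (BaseRing 𝔞 ⧸ I.1)) (bettiTable k σ (BaseRing 𝔞 ⧸ (εR (hilbOf I)).1)))
    (J : {J : Ideal (ExtRing 𝔞 t) // IsZStable J}) : ObtainedByConsecutiveCancellations
      (bettiTable k (Option σ) (ExtRing 𝔞 t ⧸ J.1))
      (bettiTable k (Option σ) (ExtRing 𝔞 t ⧸ (inducedEmbedding h𝔞 hεR (stableHilbOf J)).1)) := by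
  obtain ⟨G⟩ := nonempty_koszulMatrices k σ
  have hF := J.2.isStableFamily h𝔞
  have hε := isHilbertLift_liftEmbedding h𝔞 hεR
  have hB' : ∀ I, IsIdealOver 𝔞 I → ∀ i (m : ℕ),
      Module.finrank k (G.idealBounds (liftEmbedding h𝔞 εR I) i m) ≤
        Module.finrank k (G.idealBounds I i m) := by
    intro I hI
    have h1 := hε.isIdealOver I hI
    have h2 := hε.idealDim_eq I hI
    rw [liftEmbedding_of_isIdealOver h𝔞 εR hI] at h1 h2 ⊢
    have h3 := comap_map_mk hI.le
    exact (obtainedByConsecutiveCancellations_iff_finrank_idealBounds G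
      (isGradedQuotient_quotient (by rw [h3]; exact hI.isHomogeneous))
      (isGradedQuotient_quotient h1.isHomogeneous)
      ((ker_algebraMap_quotient _).trans h3) (ker_algebraMap_quotient _)
      (fun n => (h2 n).symm)).1 (hB ⟨_, hI.map_mem_idealPoset h𝔞⟩)
  have hL := isStableFamily_inducedFamily hF hε h𝔞
  have hLc : (inducedEmbedding h𝔞 hεR (stableHilbOf J)).1.comap
      (Ideal.Quotient.mk (extIdeal 𝔞 t)) = ofSlices _ hL.monotone :=
    (comap_embeddingFun h𝔞 hεR _).trans
      (ofSlices_congr (embeddingFamily_stableHilbOf h𝔞 hεR J))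
  have hJc := J.2.comap_eq h𝔞
  have hhom : IsHomogeneousIdeal (J.1.comap (Ideal.Quotient.mk (extIdeal 𝔞 t))) := by
    rw [hJc]
    exact isHomogeneousIdeal_ofSlices _ fun l => (hF.isIdealOver l).isHomogeneous
  have hhomL : IsHomogeneousIdeal ((inducedEmbedding h𝔞 hεR (stableHilbOf J)).1.comap
      (Ideal.Quotient.mk (extIdeal 𝔞 t))) := by
    rw [hLc]
    exact isHomogeneousIdeal_ofSlices _ fun l => (hL.isIdealOver l).isHomogeneous
  refine (obtainedByConsecutiveCancellations_iff_finrank_idealBounds G.cone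
    (isGradedQuotient_quotient hhom) (isGradedQuotient_quotient hhomL)
    ((ker_algebraMap_quotient _).trans hJc) ((ker_algebraMap_quotient _).trans hLc)
    (fun n => ?_)).2 (finrank_cone_idealBounds_inducedFamily_le hF hε h𝔞 ht hB')
  rw [← hJc, ← hLc]
  exact idealDim_eq_of_hilb_eq (hilb_embeddingFun h𝔞 hεR (stableHilbOf J)).symm n

end Embedding

end PosetEmbedding

end

theorem mainTheorem2 {k : Type*} [Field k] {σ : Type*} [Finite σ]
    (𝔞 : Ideal (MvPolynomial σ k))
    (h𝔞 : PosetEmbedding.IsGradedIdeal (MvPolynomial.homogeneousSubmodule σ k) 𝔞)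
    (t : ℕ∞) (ht : 1 ≤ t)
    (εR : ↥(PosetEmbedding.hilbertPoset k σ (PosetEmbedding.BaseRing 𝔞)) ↪o
      ↥(PosetEmbedding.idealPoset k σ (PosetEmbedding.BaseRing 𝔞)))
    (hεR : PosetEmbedding.IsHilbertEmbedding εR) :
    ∃ εS : ↥(PosetEmbedding.stableHilbertPoset 𝔞 t) ↪o
        ↥(PosetEmbedding.idealPoset k (Option σ) (PosetEmbedding.ExtRing 𝔞 t)),
      PosetEmbedding.IsInducedEmbedding εR εS ∧
      (∀ εS', PosetEmbedding.IsInducedEmbedding εR εS' → εS' = εS) ∧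
      ((∀ I : ↥(PosetEmbedding.idealPoset k σ (PosetEmbedding.BaseRing 𝔞)),
          PosetEmbedding.ObtainedByConsecutiveCancellations
            (PosetEmbedding.bettiTable k σ (PosetEmbedding.BaseRing 𝔞 ⧸ I.1))
            (PosetEmbedding.bettiTable k σ
              (PosetEmbedding.BaseRing 𝔞 ⧸ (εR (PosetEmbedding.hilbOf I)).1))) →
        ∀ J : {J : Ideal (PosetEmbedding.ExtRing 𝔞 t) // PosetEmbedding.IsZStable J},
          PosetEmbedding.ObtainedByConsecutiveCancellations
            (PosetEmbedding.bettiTable k (Option σ) (PosetEmbedding.ExtRing 𝔞 t ⧸ J.1))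
            (PosetEmbedding.bettiTable k (Option σ)
              (PosetEmbedding.ExtRing 𝔞 t ⧸ (εS (PosetEmbedding.stableHilbOf J)).1))) := by
  have h := PosetEmbedding.isHomogeneousIdeal_of_isGradedIdeal h𝔞
  exact ⟨PosetEmbedding.inducedEmbedding h hεR,
    PosetEmbedding.isInducedEmbedding_inducedEmbedding h hεR,
    fun εS' hS' => hS'.eq h hεR (PosetEmbedding.isInducedEmbedding_inducedEmbedding h hεR),
    fun hB J =>
      PosetEmbedding.obtainedByConsecutiveCancellations_inducedEmbedding h hεR ht hB J⟩
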